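/- **Setting.** Let $\Bbbk$ be a field and $m\ge 0$. Let $Q$ be the quiver with vertices $e_0,\dots,e_m$ and arrows $p_i\colon e_{i-1}\to e_i$ and $q_{i-1}\colon e_i\to e_{i-1}$ ($1\le i\le m$), $s_i\colon e_i\to e_i$ ($0\le i\le m$); paths are composed from right to left. Consider the reduction system $$q_ip_{i+1}\mapsto s_i,\qquad p_iq_{i-1}\mapsto s_i,\qquad s_ip_i\mapsto p_is_{i-1},\qquad s_iq_i\mapsto q_is_{i+1},$$ let $S$ be its set of left-hand sides $t$, with $t\mapsto\varphi_t$, and let $A=\Bbbk Q/I$ with $I=\langle t-\varphi_t\mid t\in S\rangle$ and $\pi\colon\Bbbk Q\to A$ the projection. Write $w\preceq w'$ if the path $w'$ can be turned into $w$ by finitely many (possibly no) replacements of a subpath $t\in S$ by $\varphi_t$. Every path reduces to exactly one irreducible path (one without subpath in $S$), and the irreducible paths form a basis of $A$, by which $A$ is regarded as a subspace of $\Bbbk Q$. All tensor products are over $\Bbbk Q_0$. Let $S_n$ be the set of paths of length $n$ all of whose subpaths of length two lie in $S$ (so $S_0=Q_0$, $S_1=Q_1$, $S_2=S$), let $P_n=A\otimes\Bbbk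 S_n\otimes A$ for $n\ge0$ and $P_{-1}=A$, and $$\mathrm{split}_n(w)=\sum_{w=urv,\ r\in S_n}\pi(u)\otimes r\otimes\pi(v)\in P_n .$$ *Chouhy–Solotar resolution.* Let $\delta_0(x\otimes y)=\pi(xy)$ and, for $n\ge1$, $\delta_n(x\otimes w\otimes y)=x\cdot\mathrm{split}_{n-1}(w)\cdot y$ for $n$ even and $x\cdot(\mathrm{split}^{L}_{n-1}(w)-\mathrm{split}^{R}_{n-1}(w))\cdot y$ for $n$ odd, where $\mathrm{split}^{L}_{n-1}(w)$, $\mathrm{split}^{R}_{n-1}(w)$ are the summands of $\mathrm{split}_{n-1}(w)$ for the leftmost and the rightmost subpath of $w$ in $S_{n-1}$. Let $\gamma_{-1}(x)=1\otimes x$, $\gamma_{n-1}(x\otimes w\otimes y)=(-1)^n\,\mathrm{split}_n(xw)\cdot y$ for $n\ge 1$ and irreducible $x$. Define recursively $\partial_0=\delta_0$, $\rho_{-1}=\gamma_{-1}$, and for $n\ge1$ $$\partial_n(x\otimes w\otimes y)=x\cdot\big((\mathrm{id}-\rho_{n-2}\partial_{n-1})\delta_n\big)(1\otimes w\otimes1)\cdot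 y,\qquad \rho_{n-1}=\gamma_{n-1}+\sum_{i\ge1}\gamma_{n-1}(\delta_n\gamma_{n-1}-\partial_n\gamma_{n-1})^i .$$ *Comparison map.* Let $\mathrm{Bar}_n=A\otimes\bar A^{\otimes n}\otimes A$, $\bar A=A/\Bbbk Q_0$, be the normalized bar resolution, with $\bar\partial_0$ the multiplication and, for $n\ge 1$, $$\bar\partial_n(a_{n+1}\otimes[a_n|\cdots|a_1]\otimes a_0)=a_{n+1}\otimes[a_n|\cdots|a_2]\otimes a_1a_0+\sum_{i=1}^{n-1}(-1)^ia_{n+1}\otimes[a_n|\cdots|a_{i+1}a_i|\cdots|a_1]\otimes a_0+(-1)^na_{n+1}a_n\otimes[a_{n-1}|\cdots|a_1]\otimes a_0 .$$ The comparison map $G_n\colon\mathrm{Bar}_n\to P_n$ of the Barmeier–Wang homotopy deformation retract is given by $G_{-1}=\mathrm{id}_A$ and $G_n(a\otimes y\otimes b)=a\cdot\rho_{n-1}G_{n-1}\bar\partial_n(1\otimes y\otimes b)$. **Theorem.** For all $n\ge0$ the sum defining $\rho_n$ is finite on every basis element of $P_n$. Let $n\ge0$, let $y_n,\dots,y_1$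 be irreducible paths of positive length whose concatenation $y_n\cdots y_1$ is a path (for $n=0$: a vertex $e_i$), and let $T(y_n\cdots y_1)$ be the set of all pure tensors $\pi(u)\otimes r\otimes\pi(v)$ which occur as a summand of $\mathrm{split}_n(w)$ for some $w\preceq y_n\cdots y_1$. Then $T(y_n\cdots y_1)$ is finite and, for all $a,b\in A$, $$G_n(a\otimes[y_n|\cdots|y_1]\otimes b)=a\cdot\Big(\sum_{\tau\in T(y_n\cdots y_1)}\tau\Big)\cdot b ,$$ that is, $G_n(a\otimes[y_n|\cdots|y_1]\otimes b)=a\cdot\sum_{w\preceq y_n\cdots y_1}\mathrm{split}_n(w)\cdot b$, where every pure tensor arising from different $w$ is counted only once (for $n=0$ the left-hand side is $G_0(ae_i\otimes e_ib)$). For $n\ge2$ the set $T(y_n\cdots y_1)$ is described as follows. Say that a path crosses the red strand $x_{j+1}$ ($0\le j<m$) if one of its endpoints is among $e_0,\dots,e_j$ and the other among $e_{j+1},\dots,e_m$. For each strand $x_{j+1}$ crossed by all of $y_{n-1},\dots,y_1$, let $c\in\{p_{j+1},q_j\}$ be the arrow at which $y_{n-1}=y'cy''$ crosses it, let $\bar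 c$ be the other arrow of $\{p_{j+1},q_j\}$, and let $\pi(y_ny')=a\,s^M$ with $a$ a path without loops $s$. The elements of $T(y_n\cdots y_1)$ are * for each $0\le d<M$ ($d$ of the $M$ top dots have been dropped): $\;a\,s^{M-d-1}\otimes (s\,c\,\bar c\,c\cdots)\otimes v$, where $c\,\bar c\,c\cdots$ has length $n-1$; * if $y_n$ crosses the strand too, at $y_n=a'\bar c z$ (all top dots have been dropped): $\;a'\otimes(\bar c\,c\,\bar c\cdots)\otimes v$, where $\bar c\,c\,\bar c\cdots$ has length $n$; where in each case $v$ is the unique irreducible path with the source of $y_1$ such that the tensor $u\otimes r\otimes v$ is composable and $\pi(urv)=\pi(y_n\cdots y_1)$. -/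

import Mathlib

namespace KLRW

open Relation

/-! ### The quiver, its paths and its reduction system

For `m` red strands (punctures) the quiver `Q` has the vertices `e_0, …, e_m`.  At the vertex `e_a`
start at most three arrows: `p` (that is `p_{a+1} : e_a → e_{a+1}`), `q`
(that is `q_{a-1} : e_a → e_{a-1}`) and the loop `s` (that is `s_a`).  Hence a path is determined by
its source and by its word in the letters `p`, `q`, `s`.  Words are written as in
`u_{k-1} ⋯ u_1 u_0`: the rightmost letter is traversed first. -/

inductive Arrow
  | p
  | q
  | s
  deriving DecidableEq

open Arrow

/-- Words in the letters `p`, `q`, `s`. -/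
abbrev Word := List Arrow

/-- A word starting at `e_a` ends at `e_{a + shift w}`. -/
def shift (w : Word) : ℤ := (w.count p : ℤ) - (w.count q : ℤ)

/-- `w`, read from right to left starting at `e_a`, is a path of the quiver with the vertices
`e_0, …, e_m`: all vertices it visits exist. -/
def IsPath (m : ℕ) (a : ℤ) (w : Word) : Prop :=
  ∀ t : Word, t <:+ w → 0 ≤ a + shift t ∧ a + shift t ≤ m

/-- The reduction system `R`, as pairs `(s, φ_s)`:
`q_i p_{i+1} ↦ s_i`, `p_i q_{i-1} ↦ s_i`, `s_i p_i ↦ p_i s_{i-1}`, `s_i q_i ↦ q_i s_{i+1}`. -/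
inductive Rule : Word → Word → Prop
  | qp : Rule [q, p] [s]
  | pq : Rule [p, q] [s]
  | sp : Rule [s, p] [p, s]
  | sq : Rule [s, q] [q, s]

/-- The set `S` of left-hand sides of the reduction system. -/
def InS (w : Word) : Prop := ∃ f, Rule w f

/-- A path is irreducible if it contains no element of `S` as a subpath. -/
def Irr (w : Word) : Prop := ∀ t, InS t → ¬ t <:+: w

/-- The set `S_n`.  `S_0` consists of the vertices, `S_1` of the arrows, `S_2 = S`, and for `n > 2`
the elements of `S_n` are the `(n-2)`-ambiguities, i.e. (as all elements of `S` have length two)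
the paths `u_{n-1} ⋯ u_1 u_0` with arrows `u_i` such that every `u_{i+1} u_i` is in `S`. -/
def Amb (n : ℕ) (w : Word) : Prop := w.length = n ∧ w.IsChain (fun x y => InS [x, y])

/-- One reduction: a subpath `t ∈ S` is replaced by `φ_t`. -/
inductive Step : Word → Word → Prop
  | mk (u t f v : Word) (h : Rule t f) : Step (u ++ t ++ v) (u ++ f ++ v)

/-- `Reduces w w'` is the relation `w' ⪯ w`.  Since every `φ_t` is a single path with coefficient
one, reductions turn a path into a path. -/
def Reduces : Word → Word → Prop := ReflTransGen Step

/-- The irreducible path to which `w` reduces, `a_{ji} s_i^α`; it represents `π(w)`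
(see `reduces_nf`, `irr_nf`, `nf_unique` and `nf_eq_iff`). -/
def nf (w : Word) : Word :=
  List.replicate (w.count p - w.count q) p ++ List.replicate (w.count q - w.count p) q ++
    List.replicate (w.count s + min (w.count p) (w.count q)) s

/-! ### Reduction uniqueness -/

theorem shift_append (u v : Word) : shift (u ++ v) = shift u + shift v := by
  simp only [shift, List.count_append]; push_cast; ring

theorem shift_nil : shift [] = 0 := by simp [shift]

theorem isPath_append (m : ℕ) (a : ℤ) (u v : Word) :
    IsPath m a (u ++ v) ↔ IsPath m a v ∧ IsPath m (a + shift v) u := by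
  constructor
  · intro h
    refine ⟨fun t ht => h t (ht.trans (List.suffix_append u v)), fun t ht => ?_⟩
    have := h (t ++ v) (by obtain ⟨z, rfl⟩ := ht; exact ⟨z, by simp⟩)
    rw [shift_append] at this
    constructor <;> linarith [this.1, this.2]
  · rintro ⟨h1, h2⟩ t ht
    rcases List.suffix_or_suffix_of_suffix ht (List.suffix_append u v) with h | h
    · exact h1 t h
    · obtain ⟨z, rfl⟩ := h
      have hz : z <:+ u := by
        obtain ⟨y, hy⟩ := ht
        rw [← List.append_assoc] at hy
        exact ⟨y, List.append_cancel_right hy⟩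
      have := h2 z hz
      rw [shift_append]
      constructor <;> linarith [this.1, this.2]

theorem isPath_cons (m : ℕ) (a : ℤ) (x : Arrow) (v : Word) :
    IsPath m a (x :: v) ↔
      IsPath m a v ∧ 0 ≤ a + shift (x :: v) ∧ a + shift (x :: v) ≤ m := by
  constructor
  · intro h
    exact ⟨fun t ht => h t (ht.trans (List.suffix_cons x v)), h _ List.suffix_rfl⟩
  · rintro ⟨h1, h2⟩ t ht
    rcases List.suffix_cons_iff.1 ht with rfl | h
    · exact h2
    · exact h1 t h

theorem isPath_nil (m : ℕ) (a : ℤ) : IsPath m a [] ↔ 0 ≤ a ∧ a ≤ m := by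
  simp [IsPath, shift]

theorem rule_shift {t f : Word} (h : Rule t f) : shift f = shift t := by
  cases h <;> decide

theorem rule_isPath {m : ℕ} {a : ℤ} {t f : Word} (h : Rule t f) (ht : IsPath m a t) :
    IsPath m a f := by
  cases h <;> simp only [isPath_cons, isPath_nil] at ht ⊢ <;>
    simp [shift] at ht ⊢ <;> omega

theorem step_isPath {m : ℕ} {a : ℤ} {w w' : Word} (h : Step w w') (hw : IsPath m a w) :
    IsPath m a w' := by
  obtain ⟨u, t, f, v, hr⟩ := h
  simp only [isPath_append, rule_shift hr] at hw ⊢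
  exact ⟨hw.1, rule_isPath hr hw.2.1, hw.2.2⟩

theorem reduces_isPath {m : ℕ} {a : ℤ} {w w' : Word} (h : Reduces w w') (hw : IsPath m a w) :
    IsPath m a w' := by
  induction h with
  | refl => exact hw
  | tail _ hs ih => exact step_isPath hs ih

theorem step_context {w w' : Word} (u v : Word) (h : Step w w') :
    Step (u ++ w ++ v) (u ++ w' ++ v) := by
  obtain ⟨u', t, f, v', hr⟩ := h
  have := Step.mk (u ++ u') t f (v' ++ v) hr
  simpa [List.append_assoc] using this

theorem reduces_context {w w' : Word} (u v : Word) (h : Reduces w w') :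
    Reduces (u ++ w ++ v) (u ++ w' ++ v) := by
  induction h with
  | refl => exact ReflTransGen.refl
  | tail _ hs ih => exact ih.tail (step_context u v hs)

theorem reduces_s_replicate (x : Arrow) (hx : Rule [s, x] [x, s]) (n : ℕ) :
    Reduces (s :: List.replicate n x) (List.replicate n x ++ [s]) := by
  induction n with
  | zero => exact ReflTransGen.refl
  | succ n ih =>
    have h1 : Step (s :: List.replicate (n + 1) x) ([x] ++ (s :: List.replicate n x) ++ []) := by
      have := Step.mk [] _ _ (List.replicate n x) hx
      simpa [List.replicate_succ] using this
    have h2 := reduces_context [x] [] ih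
    have := ReflTransGen.head h1 h2
    simpa [Reduces, List.replicate_succ] using this

/-- Every path reduces to its normal form. -/
theorem reduces_nf (w : Word) : Reduces w (nf w) := by
  induction w with
  | nil => exact ReflTransGen.refl
  | cons x w ih =>
    have h1 : Reduces (x :: w) (x :: nf w) := by
      have := reduces_context [x] [] ih
      simpa using this
    refine h1.trans ?_
    unfold nf
    rcases Nat.lt_or_ge (w.count p) (w.count q) with h | h
    · obtain ⟨b, hb⟩ : ∃ b, w.count q = w.count p + 1 + b := ⟨_, (Nat.add_sub_of_le h).symm⟩
      cases x
      · have h2 : Step ([p, q] ++ (List.replicate b q ++ List.replicate (w.count s + w.count p) s))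
            ([s] ++ (List.replicate b q ++ List.replicate (w.count s + w.count p) s)) := by
          have := Step.mk [] _ _ (List.replicate b q ++ List.replicate (w.count s + w.count p) s)
            Rule.pq
          simpa using this
        have h3 := reduces_context [] (List.replicate (w.count s + w.count p) s)
          (reduces_s_replicate q Rule.sq b)
        have h4 := ReflTransGen.head h2 (by simpa [Reduces] using h3)
        have e1 : w.count p + 1 - w.count q = 0 := by omega
        have e2 : w.count q - (w.count p + 1) = b := by omega
        have e3 : w.count q - w.count p = b + 1 := by omega
        have e4 : w.count p - w.count q = 0 := by omega
        have e5 : min (w.count p + 1) (w.count q) = w.count p + 1 := by omega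
        have e6 : min (w.count p) (w.count q) = w.count p := by omega
        have e7 : w.count s + (w.count p + 1) = (w.count s + w.count p) + 1 := by omega
        simpa [e1, e2, e3, e4, e5, e6, e7, List.replicate_succ] using h4
      · have e1 : w.count p - (w.count q + 1) = 0 := by omega
        have e2 : (w.count q + 1) - w.count p = (w.count q - w.count p) + 1 := by omega
        have e4 : w.count p - w.count q = 0 := by omega
        have e5 : min (w.count p) (w.count q + 1) = w.count p := by omega
        have e6 : min (w.count p) (w.count q) = w.count p := by omega
        simp [e1, e2, e4, e5, e6, List.replicate_succ]
        exact ReflTransGen.refl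
      · have h3 := reduces_context [] (List.replicate (w.count s + w.count p) s)
          (reduces_s_replicate q Rule.sq (w.count q - w.count p))
        have e4 : w.count p - w.count q = 0 := by omega
        have e6 : min (w.count p) (w.count q) = w.count p := by omega
        have e7 : w.count s + 1 + w.count p = (w.count s + w.count p) + 1 := by omega
        simpa [e4, e6, e7, List.replicate_succ, Reduces] using h3
    · cases x
      · have e1 : w.count q - (w.count p + 1) = 0 := by omega
        have e2 : (w.count p + 1) - w.count q = (w.count p - w.count q) + 1 := by omega
        have e4 : w.count q - w.count p = 0 := by omega
        have e5 : min (w.count p + 1) (w.count q) = w.count q := by omega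
        have e6 : min (w.count p) (w.count q) = w.count q := by omega
        simp [e1, e2, e4, e5, e6, List.replicate_succ]
        exact ReflTransGen.refl
      · rcases Nat.eq_or_lt_of_le h with h | h
        · have e1 : w.count q + 1 - w.count p = 1 := by omega
          have e2 : w.count p - (w.count q + 1) = 0 := by omega
          have e3 : w.count q - w.count p = 0 := by omega
          have e4 : w.count p - w.count q = 0 := by omega
          have e5 : min (w.count p) (w.count q + 1) = w.count q := by omega
          have e6 : min (w.count p) (w.count q) = w.count q := by omega
          simp [e1, e2, e3, e4, e5, e6]
          exact ReflTransGen.refl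
        · obtain ⟨b, hb⟩ : ∃ b, w.count p = w.count q + 1 + b := ⟨_, (Nat.add_sub_of_le h).symm⟩
          have h2 : Step
              ([q, p] ++ (List.replicate b p ++ List.replicate (w.count s + w.count q) s))
              ([s] ++ (List.replicate b p ++ List.replicate (w.count s + w.count q) s)) := by
            have := Step.mk [] _ _
              (List.replicate b p ++ List.replicate (w.count s + w.count q) s) Rule.qp
            simpa using this
          have h3 := reduces_context [] (List.replicate (w.count s + w.count q) s)
            (reduces_s_replicate p Rule.sp b)
          have h4 := ReflTransGen.head h2 (by simpa [Reduces] using h3)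
          have e1 : w.count q + 1 - w.count p = 0 := by omega
          have e2 : w.count p - (w.count q + 1) = b := by omega
          have e3 : w.count p - w.count q = b + 1 := by omega
          have e4 : w.count q - w.count p = 0 := by omega
          have e5 : min (w.count p) (w.count q + 1) = w.count q + 1 := by omega
          have e6 : min (w.count p) (w.count q) = w.count q := by omega
          have e7 : w.count s + (w.count q + 1) = (w.count s + w.count q) + 1 := by omega
          simpa [e1, e2, e3, e4, e5, e6, e7, List.replicate_succ] using h4
      · have h3 := reduces_context [] (List.replicate (w.count s + w.count q) s)
          (reduces_s_replicate p Rule.sp (w.count p - w.count q))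
        have e4 : w.count q - w.count p = 0 := by omega
        have e6 : min (w.count p) (w.count q) = w.count q := by omega
        have e7 : w.count s + 1 + w.count q = (w.count s + w.count q) + 1 := by omega
        simpa [e4, e6, e7, List.replicate_succ, Reduces] using h3

theorem irr_of_isChain {w : Word} (h : w.IsChain (fun x y => ¬ InS [x, y])) : Irr w := by
  rintro t ⟨f, hf⟩ ⟨a, b, rfl⟩
  have key : ∀ x y : Arrow, InS [x, y] → (a ++ [x, y] ++ b).IsChain (fun x y => ¬ InS [x, y]) →
      False := by
    intro x y hxy hc
    rw [List.isChain_append] at hc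
    have := (List.isChain_append.1 hc.1).2.1
    simp at this
    exact this hxy
  cases hf
  · exact key _ _ ⟨_, Rule.qp⟩ h
  · exact key _ _ ⟨_, Rule.pq⟩ h
  · exact key _ _ ⟨_, Rule.sp⟩ h
  · exact key _ _ ⟨_, Rule.sq⟩ h

/-- Normal forms are irreducible. -/
theorem irr_nf (w : Word) : Irr (nf w) := by
  have hself : ∀ x : Arrow, ¬ InS [x, x] := by
    rintro x ⟨f, hf⟩; cases x <;> cases hf
  have hps : ¬ InS [p, s] := by rintro ⟨f, hf⟩; cases hf
  have hqs : ¬ InS [q, s] := by rintro ⟨f, hf⟩; cases hf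
  have hrep : ∀ (n : ℕ) (x : Arrow),
      (List.replicate n x).IsChain (fun x y => ¬ InS [x, y]) := fun n x =>
    List.isChain_replicate_of_rel n (hself x)
  have hcat : ∀ (a d : ℕ) (x : Arrow), ¬ InS [x, s] →
      (List.replicate a x ++ List.replicate d s).IsChain (fun x y => ¬ InS [x, y]) := by
    intro a d x hx
    refine List.IsChain.append (hrep a x) (hrep d s) ?_
    intro y hy z hz
    have hy' := List.eq_of_mem_replicate (List.mem_of_mem_getLast? hy)
    have hz' := List.eq_of_mem_replicate (List.mem_of_mem_head? hz)
    subst hy' hz'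
    exact hx
  apply irr_of_isChain
  unfold nf
  rcases le_total (w.count p) (w.count q) with h | h
  · rw [Nat.sub_eq_zero_of_le h]
    simpa using hcat _ _ q hqs
  · rw [Nat.sub_eq_zero_of_le h]
    simpa using hcat _ _ p hps

theorem step_nf {w w' : Word} (h : Step w w') : nf w' = nf w := by
  obtain ⟨u, t, f, v, hr⟩ := h
  have h1 : f.count p + t.count q = t.count p + f.count q := by cases hr <;> rfl
  have h2 : f.count s + min (f.count p) (f.count q) = t.count s + min (t.count p) (t.count q) := by
    cases hr <;> rfl
  have h3 : 2 * f.count s + f.count p + f.count q = 2 * t.count s + t.count p + t.count q := by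
    cases hr <;> rfl
  simp only [nf, List.count_append]
  congr 1
  · congr 2 <;> omega
  · congr 1
    omega

theorem irr_not_step {w w' : Word} (h : Irr w) : ¬ Step w w' := by
  rintro ⟨u, t, f, v, hr⟩
  exact h t ⟨f, hr⟩ ⟨u, v, rfl⟩

/-- Reduction uniqueness: the normal form is the only irreducible path a path reduces to. -/
theorem nf_unique {w w' : Word} (h : Reduces w w') (hw : Irr w') : w' = nf w := by
  have h1 : nf w' = nf w := by
    clear hw
    induction h with
    | refl => rfl
    | tail _ ht ih => rw [step_nf ht, ih]
  rcases (ReflTransGen.cases_head (reduces_nf w')) with h2 | ⟨z, hz, _⟩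
  · exact h2.trans h1
  · exact absurd hz (irr_not_step hw)

/-- Words have the same normal form exactly if they are identified by the relations `t = φ_t`.
(Reductions preserve being a path of the quiver, see `step_isPath`, so for parallel paths this is
equality modulo the ideal generated by the `t - φ_t`.) -/
theorem nf_eq_iff (u v : Word) : nf u = nf v ↔ EqvGen Step u v := by
  constructor
  · intro h
    have key : ∀ {a b : Word}, Reduces a b → EqvGen Step a b := by
      intro a b hab
      induction hab with
      | refl => exact EqvGen.refl _
      | tail _ hs ih => exact EqvGen.trans _ _ _ ih (EqvGen.rel _ _ hs)
    have h1 := key (reduces_nf u)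
    rw [h] at h1
    exact EqvGen.trans _ _ _ h1 (EqvGen.symm _ _ (key (reduces_nf v)))
  · intro h
    induction h with
    | rel _ _ h => exact (step_nf h).symm
    | refl => rfl
    | symm _ _ _ ih => exact ih.symm
    | trans _ _ _ _ _ ih1 ih2 => exact ih1.trans ih2

theorem shift_nf (w : Word) : shift (nf w) = shift w := by
  have : ∀ a b d : ℕ, shift (List.replicate a p ++ List.replicate b q ++ List.replicate d s)
      = a - b := by
    intro a b d
    simp [shift, List.count_append, List.count_replicate]
  rw [nf, this, shift]
  omega

theorem isPath_nf {m : ℕ} {a : ℤ} {w : Word} (h : IsPath m a w) : IsPath m a (nf w) :=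
  reduces_isPath (reduces_nf w) h

theorem isPath_nf_append {m : ℕ} {a : ℤ} {u v : Word} (h : IsPath m a (u ++ v)) :
    IsPath m a (nf u ++ nf v) := by
  rw [isPath_append] at h ⊢
  rw [shift_nf]
  exact ⟨isPath_nf h.1, isPath_nf h.2⟩

theorem reduces_flatten_nf (ys : List Word) : Reduces ys.flatten (ys.map nf).flatten := by
  induction ys with
  | nil => exact ReflTransGen.refl
  | cons y ys ih =>
    have h1 := reduces_context [] ys.flatten (reduces_nf y)
    have h2 := reduces_context (nf y) [] ih
    simp only [List.flatten_cons, List.map_cons]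
    exact ReflTransGen.trans (by simpa [Reduces] using h1) (by simpa [Reduces] using h2)

/-! ### The algebra and the bimodules, by their standard bases

All tensor products are over `𝕜 Q_0`, so a pure tensor of paths vanishes unless the paths are
composable, and the composable pure tensors of basis elements form a basis. -/

/-- Irreducible paths of the quiver. -/
@[ext] structure IrrPath (m : ℕ) where
  src : ℤ
  word : Word
  irr : Irr word
  isPath : IsPath m src word

/-- The basis `u ⊗ r ⊗ v` of `P_n = A ⊗ 𝕜 S_n ⊗ A`: `u = left` and `v = right` are irreducible,
`r = mid ∈ S_n`, and `u r v` is composable; `src` is the source of `v`. -/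
@[ext] structure Gen (m n : ℕ) where
  src : ℤ
  left : Word
  mid : Word
  right : Word
  left_irr : Irr left
  mid_amb : Amb n mid
  right_irr : Irr right
  isPath : IsPath m src (left ++ mid ++ right)

/-- The basis `x ⊗ [y_n|⋯|y_1] ⊗ z` of the normalized bar module `A ⊗ Ā^{⊗ n} ⊗ A`: all of
`x`, `y_n`, …, `y_1`, `z` are irreducible, the `y_i` (listed from `y_n` to `y_1`) are not vertices,
and `x y_n ⋯ y_1 z` is composable; `src` is the source of `z`. -/
@[ext] structure BarGen (m n : ℕ) where
  src : ℤ
  left : Word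
  mid : List Word
  right : Word
  left_irr : Irr left
  mid_length : mid.length = n
  mid_irr : ∀ y ∈ mid, Irr y ∧ y ≠ []
  right_irr : Irr right
  isPath : IsPath m src (left ++ mid.flatten ++ right)

section

variable (k : Type*) [Field k] (m : ℕ)

/-- The algebra `A = 𝕜Q/I` on its basis of irreducible paths. -/
abbrev A : Type _ := IrrPath m →₀ k

/-- The bimodule `P_n`. -/
abbrev P (n : ℕ) : Type _ := Gen m n →₀ k

/-- The normalized bar module `Bar_n`. -/
abbrev Bar (n : ℕ) : Type _ := BarGen m n →₀ k

open Classical in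
/-- `π(w) ∈ A` for the path `w` starting at `e_a`. -/
noncomputable def proj (a : ℤ) (w : Word) : A k m :=
  if h : IsPath m a w then Finsupp.single ⟨a, nf w, irr_nf w, isPath_nf h⟩ 1 else 0

open Classical in
/-- `π(u) ⊗ r ⊗ π(v) ∈ P_n` for the path `u r v` starting at `e_a`. -/
noncomputable def tens (n : ℕ) (a : ℤ) (u r v : Word) : P k m n :=
  if h : Amb n r ∧ IsPath m a (u ++ r ++ v) then
    Finsupp.single ⟨a, nf u, r, nf v, irr_nf u, h.1, irr_nf v, by
      have h2 := h.2
      rw [isPath_append, isPath_append] at h2 ⊢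
      rw [shift_nf]
      exact ⟨isPath_nf h2.1, h2.2.1, isPath_nf h2.2.2⟩⟩ 1
  else 0

open Classical in
/-- `π(x) ⊗ [π(y_n)|⋯|π(y_1)] ⊗ π(z) ∈ Bar_n` for the path `x y_n ⋯ y_1 z` starting at `e_a`;
it vanishes if some `π(y_i)` is a vertex. -/
noncomputable def barTens (n : ℕ) (a : ℤ) (x : Word) (ys : List Word) (z : Word) : Bar k m n :=
  if h : ys.length = n ∧ (∀ y ∈ ys, nf y ≠ []) ∧ IsPath m a (x ++ ys.flatten ++ z) then
    Finsupp.single ⟨a, nf x, ys.map nf, nf z, irr_nf x, by simpa using h.1, by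
      intro y hy
      obtain ⟨y', hy', rfl⟩ := List.mem_map.1 hy
      exact ⟨irr_nf y', h.2.1 y' hy'⟩, irr_nf z, by
      have h2 := reduces_isPath (reduces_context x z (reduces_flatten_nf ys)) h.2.2
      have h3 := reduces_isPath (reduces_context [] ((ys.map nf).flatten ++ z) (reduces_nf x))
        (by simpa using h2)
      have h4 := reduces_isPath (reduces_context (nf x ++ (ys.map nf).flatten) [] (reduces_nf z))
        (by simpa using h3)
      simpa using h4⟩ 1
  else 0

variable {m} in
/-- The vertex at which the path `u r v` underlying a basis element ends. -/
def Gen.tgt {n : ℕ} (t : Gen m n) : ℤ := t.src + shift (t.left ++ t.mid ++ t.right)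

/-- Left multiplication on `P_n` by the path `x` starting at `e_a`. -/
noncomputable def lact (n : ℕ) (a : ℤ) (x : Word) : P k m n →ₗ[k] P k m n :=
  Finsupp.linearCombination k fun t =>
    if a = t.tgt then tens k m n t.src (x ++ t.left) t.mid t.right else 0

/-- Right multiplication on `P_n` by the path `y` starting at `e_a`. -/
noncomputable def ract (n : ℕ) (a : ℤ) (y : Word) : P k m n →ₗ[k] P k m n :=
  Finsupp.linearCombination k fun t =>
    if a + shift y = t.src then tens k m n a t.left t.mid (t.right ++ y) else 0

variable {k m} in
/-- The left action of `A` on `P_n`. -/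
noncomputable def lmul {n : ℕ} (a : A k m) (f : P k m n) : P k m n :=
  a.sum fun x c => c • lact k m n x.src x.word f

variable {k m} in
/-- The right action of `A` on `P_n`. -/
noncomputable def rmul {n : ℕ} (f : P k m n) (b : A k m) : P k m n :=
  b.sum fun y c => c • ract k m n y.src y.word f

variable {k m} in
/-- The element `a ⊗ [y_n|⋯|y_1] ⊗ b` of `Bar_n` for `a, b ∈ A` and irreducible paths `y_i` such
that `y_n ⋯ y_1` is a path starting at `e_i`.  For `n = 0` this is `a e_i ⊗ e_i b`. -/
noncomputable def bar (n : ℕ) (a : A k m) (i : ℤ) (ys : List Word) (b : A k m) : Bar k m n :=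
  a.sum fun x c => b.sum fun z d => (c * d) •
    if x.src = i + shift ys.flatten ∧ z.src + shift z.word = i then
      barTens k m n z.src x.word ys z.word else 0

/-! ### The Chouhy–Solotar resolution -/

/-- `split_n(w)` for the path `w` starting at `e_a`: the sum of `π(u) ⊗ r ⊗ π(v)` over all
decompositions `w = u r v` with `r ∈ S_n`.  (Decompositions are indexed by the length `l` of `u`;
if the subpath of length `n` at this position does not exist or is not in `S_n`, `tens` is `0`.) -/
noncomputable def split (n : ℕ) (a : ℤ) (w : Word) : P k m n :=
  ∑ l ∈ Finset.range (w.length + 1),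
    tens k m n a (w.take l) ((w.drop l).take n) ((w.drop l).drop n)

/-- `split_n^L(w)` for `w ∈ S_{n+1}`; the leftmost subpath in `S_n` consists of the first `n`
letters. -/
noncomputable def splitL (n : ℕ) (a : ℤ) (w : Word) : P k m n :=
  tens k m n a [] (w.take n) (w.drop n)

/-- `split_n^R(w)` for `w ∈ S_{n+1}`; the rightmost subpath in `S_n` consists of the last `n`
letters. -/
noncomputable def splitR (n : ℕ) (a : ℤ) (w : Word) : P k m n :=
  tens k m n a (w.take 1) (w.drop 1) []

/-- `x · f · y` for the outer factors `x`, `y` of a basis element `x ⊗ w ⊗ y`. -/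
noncomputable def sandwich {n : ℕ} (n' : ℕ) (t : Gen m n) (f : P k m n') : P k m n' :=
  lact k m n' (t.src + shift (t.mid ++ t.right)) t.left (ract k m n' t.src t.right f)

/-- `1 ⊗ w ⊗ 1` for a basis element `x ⊗ w ⊗ y`. -/
noncomputable def core {n : ℕ} (t : Gen m n) : P k m n :=
  tens k m n (t.src + shift t.right) [] t.mid []

/-- `δ_{n+1} : P_{n+1} → P_n`. -/
noncomputable def delta (n : ℕ) : P k m (n + 1) →ₗ[k] P k m n :=
  Finsupp.linearCombination k fun t => sandwich k m n t
    (if Even (n + 1) then split k m n (t.src + shift t.right) t.mid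
     else splitL k m n (t.src + shift t.right) t.mid - splitR k m n (t.src + shift t.right) t.mid)

/-- `γ_n : P_n → P_{n+1}`, `x ⊗ w ⊗ y ↦ (-1)^{n+1} split_{n+1}(x w) · y`. -/
noncomputable def gamma (n : ℕ) : P k m n →ₗ[k] P k m (n + 1) :=
  Finsupp.linearCombination k fun t => (-1 : k) ^ (n + 1) •
    ract k m (n + 1) t.src t.right
      (split k m (n + 1) (t.src + shift t.right) (t.left ++ t.mid))

/-- `∂_0 = δ_0 : P_0 → A`, `x ⊗ y ↦ π(x y)`. -/
noncomputable def partialZero : P k m 0 →ₗ[k] A k m :=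
  Finsupp.linearCombination k fun t => proj k m t.src (t.left ++ t.right)

/-- `ρ_{-1} = γ_{-1} : A → P_0`, `x ↦ 1 ⊗ x`; all other summands of `ρ_{-1}` vanish because
`δ_0 = ∂_0`. -/
noncomputable def rhoNegOne : A k m →ₗ[k] P k m 0 :=
  Finsupp.linearCombination k fun x => tens k m 0 x.src [] [] x.word

/-- For a candidate `d` for `∂_{n+1}` and a basis element `t` of `P_n`, the `i`-th summand
`γ_n (δ_{n+1} γ_n - d γ_n)^i (t)` of `ρ_n(t)`. -/
noncomputable def rhoSummand (n : ℕ) (d : P k m (n + 1) →ₗ[k] P k m n) (t : Gen m n) (i : ℕ) :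
    P k m (n + 1) :=
  gamma k m n (((delta k m n ∘ₗ gamma k m n - d ∘ₗ gamma k m n) ^ i) (Finsupp.single t 1))

/-- `ρ_n = γ_n + ∑_{i ≥ 1} γ_n (δ_{n+1} γ_n - ∂_{n+1} γ_n)^i`. -/
noncomputable def rhoOf (n : ℕ) (d : P k m (n + 1) →ₗ[k] P k m n) : P k m n →ₗ[k] P k m (n + 1) :=
  Finsupp.linearCombination k fun t => ∑ᶠ i : ℕ, rhoSummand k m n d t i

/-- The pair `(∂_{n+1}, ρ_n)`, where
`∂_{n+1}(x ⊗ w ⊗ y) = x · ((id - ρ_{n-1} ∂_n) δ_{n+1})(1 ⊗ w ⊗ 1) · y`. -/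
noncomputable def resolution :
    (n : ℕ) → (P k m (n + 1) →ₗ[k] P k m n) × (P k m n →ₗ[k] P k m (n + 1))
  | 0 =>
    let d := Finsupp.linearCombination k fun t : Gen m 1 => sandwich k m 0 t
      (delta k m 0 (core k m t) -
        rhoNegOne k m (partialZero k m (delta k m 0 (core k m t))))
    (d, rhoOf k m 0 d)
  | n + 1 =>
    let d := Finsupp.linearCombination k fun t : Gen m (n + 2) => sandwich k m (n + 1) t
      (delta k m (n + 1) (core k m t) -
        (resolution n).2 ((resolution n).1 (delta k m (n + 1) (core k m t))))
    (d, rhoOf k m (n + 1) d)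

/-- The differential `∂_{n+1} : P_{n+1} → P_n` of the Chouhy–Solotar resolution. -/
noncomputable def diff (n : ℕ) : P k m (n + 1) →ₗ[k] P k m n := (resolution k m n).1

/-- The map `ρ_n : P_n → P_{n+1}`. -/
noncomputable def rho (n : ℕ) : P k m n →ₗ[k] P k m (n + 1) := (resolution k m n).2

/-! ### The normalized bar resolution and the comparison map -/

/-- `∂̄_0 : Bar_0 → A`, the multiplication. -/
noncomputable def barDiffZero : Bar k m 0 →ₗ[k] A k m :=
  Finsupp.linearCombination k fun g => proj k m g.src (g.left ++ g.right)

/-- The list `[a_n, …, a_{i+1} a_i, …, a_1]` for `ys = [a_n, …, a_1]` and `1 ≤ i ≤ n - 1`. -/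
def merge (n i : ℕ) (ys : List Word) : List Word :=
  ys.take (n - 1 - i) ++ ((ys.drop (n - 1 - i)).take 2).flatten :: ys.drop (n + 1 - i)

/-- `∂̄_{n+1} : Bar_{n+1} → Bar_n`. -/
noncomputable def barDiff (n : ℕ) : Bar k m (n + 1) →ₗ[k] Bar k m n :=
  Finsupp.linearCombination k fun g =>
    barTens k m n g.src g.left g.mid.dropLast (g.mid.getLastD [] ++ g.right) +
    ∑ i ∈ Finset.Icc 1 n,
      (-1 : k) ^ i • barTens k m n g.src g.left (merge (n + 1) i g.mid) g.right +
    (-1 : k) ^ (n + 1) • barTens k m n g.src (g.left ++ g.mid.headD []) g.mid.tail g.right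

/-- The comparison map `G_n : Bar_n → P_n`:
`G_n(a ⊗ y ⊗ b) = a · ρ_{n-1} G_{n-1} ∂̄_n(1 ⊗ y ⊗ b)`, with `G_{-1} = id_A`. -/
noncomputable def G : (n : ℕ) → Bar k m n →ₗ[k] P k m n
  | 0 => Finsupp.linearCombination k fun g =>
      lact k m 0 (g.src + shift (g.mid.flatten ++ g.right)) g.left
        (rhoNegOne k m (barDiffZero k m (barTens k m 0 g.src [] g.mid g.right)))
  | n + 1 => Finsupp.linearCombination k fun g =>
      lact k m (n + 1) (g.src + shift (g.mid.flatten ++ g.right)) g.left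
        (rho k m n (G n (barDiff k m n (barTens k m (n + 1) g.src [] g.mid g.right))))

/-- The distinct terms `π(u) ⊗ r ⊗ π(v)` that occur in `split_n(w)` for some `w ⪯ w₀`, where `w₀`
is a path starting at `e_i`. -/
def splitTerms (n : ℕ) (i : ℤ) (w₀ : Word) : Set (Gen m n) :=
  {t | ∃ w, Reduces w₀ w ∧ t ∈ (split k m n i w).support}

end

/-! ### The diagrammatic description of the terms -/

/-- The path `w` starting at `e_a` goes from one side of the red strand between `e_j` and `e_{j+1}`
to the other. -/
def Crosses (j a : ℤ) (w : Word) : Prop :=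
  (a ≤ j ∧ j < a + shift w) ∨ (a + shift w ≤ j ∧ j < a)

/-- Every one of the paths `y_n, …, y_1`, where `y_n ⋯ y_1` starts at `e_i`, crosses the red strand
between `e_j` and `e_{j+1}`. -/
def AllCross (j i : ℤ) (ys : List Word) : Prop :=
  ∀ z w rest, ys = z ++ w :: rest → Crosses j (i + shift rest.flatten) w

/-- The opposite crossing. -/
def opp : Arrow → Arrow
  | p => q
  | q => p
  | s => s

/-- The path of length `n` oscillating around a red strand, with last arrow `c`. -/
def zigzag : Arrow → ℕ → Word
  | _, 0 => []
  | c, n + 1 => c :: zigzag (opp c) n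

/-- The terms obtained from `[y_n|y_{n-1}|⋯|y_1]` (`yn = y_n`, `ys = [y_{n-1}, …, y_1]`) by
splitting off an ambiguity around one red strand.  The strand has to be crossed by all of
`y_{n-1}, …, y_1`; let `c` be the crossing arrow of `y_{n-1} = y' c y''`.
Everything above it straightens to `π(y_n y') = a s^M`.  For each `0 ≤ d < M`, dropping `d` of
these `M` top dots to the bottom gives the term with left factor `a s^(M-d-1)` and the type II
ambiguity `s c c̄ c ⋯`.  If `y_n` crosses the strand as well, then dropping all top dots gives the
term with the type I ambiguity `c̄ c c̄ ⋯`, whose left factor is the part of `y_n` above the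
crossing.  The right factor is determined by the number of dots. -/
def strandTerms (m n : ℕ) (i : ℤ) (yn : Word) (ys : List Word) : Set (Gen m n) :=
  {t | t.src = i ∧ nf (t.left ++ t.mid ++ t.right) = nf (yn ++ ys.flatten) ∧
    ∃ j : ℤ, 0 ≤ j ∧ j < m ∧ AllCross j i ys ∧
    ∃ y' c y'' rest, ys = (y' ++ c :: y'') :: rest ∧
      Crosses j (i + shift (y'' ++ rest.flatten)) [c] ∧
      ((t.mid = s :: zigzag c (n - 1) ∧
          ∃ d : ℕ, nf (yn ++ y') = t.left ++ List.replicate (d + 1) s) ∨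
        (t.mid = zigzag (opp c) n ∧
          ∃ z, yn = t.left ++ opp c :: z ∧
            Crosses j (i + shift (z ++ ys.flatten)) [opp c]))}

end KLRW

namespace KLRW

open Arrow Relation

/-! ### Words, normal forms and degrees -/

/-! Both sides satisfy the same recursion in `n`. On the side of `G`, every summand of `∂̄` except
the last has left factor `1`, and `G` sends it to a combination of tight elements `u ⊗ r ⊗ v`: no
letter at the end of `u` extends `r` to a longer ambiguity. Everything in the image of `ρ` is tight
(`rho_mem_tightSpan`) and `ρ` kills tight elements (`rho_apply_tight`). So only `(-1)^n y_n ⊗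
[y_{n-1}|⋯|y_1] ⊗ b` survives, and `G_n` is `(-1)^n ρ_{n-1}` applied to `y_n · G_{n-1}`.

To evaluate `ρ` one needs `δ - ∂` explicitly. The closed formula `errTerm` is proved by induction
(`errFormula`): modulo tight elements, `∂ δ (1 ⊗ xyr ⊗ 1)` reduces to `-π(xy) ⊗ r ⊗ 1`, on which the
formula in the preceding degree already determines `ρ`. The outcome is a rule for `ρ` on `u ⊗ c r ⊗
v` (`rho_dot`, `rho_arrow`): the dots (loops `s`) at the end of `u` are dropped one by one into `v`.
Each yields the term in which it becomes the first letter of the ambiguity, and after the last dot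
the final arrow of `u` yields a term if it is opposite to `c`. No cancellation occurs
(`smul_rho_eq_finsum`).

On the side of the splittings, the tool is the number of times a path crosses a fixed red strand.
Reductions never increase it and preserve its parity; an irreducible path crosses at most once; an
ambiguity of length at least two zigzags around one strand, up to an initial loop. Comparing counts
forces the lower factors all to cross that strand, and following a crossing through the reductions
(`Reduces.track`) shows that the part of the path above it only loses dots. This determines the left
factors (`mem_splitTerms_zigzag`, `mem_splitTerms_s_zigzag`) and hence the diagrammatic description.
The right factor is then fixed by displacement and degree.

Finally, the terms for `y_n ⋯ y_1` are the disjoint union, over the terms `t` for `y_{n-1} ⋯ y_1`,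
of the terms of `ρ(y_n · t)` (`splitTerms_cons_eq_biUnion`, `pairwiseDisjoint_nextTerms`), which
matches the recursion for `G`. -/

/-- The degree of a word, for which the reduction system is homogeneous. -/
def deg (w : Word) : ℕ := 2 * w.count s + w.count p + w.count q

theorem deg_append (u v : Word) : deg (u ++ v) = deg u + deg v := by
  simp only [deg, List.count_append]; ring

@[simp] theorem deg_nil : deg [] = 0 := rfl

theorem shift_cons (x : Arrow) (w : Word) : shift (x :: w) = shift [x] + shift w :=
  shift_append [x] w

theorem deg_cons (x : Arrow) (w : Word) : deg (x :: w) = deg [x] + deg w :=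
  deg_append [x] w

@[simp] theorem shift_p : shift [p] = 1 := by decide
@[simp] theorem shift_q : shift [q] = -1 := by decide
@[simp] theorem shift_s : shift [s] = 0 := by decide
@[simp] theorem deg_p : deg [p] = 1 := by decide
@[simp] theorem deg_q : deg [q] = 1 := by decide
@[simp] theorem deg_s : deg [s] = 2 := by decide

theorem shift_replicate (n : ℕ) (x : Arrow) : shift (List.replicate n x) = n * shift [x] := by
  induction n with
  | zero => simp [shift_nil]
  | succ n ih => rw [List.replicate_succ, shift_cons, ih]; push_cast; ring

theorem deg_replicate (n : ℕ) (x : Arrow) : deg (List.replicate n x) = n * deg [x] := by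
  induction n with
  | zero => simp
  | succ n ih => rw [List.replicate_succ, deg_cons, ih]; ring

theorem length_le_deg (w : Word) : w.length ≤ deg w := by
  induction w with
  | nil => simp
  | cons x w ih => rw [deg_cons]; cases x <;> simp <;> omega

theorem eq_nil_of_deg_eq_zero {w : Word} (h : deg w = 0) : w = [] := by
  have := length_le_deg w
  exact List.eq_nil_of_length_eq_zero (by omega)

theorem deg_nf (w : Word) : deg (nf w) = deg w := by
  simp only [nf, deg_append, deg_replicate, deg_p, deg_q, deg_s]
  unfold deg
  omega

/-- A normal form is a run of one letter `p` or `q`, then dots. The displacement determines the run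
and the degree then determines the number of dots, so equality in `A` becomes integer arithmetic. -/
theorem nf_eq_nf_iff {u v : Word} : nf u = nf v ↔ shift u = shift v ∧ deg u = deg v := by
  constructor
  · intro h
    exact ⟨by rw [← shift_nf u, h, shift_nf], by rw [← deg_nf u, h, deg_nf]⟩
  · rintro ⟨h1, h2⟩
    unfold shift at h1
    unfold deg at h2
    unfold nf
    congr 1
    · congr 2 <;> omega
    · congr 1; omega

theorem irr_iff {w : Word} : Irr w ↔ nf w = w :=
  ⟨fun h => (nf_unique ReflTransGen.refl h).symm, fun h => h ▸ irr_nf w⟩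

theorem Irr.eq_of_shift_deg {u v : Word} (hu : Irr u) (hv : Irr v) (h1 : shift u = shift v)
    (h2 : deg u = deg v) : u = v := by
  rw [← irr_iff.1 hu, ← irr_iff.1 hv]
  exact nf_eq_nf_iff.2 ⟨h1, h2⟩

theorem Step.shift_eq {w w' : Word} (h : Step w w') : shift w' = shift w := by
  rw [← shift_nf, step_nf h, shift_nf]

theorem Reduces.nf_eq {w w' : Word} (h : Reduces w w') : nf w' = nf w := by
  induction h with
  | refl => rfl
  | tail _ ht ih => rw [step_nf ht, ih]

theorem Reduces.shift_eq {w w' : Word} (h : Reduces w w') : shift w' = shift w :=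
  (nf_eq_nf_iff.1 h.nf_eq).1

theorem Reduces.of_nf_eq {w w' : Word} (h : nf w = w') : Reduces w w' := h ▸ reduces_nf w

theorem Irr.of_infix {u v : Word} (h : Irr v) (huv : u <:+: v) : Irr u :=
  fun t ht htu => h t ht (htu.trans huv)

theorem Reduces.eq_of_irr {u v : Word} (h : Reduces u v) (hu : Irr u) : v = u := by
  rcases ReflTransGen.cases_head h with h | ⟨z, hz, _⟩
  · exact h.symm
  · exact absurd hz (irr_not_step hu)

theorem not_inS_s (x : Arrow) : ¬ InS [x, s] := by
  rintro ⟨f, hf⟩; cases hf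

theorem inS_s {c : Arrow} (hc : c ≠ s) : InS [s, c] := by
  cases c
  · exact ⟨_, Rule.sp⟩
  · exact ⟨_, Rule.sq⟩
  · exact absurd rfl hc

theorem inS_opp {c : Arrow} (hc : c ≠ s) : InS [opp c, c] := by
  cases c
  · exact ⟨_, Rule.qp⟩
  · exact ⟨_, Rule.pq⟩
  · exact absurd rfl hc

theorem inS_iff {x y : Arrow} : InS [x, y] ↔ y ≠ s ∧ (x = s ∨ x = opp y) := by
  constructor
  · rintro ⟨f, hf⟩
    cases hf <;> simp [opp]
  · rintro ⟨h, rfl | rfl⟩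
    · exact inS_s h
    · exact inS_opp h

theorem opp_ne_s {c : Arrow} (hc : c ≠ s) : opp c ≠ s := by
  cases c <;> simp_all [opp]

@[simp] theorem opp_opp (c : Arrow) : opp (opp c) = c := by cases c <;> rfl

theorem shift_opp (c : Arrow) : shift [opp c] = - shift [c] := by
  cases c <;> simp [opp]

theorem rule_s {c : Arrow} (hc : c ≠ s) : Rule [s, c] [c, s] := by
  cases c
  · exact Rule.sp
  · exact Rule.sq
  · exact absurd rfl hc

theorem irr_replicate_append {c : Arrow} (hc : c ≠ s) (a b : ℕ) :
    Irr (List.replicate a c ++ List.replicate b s) := by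
  rw [irr_iff]
  cases c
  · simp [nf, List.count_append, List.count_replicate]
  · simp [nf, List.count_append, List.count_replicate]
  · exact absurd rfl hc

theorem Irr.exists_form {w : Word} (h : Irr w) :
    ∃ (c : Arrow) (a b : ℕ), c ≠ s ∧ w = List.replicate a c ++ List.replicate b s := by
  rw [irr_iff] at h
  rcases le_total (w.count p) (w.count q) with h1 | h1
  · refine ⟨q, w.count q - w.count p, w.count s + min (w.count p) (w.count q), by simp, ?_⟩
    conv_lhs => rw [← h]
    rw [nf, Nat.sub_eq_zero_of_le h1]
    rfl
  · refine ⟨p, w.count p - w.count q, w.count s + min (w.count p) (w.count q), by simp, ?_⟩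
    conv_lhs => rw [← h]
    rw [nf, Nat.sub_eq_zero_of_le h1]
    simp

theorem irr_nil : Irr [] := irr_iff.2 rfl

theorem irr_singleton (x : Arrow) : Irr [x] := irr_iff.2 (by cases x <;> rfl)

theorem shift_ne_zero {c : Arrow} (hc : c ≠ s) : shift [c] = 1 ∨ shift [c] = -1 := by
  cases c <;> simp_all

/-- In an irreducible path, a non-loop arrow is preceded (on the left) by copies of itself only. -/
theorem Irr.left_eq_replicate {c : Arrow} (hc : c ≠ s) {l z : Word} (h : Irr (l ++ c :: z)) :
    l = List.replicate l.length c := by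
  obtain ⟨d, a, b, hd, e⟩ := h.exists_form
  rw [List.append_eq_append_iff] at e
  have hcs : ∀ (x : Word) (n : ℕ), List.replicate n s ≠ x ++ c :: z := by
    intro x n hx
    have : c ∈ List.replicate n s := by rw [hx]; simp
    exact hc (List.eq_of_mem_replicate this)
  rcases e with ⟨x, h1, h2⟩ | ⟨x, h1, h2⟩
  · rcases x with _ | ⟨y, x⟩
    · exact absurd h2.symm (by simpa using hcs [] b)
    · rw [List.cons_append, List.cons.injEq] at h2
      obtain ⟨rfl, h2⟩ := h2
      have hcd : c = d := List.eq_of_mem_replicate (n := a) (by rw [h1]; simp)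
      subst hcd
      have h3 : l <+: List.replicate a c := ⟨_, h1.symm⟩
      obtain ⟨hl, h4⟩ := List.prefix_replicate_iff.1 h3
      exact h4
  · exact absurd h2 (hcs x b)

/-! ### Ambiguities -/

theorem amb_cons_cons {n : ℕ} {x y : Arrow} {w : Word} :
    Amb (n + 1) (x :: y :: w) ↔ InS [x, y] ∧ Amb n (y :: w) := by
  simp [Amb, List.isChain_cons_cons]
  tauto

theorem amb_nil : Amb 0 [] := by simp [Amb]

theorem amb_singleton (x : Arrow) : Amb 1 [x] := by simp [Amb]

theorem amb_cons_iff_zigzag {n : ℕ} {c : Arrow} {w : Word} (hc : c ≠ s) :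
    Amb (n + 1) (c :: w) ↔ c :: w = zigzag c (n + 1) := by
  induction n generalizing c w with
  | zero =>
    constructor
    · rintro ⟨h, -⟩
      simp at h
      simp [zigzag, h]
    · intro h
      simp [zigzag] at h
      subst h
      exact amb_singleton c
  | succ n ih =>
    rcases w with _ | ⟨y, w⟩
    · simp [Amb, zigzag]
    · rw [amb_cons_cons, inS_iff]
      constructor
      · rintro ⟨⟨h1, h2⟩, h3⟩
        rw [ih h1] at h3
        rcases h2 with h2 | rfl
        · exact absurd h2 hc
        · rw [h3]; simp [zigzag]
      · intro h
        simp only [zigzag, List.cons.injEq, true_and] at h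
        obtain ⟨rfl, h⟩ := h
        refine ⟨⟨opp_ne_s hc, Or.inr (by simp)⟩, ?_⟩
        rw [ih (opp_ne_s hc), h]
        simp [zigzag]

theorem amb_zigzag {c : Arrow} (hc : c ≠ s) (n : ℕ) : Amb n (zigzag c n) := by
  cases n with
  | zero => exact amb_nil
  | succ n => exact (amb_cons_iff_zigzag hc).2 rfl

/-- The two types of ambiguities. -/
theorem Amb.cases {n : ℕ} {w : Word} (h : Amb (n + 2) w) :
    ∃ c, c ≠ s ∧ (w = zigzag c (n + 2) ∨ w = s :: zigzag c (n + 1)) := by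
  rcases w with _ | ⟨x, _ | ⟨y, w⟩⟩
  · simp [Amb] at h
  · simp [Amb] at h
  · by_cases hx : x = s
    · subst hx
      rw [amb_cons_cons, inS_iff] at h
      exact ⟨y, h.1.1, Or.inr (by rw [(amb_cons_iff_zigzag h.1.1).1 h.2])⟩
    · exact ⟨x, hx, Or.inl ((amb_cons_iff_zigzag hx).1 h)⟩

theorem Amb.take {n : ℕ} {w : Word} (h : Amb (n + 1) w) : Amb n (w.take n) :=
  ⟨by rw [List.length_take, h.1]; simp, h.2.take n⟩

theorem Amb.tail {n : ℕ} {x : Arrow} {w : Word} (h : Amb (n + 1) (x :: w)) : Amb n w :=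
  ⟨by have := h.1; simpa using this, h.2.tail⟩

/-- Dots slide through zigzags. -/
theorem reduces_dots_zigzag {c : Arrow} (hc : c ≠ s) (d n : ℕ) :
    Reduces (List.replicate d s ++ zigzag c n) (zigzag c n ++ List.replicate d s) := by
  have one : ∀ (n : ℕ) (c : Arrow), c ≠ s → Reduces (s :: zigzag c n) (zigzag c n ++ [s]) := by
    intro n
    induction n with
    | zero => intro c _; exact ReflTransGen.refl
    | succ n ih =>
      intro c hc
      have h1 := reduces_context [c] [] (ih _ (opp_ne_s hc))
      refine ReflTransGen.head (b := [c] ++ (s :: zigzag (opp c) n) ++ []) ?_ ?_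
      · have := Step.mk [] _ _ (zigzag (opp c) n) (rule_s hc)
        simpa [zigzag] using this
      · simpa [zigzag, Reduces] using h1
  induction d with
  | zero => simpa [Reduces] using ReflTransGen.refl
  | succ d ih =>
    have h1 := reduces_context [s] [] ih
    have h2 := reduces_context [] (List.replicate d s) (one n c hc)
    have h3 : List.replicate (d + 1) s = [s] ++ List.replicate d s := by simp [List.replicate_succ]
    rw [h3]
    refine ReflTransGen.trans (b := s :: (zigzag c n ++ List.replicate d s)) ?_ ?_
    · simpa [Reduces] using h1
    · simpa [Reduces] using h2

/-! ### Crossings of a red strand -/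

instance (j a : ℤ) (w : Word) : Decidable (Crosses j a w) := by
  unfold Crosses; infer_instance

theorem crosses_singleton {j a : ℤ} {c : Arrow} :
    Crosses j a [c] ↔ (c = p ∧ a = j) ∨ (c = q ∧ a = j + 1) := by
  cases c <;> simp [Crosses] <;> omega

theorem Crosses.ne_s {j a : ℤ} {c : Arrow} (h : Crosses j a [c]) : c ≠ s := by
  rcases crosses_singleton.1 h with ⟨rfl, -⟩ | ⟨rfl, -⟩ <;> simp

/-- The number of arrows of the path `w`, starting at `e_a`, which cross the strand between `e_j`
and `e_{j+1}`. -/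
def crossings (j a : ℤ) : Word → ℕ
  | [] => 0
  | x :: w => crossings j a w + if Crosses j (a + shift w) [x] then 1 else 0

theorem crossings_append (j a : ℤ) (u v : Word) :
    crossings j a (u ++ v) = crossings j a v + crossings j (a + shift v) u := by
  induction u with
  | nil => simp [crossings]
  | cons x u ih =>
    simp only [List.cons_append, crossings, ih, shift_append]
    rw [show a + (shift u + shift v) = a + shift v + shift u by ring, add_assoc]

theorem crossings_cons_of_crosses {j a : ℤ} {x : Arrow} {w : Word}
    (h : Crosses j (a + shift w) [x]) : crossings j a (x :: w) = crossings j a w + 1 := by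
  simp [crossings, h]

theorem crossings_replicate_s (j a : ℤ) (n : ℕ) : crossings j a (List.replicate n s) = 0 := by
  induction n with
  | zero => rfl
  | succ n ih => simp [List.replicate_succ, crossings, ih, crosses_singleton]

/-- The two arrows of a cancelling pair cross the same strand, so cancelling removes two crossings
of a given strand or none; sliding a dot past an arrow changes nothing. -/
theorem Step.crossings_le {w w' : Word} (h : Step w w') (j a : ℤ) :
    crossings j a w' ≤ crossings j a w := by
  obtain ⟨u, t, f, v, hr⟩ := h
  have h1 : crossings j (a + shift v) f ≤ crossings j (a + shift v) t := by
    generalize a + shift v = b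
    cases hr <;> simp [crossings, crosses_singleton, shift_nil]
  simp only [crossings_append, rule_shift hr]
  omega

theorem Reduces.crossings_le {w w' : Word} (h : Reduces w w') (j a : ℤ) :
    crossings j a w' ≤ crossings j a w := by
  induction h with
  | refl => exact le_rfl
  | tail _ hs ih => exact (hs.crossings_le j a).trans ih

/-- Each crossing switches the side of the strand. As reductions fix the endpoints, the parity is an
invariant of reduction. -/
theorem odd_crossings_iff (j a : ℤ) (w : Word) : Odd (crossings j a w) ↔ Crosses j a w := by
  induction w with
  | nil => simp [crossings, Crosses, shift_nil]
  | cons x w ih =>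
    simp only [crossings]
    by_cases h : Crosses j (a + shift w) [x]
    · rw [if_pos h, Nat.odd_add_one, ih]
      rw [crosses_singleton] at h
      rcases h with ⟨rfl, h⟩ | ⟨rfl, h⟩ <;> unfold Crosses <;> rw [shift_cons] <;> simp <;> omega
    · rw [if_neg h, add_zero, ih]
      rw [crosses_singleton] at h
      cases x <;> simp at h <;> unfold Crosses <;> rw [shift_cons] <;> simp <;> omega

/-- Apart from loops, the arrows of an irreducible path all point in the same direction. -/
theorem Irr.crossings_le_one {w : Word} (h : Irr w) (j a : ℤ) : crossings j a w ≤ 1 := by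
  obtain ⟨c, n, b, hc, rfl⟩ := h.exists_form
  rw [crossings_append, crossings_replicate_s, zero_add]
  generalize a + shift (List.replicate b s) = e
  clear h
  cases c
  · have : crossings j e (List.replicate n p) = if e ≤ j ∧ j < e + n then 1 else 0 := by
      induction n with
      | zero => simp [crossings]
      | succ n ih =>
        simp only [List.replicate_succ, crossings, ih, crosses_singleton, shift_replicate]
        push_cast
        simp
        split_ifs <;> omega
    rw [this]; split_ifs <;> simp
  · have : crossings j e (List.replicate n q) = if j < e ∧ e - n ≤ j then 1 else 0 := by
      induction n with
      | zero => simp [crossings]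
      | succ n ih =>
        simp only [List.replicate_succ, crossings, ih, crosses_singleton, shift_replicate]
        push_cast
        simp
        split_ifs <;> omega
    rw [this]; split_ifs <;> simp
  · exact absurd rfl hc

theorem Irr.crossings_eq_one_iff {w : Word} (h : Irr w) {j a : ℤ} :
    crossings j a w = 1 ↔ Crosses j a w := by
  have := h.crossings_le_one j a
  rw [← odd_crossings_iff]
  constructor
  · intro h; rw [h]; exact odd_one
  · intro h; obtain ⟨r, hr⟩ := h; omega

theorem exists_leftmost_crossing {j a : ℤ} {w : Word} (h : crossings j a w ≠ 0) :
    ∃ A c z, w = A ++ c :: z ∧ Crosses j (a + shift z) [c] ∧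
      crossings j (a + shift (c :: z)) A = 0 := by
  induction w with
  | nil => simp [crossings] at h
  | cons x w ih =>
    by_cases hx : Crosses j (a + shift w) [x]
    · exact ⟨[], x, w, rfl, hx, rfl⟩
    · simp only [crossings, if_neg hx, add_zero] at h
      obtain ⟨A, c, z, rfl, h1, h2⟩ := ih h
      refine ⟨x :: A, c, z, rfl, h1, ?_⟩
      simp only [crossings, h2, zero_add]
      rw [shift_append] at hx
      rw [if_neg]
      rwa [add_assoc, add_comm (shift (c :: z))]

theorem Irr.exists_crossing {j a : ℤ} {w : Word} (hw : Irr w) (h : Crosses j a w) :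
    ∃ A c z, w = A ++ c :: z ∧ Crosses j (a + shift z) [c] := by
  obtain ⟨A, c, z, h1, h2, -⟩ := exists_leftmost_crossing (j := j) (a := a) (w := w)
    (by rw [hw.crossings_eq_one_iff.2 h]; simp)
  exact ⟨A, c, z, h1, h2⟩

theorem crossings_flatten_le {j i : ℤ} {ys : List Word} (hys : ∀ y ∈ ys, Irr y) :
    crossings j i ys.flatten ≤ ys.length := by
  induction ys with
  | nil => simp [crossings]
  | cons y ys ih =>
    simp only [List.flatten_cons, crossings_append, List.length_cons]
    have h1 := ih fun z hz => hys z (List.mem_cons_of_mem _ hz)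
    have h2 := (hys y (by simp)).crossings_le_one j (i + shift ys.flatten)
    omega

theorem allCross_nil (j i : ℤ) : AllCross j i [] := by
  intro z w rest h; simp at h

theorem allCross_cons {j i : ℤ} {y : Word} {ys : List Word} :
    AllCross j i (y :: ys) ↔ Crosses j (i + shift ys.flatten) y ∧ AllCross j i ys := by
  constructor
  · intro h
    exact ⟨h [] y ys rfl, fun z w rest e => h (y :: z) w rest (by simp [e])⟩
  · rintro ⟨h1, h2⟩ z w rest e
    rcases z with _ | ⟨x, z⟩
    · simp at e; obtain ⟨rfl, rfl⟩ := e; exact h1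
    · simp at e; exact h2 z w rest e.2

/-- The equality case of `crossings_flatten_le`: it makes "all factors cross" an extremal count,
which can be compared along reductions. -/
theorem crossings_flatten_eq_length_iff {j i : ℤ} {ys : List Word} (hys : ∀ y ∈ ys, Irr y) :
    crossings j i ys.flatten = ys.length ↔ AllCross j i ys := by
  induction ys with
  | nil => simp [crossings, allCross_nil]
  | cons y ys ih =>
    have hys' : ∀ z ∈ ys, Irr z := fun z hz => hys z (List.mem_cons_of_mem _ hz)
    rw [allCross_cons, ← ih hys', ← (hys y (by simp)).crossings_eq_one_iff]
    simp only [List.flatten_cons, crossings_append, List.length_cons]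
    have h1 := crossings_flatten_le (j := j) (i := i) hys'
    have h2 := (hys y (by simp)).crossings_le_one j (i + shift ys.flatten)
    omega

/-! ### Following one crossing through reductions -/

/-- A crossing is determined by its path and the number of crossings which precede it. -/
theorem crossing_unique {j a : ℤ} {x x' : Arrow} {A A' B B' : Word}
    (e : A ++ x :: B = A' ++ x' :: B') (hx : Crosses j (a + shift B) [x])
    (hx' : Crosses j (a + shift B') [x']) (h : crossings j a B = crossings j a B') :
    A = A' ∧ x = x' ∧ B = B' := by
  rw [List.append_eq_append_iff] at e
  rcases e with ⟨l, h1, h2⟩ | ⟨l, h1, h2⟩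
  · rcases l with _ | ⟨y, l⟩
    · simp at h1 h2; exact ⟨h1.symm, h2⟩
    · simp at h2
      obtain ⟨rfl, h2⟩ := h2
      rw [h2, crossings_append, crossings_cons_of_crosses hx'] at h
      omega
  · rcases l with _ | ⟨y, l⟩
    · simp at h1 h2; exact ⟨h1, h2.1.symm, h2.2.symm⟩
    · simp at h2
      obtain ⟨rfl, h2⟩ := h2
      rw [h2, crossings_append, crossings_cons_of_crosses hx] at h
      omega

theorem rule_length {t f : Word} (h : Rule t f) : ∃ x y, t = [x, y] := by
  cases h <;> exact ⟨_, _, rfl⟩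

theorem Rule.eq_of_opp {c : Arrow} {f : Word} (h : Rule [opp c, c] f) : f = [s] := by
  generalize e : [opp c, c] = t at h
  cases h <;> cases c <;> simp [opp] at e ⊢

theorem step_append_cons {A B w : Word} {x : Arrow} (h : Step (A ++ x :: B) w) :
    (∃ A', Step A A' ∧ w = A' ++ x :: B) ∨ (∃ B', Step B B' ∧ w = A ++ x :: B') ∨
    (∃ A0 y f, A = A0 ++ [y] ∧ Rule [y, x] f ∧ w = A0 ++ f ++ B) ∨
    (∃ y f B0, B = y :: B0 ∧ Rule [x, y] f ∧ w = A ++ f ++ B0) := by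
  generalize e : A ++ x :: B = w0 at h
  obtain ⟨u, t, f, v, hr⟩ := h
  obtain ⟨y, z, rfl⟩ := rule_length hr
  rw [List.append_assoc, List.append_eq_append_iff] at e
  rcases e with ⟨l, rfl, h2⟩ | ⟨l, rfl, h2⟩
  · rcases l with _ | ⟨b, l⟩
    · simp at h2
      obtain ⟨rfl, rfl⟩ := h2
      exact Or.inr (Or.inr (Or.inr ⟨z, f, v, rfl, hr, by simp⟩))
    · simp at h2
      obtain ⟨rfl, rfl⟩ := h2
      refine Or.inr (Or.inl ⟨l ++ f ++ v, ?_, by simp⟩)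
      simpa using Step.mk l [y, z] f v hr
  · rcases l with _ | ⟨b, _ | ⟨b', l⟩⟩
    · simp at h2
      obtain ⟨rfl, rfl⟩ := h2
      exact Or.inr (Or.inr (Or.inr ⟨z, f, v, rfl, hr, by simp⟩))
    · simp at h2
      obtain ⟨rfl, rfl, rfl⟩ := h2
      exact Or.inr (Or.inr (Or.inl ⟨u, y, f, rfl, hr, rfl⟩))
    · simp at h2
      obtain ⟨rfl, rfl, rfl⟩ := h2
      refine Or.inl ⟨u ++ f ++ l, ?_, by simp⟩
      simpa using Step.mk u [y, z] f l hr

/-- Along reductions which preserve the number of crossings of a strand, a crossing persists, and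
the part of the path above it only loses dots. -/
theorem Reduces.track {j a : ℤ} {A B w : Word} {x : Arrow} (h : Reduces (A ++ x :: B) w)
    (hx : Crosses j (a + shift B) [x])
    (hw : crossings j a w = crossings j a (A ++ x :: B)) :
    ∃ A' B' d, w = A' ++ x :: B' ∧ Crosses j (a + shift B') [x] ∧
      Reduces A (A' ++ List.replicate d s) ∧ crossings j a B' = crossings j a B := by
  -- Through the induction the crossings below `x` are only bounded. Equality follows at the end,
  -- since the part above gains none either and the total is unchanged.
  suffices H : ∃ A' B' d, w = A' ++ x :: B' ∧ shift B' = shift B ∧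
      Reduces A (A' ++ List.replicate d s) ∧ crossings j a B' ≤ crossings j a B by
    obtain ⟨A', B', d, rfl, h1, h2, h3⟩ := H
    have hx' : Crosses j (a + shift B') [x] := by rwa [h1]
    refine ⟨A', B', d, rfl, hx', h2, ?_⟩
    have h5 := h2.crossings_le j (a + shift (x :: B))
    have h6 : shift (x :: B') = shift (x :: B) := by rw [shift_cons, h1, ← shift_cons]
    rw [crossings_append] at h5
    rw [crossings_append, crossings_append, crossings_cons_of_crosses hx,
      crossings_cons_of_crosses hx', h6] at hw
    rw [crossings_replicate_s, shift_replicate, shift_s, mul_zero, add_zero] at h5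
    omega
  induction h with
  | refl => exact ⟨A, B, 0, rfl, rfl, by simpa [Reduces] using ReflTransGen.refl, le_rfl⟩
  | tail hr hs ih =>
    rename_i b c
    have h1 := Reduces.crossings_le hr j a
    have h2 := hs.crossings_le j a
    obtain ⟨A', B', d, rfl, h3, h4, h5⟩ := ih (by omega)
    have hx' : Crosses j (a + shift B') [x] := by rwa [h3]
    rcases step_append_cons hs with ⟨A'', hA, rfl⟩ | ⟨B'', hB, rfl⟩ | ⟨A0, y, f, rfl, hf, rfl⟩ |
      ⟨y, f, B0, rfl, hf, rfl⟩
    · refine ⟨A'', B', d, rfl, h3, ReflTransGen.tail h4 ?_, h5⟩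
      simpa using step_context [] (List.replicate d s) hA
    · exact ⟨A', B'', d, rfl, hB.shift_eq.trans h3, h4, (hB.crossings_le j a).trans h5⟩
    · have hy : InS [y, x] := ⟨f, hf⟩
      rw [inS_iff] at hy
      rcases hy with ⟨hxs, rfl | rfl⟩
      -- A dot from above slides past `x`; it is recorded in `d`.
      · have hf' : f = [x, s] := by cases hf <;> rfl
        subst hf'
        refine ⟨A0, s :: B', d + 1, by simp, ?_, ?_, ?_⟩
        · rw [shift_cons, shift_s, zero_add, h3]
        · simpa [List.replicate_succ] using h4
        · simpa [crossings, crosses_singleton] using h5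
      -- Cancelling `x` against its neighbour would lose crossings of the strand, which no later
      -- reduction restores.
      · exfalso
        have hf' := hf.eq_of_opp
        subst hf'
        have e1 : A0 ++ [opp x] ++ x :: B' = A0 ++ opp x :: x :: B' := by simp
        have e2 : A0 ++ [s] ++ B' = A0 ++ s :: B' := by simp
        have e3 : shift (s :: B') = shift (opp x :: x :: B') := by
          rw [shift_cons, shift_cons (opp x), shift_cons x, shift_opp]; simp
        rw [e1] at h1 h2
        rw [e2] at hw h2
        rw [crossings_append, e3] at h2 hw
        have h6 : crossings j a (opp x :: x :: B') ≥ crossings j a B' + 1 := by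
          rw [crossings, crossings_cons_of_crosses hx']; omega
        have h7 : crossings j a (s :: B') = crossings j a B' := by
          simp [crossings, crosses_singleton]
        rw [crossings_append j a A0 (opp x :: x :: B')] at h1
        omega
    · exfalso
      have hy : InS [x, y] := ⟨f, hf⟩
      rw [inS_iff] at hy
      rcases hy with ⟨hys, rfl | rfl⟩
      · exact hx.ne_s rfl
      · have hf' := hf.eq_of_opp
        subst hf'
        have e2 : A' ++ [s] ++ B0 = A' ++ s :: B0 := by simp
        have e3 : shift (s :: B0) = shift (opp y :: y :: B0) := by
          rw [shift_cons, shift_cons (opp y), shift_cons y, shift_opp]; simp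
        rw [e2] at hw h2
        rw [crossings_append, e3] at h2 hw
        have h6 : crossings j a (opp y :: y :: B0) ≥ crossings j a B0 + 1 := by
          rw [crossings_cons_of_crosses hx', crossings]; omega
        have h7 : crossings j a (s :: B0) = crossings j a B0 := by
          simp [crossings, crosses_singleton]
        rw [crossings_append j a A' (opp y :: y :: B0)] at h1
        omega

theorem crossings_zigzag {j b : ℤ} {c : Arrow} {n : ℕ}
    (h : Crosses j (b + shift (zigzag (opp c) n)) [c]) : crossings j b (zigzag c (n + 1)) = n + 1 := by
  induction n generalizing c with
  | zero => simp only [zigzag] at h ⊢; rw [crossings_cons_of_crosses h]; rfl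
  | succ n ih =>
    rw [zigzag, crossings_cons_of_crosses h, ih]
    rw [zigzag, shift_cons, shift_opp, opp_opp] at h
    rw [opp_opp]
    rw [crosses_singleton] at h ⊢
    rcases h with ⟨rfl, h⟩ | ⟨rfl, h⟩ <;> simp [opp] at h ⊢ <;> omega

theorem IsPath.exists_strand {m : ℕ} {a : ℤ} {c : Arrow} {w : Word} (hc : c ≠ s)
    (h : IsPath m a (c :: w)) : ∃ j : ℤ, 0 ≤ j ∧ j < m ∧ Crosses j (a + shift w) [c] := by
  have h1 := (isPath_cons m a c w).1 h
  have h2 := h1.1 w List.suffix_rfl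
  rw [shift_cons] at h1
  cases c
  · exact ⟨a + shift w, by simp at h1; omega, by simp at h1; omega, by simp [crosses_singleton]⟩
  · exact ⟨a + shift w - 1, by simp at h1; omega, by simp at h1; omega,
      by simp [crosses_singleton]⟩
  · exact absurd rfl hc

theorem Crosses.strand_bounds {m : ℕ} {j a : ℤ} {u w : Word} {c : Arrow}
    (hc : Crosses j (a + shift w) [c]) (h : IsPath m a (u ++ c :: w)) : 0 ≤ j ∧ j < m := by
  have h1 := (isPath_cons m a c w).1 ((isPath_append m a u (c :: w)).1 h).1
  have h2 := h1.1 w List.suffix_rfl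
  rw [shift_cons] at h1
  rcases crosses_singleton.1 hc with ⟨rfl, h⟩ | ⟨rfl, h⟩ <;> simp at h1 <;> omega

/-! ### The terms of the splittings -/

section

variable {k : Type*} [Field k] {m : ℕ}

/-- The class of the whole path fixes displacement and degree of the right factor once the other two
factors are known. This is why the sets of terms below prescribe the total normal form instead of
the right factor. -/
theorem Gen.ext_of_nf {n : ℕ} {t t' : Gen m n} (h1 : t.src = t'.src) (h2 : t.left = t'.left)
    (h3 : t.mid = t'.mid)
    (h4 : nf (t.left ++ t.mid ++ t.right) = nf (t'.left ++ t'.mid ++ t'.right)) : t = t' := by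
  refine Gen.ext h1 h2 h3 (t.right_irr.eq_of_shift_deg t'.right_irr ?_ ?_)
  · have := (nf_eq_nf_iff.1 h4).1
    rw [shift_append, shift_append (t'.left ++ t'.mid), h2, h3] at this
    linarith
  · have := (nf_eq_nf_iff.1 h4).2
    rw [deg_append, deg_append (t'.left ++ t'.mid), h2, h3] at this
    omega

theorem tens_apply (n : ℕ) (a : ℤ) (u r v : Word) (t : Gen m n) [Decidable (t.src = a ∧
      nf u = t.left ∧ r = t.mid ∧ nf v = t.right ∧ IsPath m a (u ++ r ++ v))] :
    tens k m n a u r v t = if t.src = a ∧ nf u = t.left ∧ r = t.mid ∧ nf v = t.right ∧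
      IsPath m a (u ++ r ++ v) then 1 else 0 := by
  classical
  unfold tens
  split_ifs with h1 h2 h2
  · rw [Finsupp.single_apply, if_pos]
    obtain ⟨h3, h4, h5, h6, -⟩ := h2
    exact Gen.ext h3.symm h4 h5 h6
  · rw [Finsupp.single_apply, if_neg]
    rintro rfl
    exact h2 ⟨rfl, rfl, rfl, rfl, h1.2⟩
  · obtain ⟨-, -, rfl, -, h4⟩ := h2
    exact absurd ⟨t.mid_amb, h4⟩ h1
  · rfl

-- Prefixes of one path with equal normal forms have equal degree, and every letter has positive
-- degree, so they coincide. Hence no pure tensor occurs twice in a single splitting and all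
-- coefficients are `0` or `1`.
open Classical in
theorem split_apply (n : ℕ) (a : ℤ) (w : Word) (t : Gen m n) :
    split k m n a w t = if t.src = a ∧ ∃ u v, w = u ++ t.mid ++ v ∧ nf u = t.left ∧
      nf v = t.right ∧ IsPath m a w then 1 else 0 := by
  have hn := t.mid_amb.1
  have hdec : ∀ l, w.take l ++ (w.drop l).take n ++ (w.drop l).drop n = w := by
    intro l; rw [List.append_assoc, List.take_append_drop, List.take_append_drop]
  unfold split
  rw [Finsupp.finsetSum_apply]
  simp only [tens_apply, hdec]
  split_ifs with h
  · obtain ⟨h1, u, v, rfl, h2, h3, h4⟩ := h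
    rw [Finset.sum_eq_single u.length]
    · rw [if_pos]
      refine ⟨h1, by simpa using h2, by simp [hn], ?_, h4⟩
      rw [← h3]
      simp [hn]
    · intro l hl hlu
      rw [if_neg]
      rintro ⟨-, h5, -⟩
      apply hlu
      have h6 := (nf_eq_nf_iff.1 (h5.trans h2.symm)).2
      rw [Finset.mem_range] at hl
      have hl' : ((u ++ t.mid ++ v).take l).length = l := by
        rw [List.length_take]; omega
      have hx := List.take_prefix l (u ++ t.mid ++ v)
      generalize (u ++ t.mid ++ v).take l = x at h6 hl' hx
      rw [← hl']
      rcases List.prefix_or_prefix_of_prefix hx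
        (⟨t.mid ++ v, by simp⟩ : u <+: u ++ t.mid ++ v) with ⟨z, rfl⟩ | ⟨z, rfl⟩
      · rw [deg_append] at h6
        rw [eq_nil_of_deg_eq_zero (w := z) (by omega)]
        simp
      · rw [deg_append] at h6
        rw [eq_nil_of_deg_eq_zero (w := z) (by omega)]
        simp
    · intro hl
      simp at hl
  · apply Finset.sum_eq_zero
    intro l _
    rw [if_neg]
    rintro ⟨h1, h2, h3, h4, h5⟩
    exact h ⟨h1, _, _, by rw [← h3, hdec], h2, h4, h5⟩

theorem mem_splitTerms {n : ℕ} {i : ℤ} {w₀ : Word} {t : Gen m n} :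
    t ∈ splitTerms k m n i w₀ ↔ t.src = i ∧ ∃ u v, Reduces w₀ (u ++ t.mid ++ v) ∧
      IsPath m i (u ++ t.mid ++ v) ∧ nf u = t.left ∧ nf v = t.right := by
  classical
  simp only [splitTerms, Set.mem_ofPred_eq, Finsupp.mem_support_iff, split_apply]
  constructor
  · rintro ⟨w, h1, h2⟩
    by_cases h : t.src = i ∧ ∃ u v, w = u ++ t.mid ++ v ∧ nf u = t.left ∧
      nf v = t.right ∧ IsPath m i w
    · obtain ⟨h3, u, v, rfl, h4, h5, h6⟩ := h
      exact ⟨h3, u, v, h1, h6, h4, h5⟩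
    · rw [if_neg h] at h2; exact absurd rfl h2
  · rintro ⟨h1, u, v, h2, h3, h4, h5⟩
    refine ⟨_, h2, ?_⟩
    rw [if_pos ⟨h1, u, v, rfl, h4, h5, h3⟩]
    exact one_ne_zero

theorem nf_append_congr {u u' v v' : Word} (h1 : nf u = nf u') (h2 : nf v = nf v') :
    nf (u ++ v) = nf (u' ++ v') := by
  rw [nf_eq_nf_iff] at *
  rw [shift_append, shift_append, deg_append, deg_append]
  omega

@[simp] theorem nf_nf (w : Word) : nf (nf w) = nf w := irr_iff.1 (irr_nf w)

theorem nf_total_of_mem_splitTerms {n : ℕ} {i : ℤ} {w₀ : Word} {t : Gen m n}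
    (h : t ∈ splitTerms k m n i w₀) : nf (t.left ++ t.mid ++ t.right) = nf w₀ := by
  obtain ⟨-, u, v, h1, -, h2, h3⟩ := mem_splitTerms.1 h
  rw [← h1.nf_eq, ← h2, ← h3]
  exact nf_append_congr (nf_append_congr (nf_nf u) rfl) (nf_nf v)

/-- The degree of `w₀` bounds the lengths of all three factors. -/
theorem finite_setOf_gen (n : ℕ) (i : ℤ) (w₀ : Word) :
    {t : Gen m n | t.src = i ∧ nf (t.left ++ t.mid ++ t.right) = nf w₀}.Finite := by
  classical
  have hfin : Fintype Arrow := ⟨{p, q, s}, fun x => by cases x <;> simp⟩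
  have hW : {w : Word | w.length ≤ deg w₀}.Finite := List.finite_length_le Arrow (deg w₀)
  refine Set.Finite.of_finite_image (f := fun t : Gen m n => (t.left, t.mid, t.right))
    ((hW.prod (hW.prod hW)).subset ?_) ?_
  · rintro _ ⟨t, ⟨-, h⟩, rfl⟩
    have h1 := (nf_eq_nf_iff.1 h).2
    rw [deg_append, deg_append] at h1
    have h2 := length_le_deg t.left
    have h3 := length_le_deg t.mid
    have h4 := length_le_deg t.right
    refine ⟨?_, ?_, ?_⟩ <;> simp only [Set.mem_ofPred_eq] <;> omega
  · rintro t ⟨h1, -⟩ t' ⟨h1', -⟩ h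
    simp only [Prod.mk.injEq] at h
    exact Gen.ext (h1.trans h1'.symm) h.1 h.2.1 h.2.2

theorem finite_splitTerms (n : ℕ) (i : ℤ) (w₀ : Word) : (splitTerms k m n i w₀).Finite :=
  (finite_setOf_gen n i w₀).subset fun _ h =>
    ⟨(mem_splitTerms.1 h).1, nf_total_of_mem_splitTerms h⟩

/-- To find a term among the `splitTerms`, its right factor need not be inspected. -/
theorem mem_splitTerms_of_reduces {n : ℕ} {i : ℤ} {w₀ v : Word} {t : Gen m n}
    (hp : IsPath m i w₀) (h1 : t.src = i) (h2 : nf (t.left ++ t.mid ++ t.right) = nf w₀)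
    (h : Reduces w₀ (t.left ++ t.mid ++ v)) : t ∈ splitTerms k m n i w₀ := by
  refine mem_splitTerms.2 ⟨h1, t.left, v, h, reduces_isPath h hp, irr_iff.1 t.left_irr, ?_⟩
  rw [← irr_iff.1 t.right_irr]
  rw [← h.nf_eq, nf_eq_nf_iff] at h2
  rw [nf_eq_nf_iff]
  simp only [shift_append, deg_append] at h2
  constructor
  · linarith [h2.1]
  · omega

/-! ### Straightening above a strand -/

/-- After the lower factor has crossed, the path is on the other side of the strand, and both
irreducible factors are monotone. So the upper factor must cross back by the opposite arrow, and the
stretch between the two crossings is a closed path. -/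
theorem crosses_opp_of_allCross {j i : ℤ} {A z A₁ z₁ w : Word} {c c₁ : Arrow}
    (hA₁ : Irr (A₁ ++ c₁ :: z₁)) (hA : Irr (A ++ c :: z))
    (h₁ : Crosses j (i + shift (z₁ ++ w)) [c₁])
    (h : Crosses j (i + shift (z ++ (A₁ ++ c₁ :: z₁ ++ w))) [c]) :
    c = opp c₁ ∧ shift (z ++ A₁) = 0 := by
  have e₁ := hA₁.left_eq_replicate h₁.ne_s
  have e : ∃ b d, z = List.replicate b c ++ List.replicate d s := by
    obtain ⟨x, b, d, hx, hz⟩ := (hA.of_infix (u := c :: z) ⟨A, [], by simp⟩).exists_form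
    rcases b with _ | b
    · have : c ∈ List.replicate d s := by
        have : c ∈ c :: z := by simp
        rw [hz] at this; simpa using this
      exact absurd (List.eq_of_mem_replicate this) h.ne_s
    · rw [List.replicate_succ, List.cons_append, List.cons.injEq] at hz
      obtain ⟨rfl, hz⟩ := hz
      exact ⟨b, d, hz⟩
  obtain ⟨b, d, rfl⟩ := e
  rw [e₁] at h ⊢
  generalize A₁.length = l at *
  have h' := crosses_singleton.1 h
  have h₁' := crosses_singleton.1 h₁
  simp only [shift_append, shift_cons _ z₁, shift_replicate, shift_s] at h' h₁' ⊢
  rcases h₁' with ⟨rfl, h₁'⟩ | ⟨rfl, h₁'⟩ <;> rcases h' with ⟨rfl, h'⟩ | ⟨rfl, h'⟩ <;>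
    simp [opp] at h' h₁' ⊢ <;> omega

theorem reduces_dots_of_shift_eq_zero {w : Word} (h : shift w = 0) :
    ∃ M, Reduces w (List.replicate M s) := by
  refine ⟨_, Reduces.of_nf_eq (w' := List.replicate (w.count s + min (w.count p) (w.count q)) s) ?_⟩
  unfold shift at h
  have h1 : w.count p = w.count q := by omega
  simp [nf, h1]

/-- If all factors cross the strand, then the path reduces to a zigzag around it. -/
theorem AllCross.reduces {j i : ℤ} {ys : List Word} {A z : Word} {c : Arrow}
    (hys : ∀ y ∈ ys, Irr y) (hA : Irr (A ++ c :: z)) (h : AllCross j i ys)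
    (hc : Crosses j (i + shift (z ++ ys.flatten)) [c]) :
    ∃ v, Reduces (A ++ c :: z ++ ys.flatten) (A ++ zigzag c (ys.length + 1) ++ v) := by
  induction ys generalizing A c z with
  | nil => exact ⟨z, by simpa [zigzag, Reduces] using ReflTransGen.refl⟩
  | cons y ys ih =>
    rw [allCross_cons] at h
    have hy : Irr y := hys y (by simp)
    obtain ⟨A₁, c₁, z₁, rfl, h₁⟩ := hy.exists_crossing h.1
    have h₁' : Crosses j (i + shift (z₁ ++ ys.flatten)) [c₁] := by
      rw [shift_append]; convert h₁ using 1; ring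
    obtain ⟨v, hv⟩ := ih (fun y hy => hys y (List.mem_cons_of_mem _ hy)) hy h.2 h₁'
    obtain ⟨rfl, h0⟩ := crosses_opp_of_allCross hy hA h₁' (by simpa using hc)
    -- The closed stretch between the two crossings straightens to `M` dots, which then slide down
    -- through the zigzag already built below.
    obtain ⟨M, hM⟩ := reduces_dots_of_shift_eq_zero h0
    refine ⟨List.replicate M s ++ v, ?_⟩
    have r1 := reduces_context (A ++ opp c₁ :: z) [] hv
    have r2 := reduces_context (A ++ [opp c₁]) (zigzag c₁ (ys.length + 1) ++ v) hM
    have r3 := reduces_context (A ++ [opp c₁]) v (reduces_dots_zigzag h₁.ne_s M (ys.length + 1))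
    have := (ReflTransGen.trans (ReflTransGen.trans (by simpa [Reduces] using r1)
      (by simpa [Reduces] using r2)) (by simpa [Reduces] using r3) :
      Reduces (A ++ (opp c₁ :: (z ++ (A₁ ++ c₁ :: (z₁ ++ ys.flatten))))) _)
    simpa [zigzag, Reduces] using this

theorem allCross_cons_of_split {j i : ℤ} {ys : List Word} {A z : Word} {c : Arrow}
    (hA : Irr (A ++ c :: z)) (hc : Crosses j (i + shift (z ++ ys.flatten)) [c]) :
    Crosses j (i + shift ys.flatten) (A ++ c :: z) := by
  rw [← hA.crossings_eq_one_iff]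
  have h1 := hA.crossings_le_one j (i + shift ys.flatten)
  rw [crossings_append, crossings_cons_of_crosses (by
    rw [shift_append] at hc; convert hc using 1; ring)] at h1 ⊢
  omega

/-- Above its crossing arrow an irreducible path consists of copies of that arrow
(`Irr.left_eq_replicate`): it cannot be reduced and has no dot to lose. -/
theorem Irr.eq_of_reduces_dots {A A' z : Word} {c : Arrow} {d : ℕ} (hA : Irr (A ++ c :: z))
    (hc : c ≠ s) (h : Reduces A (A' ++ List.replicate d s)) : A' = A := by
  have e := h.eq_of_irr (hA.of_infix ⟨[], c :: z, by simp⟩)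
  rcases d with _ | d
  · simpa using e
  · have h1 := hA.left_eq_replicate hc
    have h2 : s ∈ A := by rw [← e]; simp
    rw [h1] at h2
    exact absurd (List.eq_of_mem_replicate h2).symm hc

/-! ### The splitting terms for each type of ambiguity -/

/-- The description of the terms of the first type. -/
theorem mem_splitTerms_zigzag {n : ℕ} {i : ℤ} {y : Word} {ys : List Word} {c : Arrow}
    {t : Gen m (n + 1)} (hn : ys.length = n) (hys : ∀ x ∈ y :: ys, Irr x)
    (hp : IsPath m i (y :: ys).flatten) (hc : c ≠ s) (ht : t.mid = zigzag c (n + 1)) :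
    t ∈ splitTerms k m (n + 1) i (y :: ys).flatten ↔ t.src = i ∧
      nf (t.left ++ t.mid ++ t.right) = nf (y :: ys).flatten ∧
      ∃ j, AllCross j i (y :: ys) ∧ ∃ z, y = t.left ++ c :: z ∧
        Crosses j (i + shift (z ++ ys.flatten)) [c] := by
  constructor
  · intro hmem
    obtain ⟨h1, u, v, h2, h3, h4, h5⟩ := mem_splitTerms.1 hmem
    refine ⟨h1, nf_total_of_mem_splitTerms hmem, ?_⟩
    rw [ht] at h2 h3
    have h6 : IsPath m i (c :: (zigzag (opp c) n ++ v)) := by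
      rw [List.append_assoc, isPath_append] at h3
      exact h3.1
    obtain ⟨j, -, -, hj⟩ := h6.exists_strand hc
    have h7 : crossings j i (u ++ zigzag c (n + 1) ++ v) =
        crossings j i v + (n + 1) + crossings j (i + shift (zigzag c (n + 1) ++ v)) u := by
      rw [List.append_assoc, crossings_append, crossings_append, crossings_zigzag (c := c)]
      rw [shift_append] at hj
      rwa [add_assoc, add_comm (shift v)]
    have h8 := crossings_flatten_le (j := j) (i := i) hys
    have h9 := h2.crossings_le j i
    rw [List.length_cons, hn] at h8
    -- The zigzag shows `n + 1` crossings after reduction, and the `n + 1` irreducible factors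
    -- supply at most one each, so each crosses.
    have hall : AllCross j i (y :: ys) := by
      rw [← crossings_flatten_eq_length_iff hys, List.length_cons, hn]
      omega
    refine ⟨j, hall, ?_⟩
    have hy : Irr y := hys y (by simp)
    have hys' : ∀ x ∈ ys, Irr x := fun x hx => hys x (List.mem_cons_of_mem _ hx)
    obtain ⟨A, c₀, z, rfl, hc₀⟩ := hy.exists_crossing (allCross_cons.1 hall).1
    have hc₀' : Crosses j (i + shift (z ++ ys.flatten)) [c₀] := by
      rw [shift_append]; convert hc₀ using 1; ring
    have h10 := (hy.crossings_eq_one_iff (j := j)).2 (allCross_cons.1 hall).1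
    have h11 := (crossings_flatten_eq_length_iff hys').2 (allCross_cons.1 hall).2
    have h12 : crossings j i (z ++ ys.flatten) = n := by
      rw [crossings_append, crossings_cons_of_crosses hc₀] at h10
      rw [crossings_append]
      omega
    obtain ⟨A', B', d, e, hB', hA', hcr⟩ := Reduces.track (j := j) (a := i) (A := A)
      (B := z ++ ys.flatten) (x := c₀) (by simpa using h2) hc₀' (by
        simp only [List.flatten_cons, List.append_assoc, List.cons_append] at *
        omega)
    obtain rfl := hy.eq_of_reduces_dots hc₀.ne_s hA'
    have hz : crossings j i (c :: (zigzag (opp c) n ++ v)) ≤ n + 1 := by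
      have h13 := h2.crossings_le j i
      rw [show u ++ zigzag c (n + 1) ++ v = u ++ c :: (zigzag (opp c) n ++ v) by simp [zigzag],
        crossings_append] at h13
      omega
    rw [crossings_cons_of_crosses hj] at hz
    have hz' : n ≤ crossings j i (zigzag (opp c) n ++ v) := by
      have := crossings_zigzag (j := j) (b := i + shift v) (c := c) (n := n)
        (by rw [shift_append] at hj; rwa [add_assoc, add_comm (shift v)])
      rw [zigzag, crossings_cons_of_crosses (by
        rw [shift_append] at hj; rwa [add_assoc, add_comm (shift v)])] at this
      rw [crossings_append]
      omega
    -- The first arrow of the zigzag and the tracked crossing of `y` both have exactly `n` crossings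
    -- below them, so they are the same arrow and `u` is the part of `y` above it.
    obtain ⟨rfl, rfl, rfl⟩ := crossing_unique (j := j) (a := i) (A := u)
      (by rw [← e]; simp [zigzag]) hj hB' (by omega)
    have hu : Irr u := hy.of_infix ⟨[], c :: z, by simp⟩
    rw [← h4, irr_iff.1 hu]
    exact ⟨z, rfl, hc₀'⟩
  · rintro ⟨h1, h2, j, h3, z, rfl, h4⟩
    have hys' : ∀ x ∈ ys, Irr x := fun x hx => hys x (List.mem_cons_of_mem _ hx)
    obtain ⟨v, hv⟩ := (allCross_cons.1 h3).2.reduces hys' (hys _ (List.mem_cons_self ..)) h4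
    refine mem_splitTerms_of_reduces (v := v) hp h1 h2 ?_
    rw [hn] at hv
    rw [ht]
    exact hv

end

section

variable {k : Type*} [Field k] {m : ℕ}

theorem Irr.append_dots {w : Word} (h : Irr w) (n : ℕ) : Irr (w ++ List.replicate n s) := by
  obtain ⟨c, a, b, hc, rfl⟩ := h.exists_form
  rw [List.append_assoc, List.replicate_append_replicate]
  exact irr_replicate_append hc _ _

theorem nf_append_dots (w : Word) (n : ℕ) :
    nf (w ++ List.replicate n s) = nf w ++ List.replicate n s := by
  rw [← irr_iff.1 ((irr_nf w).append_dots n)]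
  exact nf_append_congr (nf_nf w).symm rfl

theorem odd_crossings_congr {w w' : Word} (h : Reduces w w') (j a : ℤ) :
    Odd (crossings j a w) ↔ Odd (crossings j a w') := by
  rw [odd_crossings_iff, odd_crossings_iff, Crosses, Crosses, h.shift_eq]

/-- The description of the terms of the second type. -/
theorem mem_splitTerms_s_zigzag {n : ℕ} {i : ℤ} {y : Word} {ys : List Word} {c : Arrow}
    {t : Gen m (n + 2)} (hn : ys.length = n + 1) (hys : ∀ x ∈ y :: ys, Irr x)
    (hp : IsPath m i (y :: ys).flatten) (hc : c ≠ s) (ht : t.mid = s :: zigzag c (n + 1)) :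
    t ∈ splitTerms k m (n + 2) i (y :: ys).flatten ↔ t.src = i ∧
      nf (t.left ++ t.mid ++ t.right) = nf (y :: ys).flatten ∧
      ∃ j, AllCross j i ys ∧ ∃ y' y'' rest, ys = (y' ++ c :: y'') :: rest ∧
        Crosses j (i + shift (y'' ++ rest.flatten)) [c] ∧
        ∃ d, nf (y ++ y') = t.left ++ List.replicate (d + 1) s := by
  have hy : Irr y := hys y (by simp)
  have hys' : ∀ x ∈ ys, Irr x := fun x hx => hys x (List.mem_cons_of_mem _ hx)
  constructor
  · intro hmem
    obtain ⟨h1, u, v, h2, h3, h4, h5⟩ := mem_splitTerms.1 hmem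
    refine ⟨h1, nf_total_of_mem_splitTerms hmem, ?_⟩
    rw [ht] at h2 h3
    -- The loop of the ambiguity is counted with the left part, so that the word is cut at the first
    -- genuine crossing `c`.
    obtain ⟨U, hU⟩ : ∃ U, U = u ++ [s] := ⟨_, rfl⟩
    have ew : u ++ s :: zigzag c (n + 1) ++ v = U ++ c :: (zigzag (opp c) n ++ v) := by
      simp [zigzag, hU]
    rw [ew] at h2 h3
    have h6 : IsPath m i (c :: (zigzag (opp c) n ++ v)) := ((isPath_append _ _ _ _).1 h3).1
    obtain ⟨j, -, -, hj⟩ := h6.exists_strand hc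
    have hV : crossings j i (zigzag (opp c) n ++ v) = crossings j i v + n := by
      have hj' : Crosses j (i + shift v + shift (zigzag (opp c) n)) [c] := by
        rw [shift_append] at hj; rwa [add_assoc, add_comm (shift v)]
      have := crossings_zigzag hj'
      rw [zigzag, crossings_cons_of_crosses hj'] at this
      rw [crossings_append]
      omega
    generalize zigzag (opp c) n ++ v = V at *
    have h7 : crossings j i (U ++ c :: V) =
        crossings j i v + (n + 1) + crossings j (i + shift (c :: V)) U := by
      rw [crossings_append, crossings_cons_of_crosses hj]
      omega
    have h8 := crossings_flatten_le (j := j) (i := i) hys'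
    have h9 := h2.crossings_le j i
    have h10 := odd_crossings_congr h2 j i
    rw [Nat.odd_iff, Nat.odd_iff] at h10
    have h11 := hy.crossings_le_one j (i + shift ys.flatten)
    have h12 : crossings j i (y :: ys).flatten =
        crossings j i ys.flatten + crossings j (i + shift ys.flatten) y := by
      rw [List.flatten_cons, crossings_append]
    -- If `y` does not cross, the `n + 1` crossings of the zigzag must all come from `ys`. If `y`
    -- crosses, one crossing is to spare; parity forces the total to be preserved, so the crossing
    -- of `y` persists under reduction. It cannot be `c`, because only copies of its own arrow stand
    -- above it whereas `U` ends in a dot. So it lies in `U`, and again all of `ys` must cross.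
    have key : crossings j i v = 0 ∧ AllCross j i ys := by
      rw [← crossings_flatten_eq_length_iff hys']
      by_cases hcr : Crosses j (i + shift ys.flatten) y
      · have h13 := (hy.crossings_eq_one_iff (j := j)).2 hcr
        obtain ⟨A, c₀, z, rfl, hc₀⟩ := hy.exists_crossing hcr
        have hc₀' : Crosses j (i + shift (z ++ ys.flatten)) [c₀] := by
          rw [shift_append]; convert hc₀ using 1; ring
        have h14 : crossings j i (z ++ ys.flatten) = crossings j i ys.flatten := by
          rw [crossings_append, crossings_cons_of_crosses hc₀] at h13
          rw [crossings_append]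
          omega
        obtain ⟨A', B', d, e, hB', hA', hcr'⟩ := Reduces.track (j := j) (a := i) (A := A)
          (B := z ++ ys.flatten) (x := c₀) (by simpa using h2) hc₀' (by
            simp only [List.flatten_cons, List.append_assoc, List.cons_append] at *
            omega)
        obtain rfl := hy.eq_of_reduces_dots hc₀.ne_s hA'
        have h15 : crossings j (i + shift (c :: V)) U ≠ 0 := by
          intro h0
          obtain ⟨h16, -, -⟩ := crossing_unique (j := j) (a := i) e hj hB' (by omega)
          have h17 := hy.left_eq_replicate hc₀.ne_s
          rw [← h16] at h17
          have h18 : s ∈ U := by simp [hU]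
          rw [h17] at h18
          exact hc₀.ne_s (List.eq_of_mem_replicate h18).symm
        omega
      · have h13 : crossings j (i + shift ys.flatten) y = 0 := by
          have := (hy.crossings_eq_one_iff (j := j) (a := i + shift ys.flatten)).not.2 hcr
          omega
        omega
    obtain ⟨hv, hall⟩ := key
    refine ⟨j, hall, ?_⟩
    rcases ys with _ | ⟨y₁, rest⟩
    · simp at hn
    have hy₁ : Irr y₁ := hys' y₁ (by simp)
    obtain ⟨y', c₁, y'', rfl, hc₁⟩ := hy₁.exists_crossing (allCross_cons.1 hall).1
    have hc₁' : Crosses j (i + shift (y'' ++ rest.flatten)) [c₁] := by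
      rw [shift_append]; convert hc₁ using 1; ring
    have h13 := (hy₁.crossings_eq_one_iff (j := j)).2 (allCross_cons.1 hall).1
    have h14 := (crossings_flatten_eq_length_iff
      fun x hx => hys' x (List.mem_cons_of_mem _ hx)).2 (allCross_cons.1 hall).2
    have h15 := (crossings_flatten_eq_length_iff hys').2 hall
    simp only [List.length_cons] at hn h15
    have h16 : crossings j i (y'' ++ rest.flatten) = n := by
      rw [crossings_append, crossings_cons_of_crosses hc₁] at h13
      rw [crossings_append]
      omega
    obtain ⟨A', B', d, e, hB', hA', hcr⟩ := Reduces.track (j := j) (a := i) (A := y ++ y')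
      (B := y'' ++ rest.flatten) (x := c₁) (by simpa using h2) hc₁' (by
        simp only [List.flatten_cons, List.append_assoc, List.cons_append] at *
        omega)
    obtain ⟨rfl, rfl, rfl⟩ := crossing_unique (j := j) (a := i) e hj hB' (by omega)
    -- The part above the crossing ends in the loop of the ambiguity; together with the `d` dots
    -- lost during tracking this makes `d + 1`.
    refine ⟨y', y'', rest, rfl, hc₁', d, ?_⟩
    rw [← hA'.nf_eq, ← h4, ← nf_append_dots]
    simp [List.replicate_succ, hU]
  · rintro ⟨h1, h2, j, h3, y', y'', rest, rfl, h4, d, h5⟩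
    simp only [List.length_cons, Nat.add_right_cancel_iff] at hn
    obtain ⟨v, hv⟩ := (allCross_cons.1 h3).2.reduces
      (fun x hx => hys' x (List.mem_cons_of_mem _ hx)) (hys' _ (List.mem_cons_self ..)) h4
    refine mem_splitTerms_of_reduces (v := List.replicate d s ++ v) hp h1 h2 ?_
    rw [hn] at hv
    rw [ht]
    -- Build the zigzag below, straighten everything above it, and slide `d` of the `d + 1` dots
    -- through; the remaining dot becomes the loop of the ambiguity.
    have r1 := reduces_context y [] hv
    have r2 := reduces_context [] (zigzag c (n + 1) ++ v) (Reduces.of_nf_eq h5)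
    have r3 := reduces_context (t.left ++ [s]) v (reduces_dots_zigzag hc d (n + 1))
    have := ReflTransGen.trans (ReflTransGen.trans (by simpa [Reduces] using r1)
      (by simpa [Reduces] using r2)) (by simpa [Reduces, List.replicate_succ] using r3)
    simpa [Reduces] using this

theorem splitTerms_eq_strandTerms {n : ℕ} {i : ℤ} {y : Word} {ys : List Word}
    (hn : ys.length = n + 1) (hys : ∀ x ∈ y :: ys, Irr x) (hp : IsPath m i (y :: ys).flatten) :
    splitTerms k m (n + 2) i (y :: ys).flatten = strandTerms m (n + 2) i y ys := by
  have hys' : ∀ x ∈ ys, Irr x := fun x hx => hys x (List.mem_cons_of_mem _ hx)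
  ext t
  simp only [strandTerms, Set.mem_ofPred_eq]
  constructor
  · intro h
    obtain ⟨c, hc, ht | ht⟩ := t.mid_amb.cases
    · obtain ⟨h1, h2, j, h3, z, rfl, h4⟩ := (mem_splitTerms_zigzag hn hys hp hc ht).1 h
      have hb := h4.strand_bounds (m := m) (u := t.left) (by simpa using hp)
      refine ⟨h1, h2, j, hb.1, hb.2, (allCross_cons.1 h3).2, ?_⟩
      rcases ys with _ | ⟨y₁, rest⟩
      · simp at hn
      have hy₁ : Irr y₁ := hys' y₁ (by simp)
      obtain ⟨y', c₁, y'', rfl, hc₁⟩ :=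
        hy₁.exists_crossing (allCross_cons.1 (allCross_cons.1 h3).2).1
      have hc₁' : Crosses j (i + shift (y'' ++ rest.flatten)) [c₁] := by
        rw [shift_append]; convert hc₁ using 1; ring
      obtain ⟨rfl, -⟩ := crosses_opp_of_allCross hy₁ (hys _ (List.mem_cons_self ..)) hc₁'
        (by simpa using h4)
      exact ⟨y', c₁, y'', rest, rfl, hc₁', Or.inr ⟨ht, z, rfl, h4⟩⟩
    · obtain ⟨h1, h2, j, h3, y', y'', rest, rfl, h4, h5⟩ :=
        (mem_splitTerms_s_zigzag hn hys hp hc ht).1 h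
      have hb := h4.strand_bounds (m := m) (u := y ++ y') (by simpa using hp)
      exact ⟨h1, h2, j, hb.1, hb.2, h3, y', c, y'', rest, rfl, h4, Or.inl ⟨ht, h5⟩⟩
  · rintro ⟨h1, h2, j, -, -, h3, y', c, y'', rest, rfl, h4, ⟨ht, h5⟩ | ⟨ht, z, rfl, h5⟩⟩
    · exact (mem_splitTerms_s_zigzag hn hys hp h4.ne_s ht).2
        ⟨h1, h2, j, h3, y', y'', rest, rfl, h4, h5⟩
    · refine (mem_splitTerms_zigzag hn hys hp (opp_ne_s h4.ne_s) ht).2 ⟨h1, h2, j, ?_, z, rfl, h5⟩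
      exact allCross_cons.2 ⟨allCross_cons_of_split (hys _ (List.mem_cons_self ..)) h5, h3⟩

end

/-! ### Pure tensors and the bimodule structure -/

section

variable {k : Type*} [Field k] {m : ℕ}

theorem tens_of_not_isPath {n : ℕ} {a : ℤ} {u r v : Word} (h : ¬ IsPath m a (u ++ r ++ v)) :
    tens k m n a u r v = 0 := by
  unfold tens; rw [dif_neg]; exact fun h' => h h'.2

theorem tens_of_not_amb {n : ℕ} {a : ℤ} {u r v : Word} (h : ¬ Amb n r) :
    tens k m n a u r v = 0 := by
  unfold tens; rw [dif_neg]; exact fun h' => h h'.1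

theorem exists_tens_eq_single {n : ℕ} {a : ℤ} {u r v : Word} (h : Amb n r)
    (hp : IsPath m a (u ++ r ++ v)) :
    ∃ t : Gen m n, tens k m n a u r v = Finsupp.single t 1 ∧ t.src = a ∧ t.left = nf u ∧
      t.mid = r ∧ t.right = nf v := by
  unfold tens
  rw [dif_pos ⟨h, hp⟩]
  exact ⟨_, rfl, rfl, rfl, rfl, rfl⟩

theorem single_eq_tens {n : ℕ} (t : Gen m n) :
    Finsupp.single t (1 : k) = tens k m n t.src t.left t.mid t.right := by
  obtain ⟨t', h1, h2, h3, h4, h5⟩ := exists_tens_eq_single (k := k) t.mid_amb t.isPath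
  rw [h1]
  congr 1
  exact Gen.ext h2.symm (by rw [h3, irr_iff.1 t.left_irr]) h4.symm
    (by rw [h5, irr_iff.1 t.right_irr])

theorem tens_congr {n : ℕ} {a : ℤ} {u u' r v v' : Word}
    (hp : IsPath m a (u ++ r ++ v) ↔ IsPath m a (u' ++ r ++ v')) (h1 : nf u = nf u')
    (h2 : nf v = nf v') : tens k m n a u r v = tens k m n a u' r v' := by
  classical
  ext t
  rw [tens_apply, tens_apply, h1, h2, hp]

theorem isPath_nf_nf_iff {a : ℤ} {u r v : Word} (x : Word) (h : IsPath m a (u ++ r ++ v)) :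
    IsPath m a (x ++ nf u ++ r ++ nf v) ↔ IsPath m a (x ++ u ++ r ++ v) := by
  simp only [isPath_append, shift_nf] at h ⊢
  have h1 := isPath_nf h.1
  have h2 := isPath_nf h.2.2
  tauto

theorem isPath_append_right_iff {a b : ℤ} {u r v y : Word} (hb : b + shift y = a)
    (h : IsPath m a (u ++ r ++ v)) :
    IsPath m b (nf u ++ r ++ (nf v ++ y)) ↔ IsPath m b (u ++ r ++ (v ++ y)) := by
  subst hb
  simp only [isPath_append, shift_append, shift_nf] at h ⊢
  have h1 := isPath_nf h.1
  have h2 := isPath_nf h.2.2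
  rw [show b + (shift v + shift y) = b + shift y + shift v by ring]
  tauto

theorem lact_tens (n : ℕ) (a b : ℤ) (x u r v : Word) :
    lact k m n b x (tens k m n a u r v) =
      if b = a + shift (u ++ r ++ v) then tens k m n a (x ++ u) r v else 0 := by
  by_cases ha : Amb n r
  swap
  · rw [tens_of_not_amb ha, tens_of_not_amb ha]; simp
  by_cases hp : IsPath m a (u ++ r ++ v)
  · obtain ⟨t, h1, h2, h3, h4, h5⟩ := exists_tens_eq_single (k := k) ha hp
    rw [h1, lact, Finsupp.linearCombination_single, one_smul, Gen.tgt, h2, h3, h4, h5]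
    simp only [shift_append, shift_nf]
    split_ifs
    · exact tens_congr (isPath_nf_nf_iff x hp) (nf_append_congr rfl (nf_nf u)) (nf_nf v)
    · rfl
  · rw [tens_of_not_isPath hp, tens_of_not_isPath (u := x ++ u)]
    · simp
    · intro h
      apply hp
      simp only [isPath_append] at h ⊢
      tauto

theorem ract_tens (n : ℕ) (a b : ℤ) (y u r v : Word) :
    ract k m n b y (tens k m n a u r v) =
      if b + shift y = a then tens k m n b u r (v ++ y) else 0 := by
  by_cases ha : Amb n r
  swap
  · rw [tens_of_not_amb ha, tens_of_not_amb ha]; simp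
  by_cases hp : IsPath m a (u ++ r ++ v)
  · obtain ⟨t, h1, h2, h3, h4, h5⟩ := exists_tens_eq_single (k := k) ha hp
    rw [h1, ract, Finsupp.linearCombination_single, one_smul, h2, h3, h4, h5]
    split_ifs with hb
    · exact tens_congr (isPath_append_right_iff hb hp) (nf_nf u) (nf_append_congr (nf_nf v) rfl)
    · rfl
  · rw [tens_of_not_isPath hp, map_zero]
    split_ifs with hb
    · rw [tens_of_not_isPath]
      subst hb
      intro h
      apply hp
      simp only [isPath_append, shift_append] at h ⊢
      rw [show b + shift y + shift v = b + (shift v + shift y) by ring]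
      tauto
    · rfl

theorem sandwich_tens {n n' : ℕ} (t : Gen m n) {u r v : Word}
    (h : shift (u ++ r ++ v) = shift t.mid) :
    sandwich k m n' t (tens k m n' (t.src + shift t.right) u r v) =
      tens k m n' t.src (t.left ++ u) r (v ++ t.right) := by
  rw [sandwich, ract_tens, if_pos rfl, lact_tens, if_pos]
  simp only [shift_append] at h ⊢
  linarith

/-- The operators `x · f · y` are linear. -/
theorem sandwich_add {n n' : ℕ} (t : Gen m n) (f g : P k m n') :
    sandwich k m n' t (f + g) = sandwich k m n' t f + sandwich k m n' t g := by
  simp [sandwich]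

theorem sandwich_sub {n n' : ℕ} (t : Gen m n) (f g : P k m n') :
    sandwich k m n' t (f - g) = sandwich k m n' t f - sandwich k m n' t g := by
  simp [sandwich]

theorem sandwich_smul {n n' : ℕ} (t : Gen m n) (c : k) (f : P k m n') :
    sandwich k m n' t (c • f) = c • sandwich k m n' t f := by
  simp [sandwich]

/-! ### The maps `δ` and `γ` -/

theorem split_eq_add {n : ℕ} (a : ℤ) {w : Word} (h : Amb (n + 1) w) :
    split k m n a w = splitL k m n a w + splitR k m n a w := by
  have hl := h.1
  rw [split, hl, Finset.sum_range_succ', Finset.sum_range_succ', Finset.sum_eq_zero, zero_add,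
    add_comm]
  · congr 1
    rw [splitR]
    congr 1
    · rw [List.take_of_length_le]; simp [hl]
    · rw [List.drop_eq_nil_of_le]; simp [hl]
  · intro l hl'
    rw [Finset.mem_range] at hl'
    apply tens_of_not_amb
    intro h
    have := h.1
    rw [List.length_take, List.length_drop, hl] at this
    omega

/-- A word in `S_{n+1}` has room for just two subpaths of length `n`, so the even and odd
definitions merge into one formula with a sign. -/
theorem delta_tens {n : ℕ} (a : ℤ) (u : Word) {w : Word} (v : Word) (hw : Amb (n + 1) w) :
    delta k m n (tens k m (n + 1) a u w v) = tens k m n a u (w.take n) (w.drop n ++ v) +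
      (-1 : k) ^ (n + 1) • tens k m n a (u ++ w.take 1) (w.drop 1) v := by
  have e1 : u ++ w.take n ++ (w.drop n ++ v) = u ++ w ++ v := by
    rw [List.append_assoc, ← List.append_assoc (w.take n), List.take_append_drop]; simp
  have e2 : u ++ w.take 1 ++ w.drop 1 ++ v = u ++ w ++ v := by
    rw [List.append_assoc u, List.take_append_drop]
  by_cases hp : IsPath m a (u ++ w ++ v)
  · have hnf : IsPath m a (nf u ++ w ++ nf v) ↔ IsPath m a (u ++ w ++ v) := by
      simpa using isPath_nf_nf_iff [] hp
    obtain ⟨t, h1, h2, h3, h4, h5⟩ := exists_tens_eq_single (k := k) hw hp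
    rw [h1, delta, Finsupp.linearCombination_single, one_smul]
    have h6 : (if Even (n + 1) then split k m n (t.src + shift t.right) t.mid
        else splitL k m n (t.src + shift t.right) t.mid -
          splitR k m n (t.src + shift t.right) t.mid) =
        splitL k m n (t.src + shift t.right) t.mid +
          (-1 : k) ^ (n + 1) • splitR k m n (t.src + shift t.right) t.mid := by
      split_ifs with he
      · rw [split_eq_add _ t.mid_amb, he.neg_one_pow, one_smul]
      · rw [(Nat.not_even_iff_odd.1 he).neg_one_pow, neg_one_smul, sub_eq_add_neg]
    rw [h6, sandwich_add, sandwich_smul, splitL, splitR, sandwich_tens, sandwich_tens, h2, h3, h4,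
      h5]
    · congr 1
      · refine tens_congr ?_ (by simp) (nf_append_congr rfl (nf_nf v))
        rw [e1, ← hnf]
        have : nf u ++ [] ++ w.take n ++ (w.drop n ++ nf v) = nf u ++ w ++ nf v := by
          rw [List.append_nil, List.append_assoc, ← List.append_assoc (w.take n),
            List.take_append_drop]; simp
        rw [this]
      · congr 1
        refine tens_congr ?_ (nf_append_congr (nf_nf u) rfl) (by simp)
        rw [e2, ← hnf]
        have : nf u ++ w.take 1 ++ w.drop 1 ++ ([] ++ nf v) = nf u ++ w ++ nf v := by
          rw [List.append_assoc (nf u), List.take_append_drop]; simp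
        rw [this]
    · rw [List.append_nil, List.take_append_drop]
    · rw [List.nil_append, List.take_append_drop]
  · rw [tens_of_not_isPath hp, tens_of_not_isPath, tens_of_not_isPath]
    · simp
    · rwa [e2]
    · rwa [e1]

/-! ### Tight elements: the image and the vanishing of `γ` -/

/-- The basis elements `u ⊗ r ⊗ v` such that no letter of `u` extends `r` to an ambiguity. -/
def Tight {n : ℕ} (t : Gen m n) : Prop := ∀ u x, t.left = u ++ [x] → ¬ Amb (n + 1) (x :: t.mid)

variable (k m) in
/-- The span of the tight basis elements. -/
def tightSpan (n : ℕ) : Submodule k (P k m n) := Finsupp.supported k k {t | Tight t}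

theorem single_mem_tightSpan {n : ℕ} {t : Gen m n} (h : Tight t) :
    Finsupp.single t (1 : k) ∈ tightSpan k m n := Finsupp.single_mem_supported k 1 h

theorem tens_mem_tightSpan {n : ℕ} {a : ℤ} {u r v : Word}
    (h : ∀ u' x, nf u = u' ++ [x] → ¬ Amb (n + 1) (x :: r)) :
    tens k m n a u r v ∈ tightSpan k m n := by
  by_cases ha : Amb n r
  swap
  · rw [tens_of_not_amb ha]; exact zero_mem _
  by_cases hp : IsPath m a (u ++ r ++ v)
  · obtain ⟨t, h1, h2, h3, h4, h5⟩ := exists_tens_eq_single (k := k) ha hp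
    rw [h1]
    apply single_mem_tightSpan
    intro u' x e
    rw [h4]
    exact h u' x (by rw [← h3, e])
  · rw [tens_of_not_isPath hp]; exact zero_mem _

theorem tens_nil_mem_tightSpan {n : ℕ} (a : ℤ) (r v : Word) :
    tens k m n a [] r v ∈ tightSpan k m n := by
  apply tens_mem_tightSpan
  intro u' x e
  rw [irr_iff.1 irr_nil] at e
  simp at e

theorem tens_s_mem_tightSpan {n : ℕ} (a : ℤ) (u r v : Word) :
    tens k m n a u (s :: r) v ∈ tightSpan k m n := by
  apply tens_mem_tightSpan
  rintro u' x - h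
  exact not_inS_s x (by
    have := h.2
    simp [List.isChain_cons_cons] at this
    exact this.1)

theorem tens_irr_mem_tightSpan {n : ℕ} (a : ℤ) {u r v : Word} {x : Arrow} (h : Irr (u ++ [x])) :
    tens k m n a u (x :: r) v ∈ tightSpan k m n := by
  apply tens_mem_tightSpan
  intro u' y e h'
  rw [irr_iff.1 (h.of_infix ⟨[], [x], by simp⟩)] at e
  subst e
  have h2 := h'.2
  simp only [List.isChain_cons_cons] at h2
  exact h _ h2.1 ⟨u', [], by simp⟩

theorem lact_nil_mem_tightSpan {n : ℕ} (a : ℤ) {f : P k m n} (hf : f ∈ tightSpan k m n) :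
    lact k m n a [] f ∈ tightSpan k m n := by
  rw [tightSpan, Finsupp.supported_eq_span_single] at hf
  induction hf using Submodule.span_induction with
  | mem x hx =>
    obtain ⟨t, ht, rfl⟩ := hx
    simp only [single_eq_tens, lact_tens]
    split_ifs
    · rw [List.nil_append, ← single_eq_tens]; exact single_mem_tightSpan ht
    · exact zero_mem _
  | zero => simp
  | add x y _ _ hx hy => rw [map_add]; exact add_mem hx hy
  | smul c x _ hx => rw [map_smul]; exact Submodule.smul_mem _ _ hx

theorem ract_mem_tightSpan {n : ℕ} (a : ℤ) (y : Word) {f : P k m n} (hf : f ∈ tightSpan k m n) :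
    ract k m n a y f ∈ tightSpan k m n := by
  rw [tightSpan, Finsupp.supported_eq_span_single] at hf
  induction hf using Submodule.span_induction with
  | mem x hx =>
    obtain ⟨t, ht, rfl⟩ := hx
    simp only [single_eq_tens, ract_tens]
    split_ifs
    · apply tens_mem_tightSpan
      intro u' x e
      rw [irr_iff.1 t.left_irr] at e
      exact ht u' x e
    · exact zero_mem _
  | zero => simp
  | add x y _ _ hx hy => rw [map_add]; exact add_mem hx hy
  | smul c x _ hx => rw [map_smul]; exact Submodule.smul_mem _ _ hx

theorem le_ker_of_tight {n : ℕ} {M : Type*} [AddCommGroup M] [Module k M] (F : P k m n →ₗ[k] M)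
    (h : ∀ t : Gen m n, Tight t → F (Finsupp.single t 1) = 0) {f : P k m n}
    (hf : f ∈ tightSpan k m n) : F f = 0 := by
  rw [tightSpan, Finsupp.supported_eq_span_single] at hf
  induction hf using Submodule.span_induction with
  | mem x hx => obtain ⟨t, ht, rfl⟩ := hx; exact h t ht
  | zero => simp
  | add x y _ _ hx hy => rw [map_add, hx, hy, add_zero]
  | smul c x _ hx => rw [map_smul, hx, smul_zero]

theorem gamma_single {n : ℕ} (t : Gen m n) :
    gamma k m n (Finsupp.single t 1) = (-1 : k) ^ (n + 1) •
      ∑ l ∈ Finset.range ((t.left ++ t.mid).length + 1),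
        tens k m (n + 1) t.src ((t.left ++ t.mid).take l)
          (((t.left ++ t.mid).drop l).take (n + 1))
          (((t.left ++ t.mid).drop l).drop (n + 1) ++ t.right) := by
  rw [gamma, Finsupp.linearCombination_single, one_smul, split, map_sum]
  simp only [ract_tens, if_true]

/-- Only one splitting position contributes: further right the remaining word is too short, and
further left the ambiguity would contain two consecutive letters of the irreducible left factor.
This needs ambiguities of length at least two, hence the degree `n + 1`. -/
theorem gamma_single_of_left_eq {n : ℕ} {t : Gen m (n + 1)} {u : Word} {x : Arrow}
    (h : t.left = u ++ [x]) :
    gamma k m (n + 1) (Finsupp.single t 1) =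
      (-1 : k) ^ (n + 2) • tens k m (n + 2) t.src u (x :: t.mid) t.right := by
  have hm := t.mid_amb.1
  rw [gamma_single]
  congr 1
  rw [Finset.sum_eq_single u.length]
  · have h1 : t.mid.take (n + 1) = t.mid := List.take_of_length_le hm.le
    have h2 : t.mid.drop (n + 1) = [] := List.drop_eq_nil_of_le hm.le
    simp [h, h1, h2]
  · intro l _ hl
    apply tens_of_not_amb
    intro ha
    have h1 := ha.1
    rw [List.length_take, List.length_drop, List.length_append, hm, h, List.length_append,
      List.length_singleton] at h1
    have hlu : l < u.length := by omega
    rcases hd : (u ++ [x]).drop l with _ | ⟨y, _ | ⟨z, e⟩⟩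
    · rw [List.drop_eq_nil_iff] at hd; simp at hd; omega
    · have := congrArg List.length hd
      simp at this
      omega
    · rw [h, List.drop_append_of_le_length (by simp; omega), hd] at ha
      have h2 := ha.2
      simp only [List.cons_append, List.take_succ_cons, List.isChain_cons_cons] at h2
      refine t.left_irr _ h2.1 ?_
      rw [h]
      exact ⟨(u ++ [x]).take l, e, by
        have := List.take_append_drop l (u ++ [x])
        rw [hd] at this; simpa using this⟩
  · intro hu
    simp [h] at hu

theorem gamma_single_of_left_nil {n : ℕ} {t : Gen m n} (h : t.left = []) :
    gamma k m n (Finsupp.single t 1) = 0 := by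
  rw [gamma_single, Finset.sum_eq_zero, smul_zero]
  intro l _
  apply tens_of_not_amb
  intro ha
  have h1 := ha.1
  rw [List.length_take, List.length_drop, List.length_append, t.mid_amb.1, h,
      List.length_nil] at h1
  omega

/-- In positive degree `γ` can only move the last letter of the left factor into the ambiguity,
which tightness forbids. In degree `0` every arrow is an ambiguity, so a tight element has empty
left factor. -/
theorem gamma_apply_tight {n : ℕ} {f : P k m n} (hf : f ∈ tightSpan k m n) :
    gamma k m n f = 0 := by
  refine le_ker_of_tight _ ?_ hf
  intro t ht
  rcases List.eq_nil_or_concat t.left with h | ⟨u, x, h⟩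
  · exact gamma_single_of_left_nil h
  · rw [List.concat_eq_append] at h
    rcases n with _ | n
    · have h1 := ht u x h
      have h2 := List.eq_nil_of_length_eq_zero t.mid_amb.1
      rw [h2] at h1
      exact absurd (amb_singleton x) h1
    · rw [gamma_single_of_left_eq h, tens_of_not_amb (ht u x h), smul_zero]

theorem gamma_zero_single (t : Gen m 0) :
    gamma k m 0 (Finsupp.single t 1) = - ract k m 1 t.src t.right
      (split k m 1 (t.src + shift t.right) t.left) := by
  have h2 := List.eq_nil_of_length_eq_zero t.mid_amb.1
  rw [gamma, Finsupp.linearCombination_single, one_smul, h2, List.append_nil]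
  simp

/-- The letter that `γ` moves into the ambiguity was part of an irreducible path, so its left
neighbour does not form an element of `S` with it. -/
theorem gamma_mem_tightSpan {n : ℕ} (f : P k m n) : gamma k m n f ∈ tightSpan k m (n + 1) := by
  induction f using Finsupp.induction_linear with
  | zero => simp
  | add f g hf hg => rw [map_add]; exact add_mem hf hg
  | single t c =>
    rw [← mul_one c, ← smul_eq_mul, ← Finsupp.smul_single, map_smul]
    apply Submodule.smul_mem
    rcases n with _ | n
    · rw [gamma_zero_single]
      apply Submodule.neg_mem
      apply ract_mem_tightSpan
      apply Submodule.sum_mem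
      intro l hl
      rcases hd : t.left.drop l with _ | ⟨x, e⟩
      · rw [tens_of_not_amb (by simp [Amb])]; exact zero_mem _
      · have := List.take_append_drop l t.left
        rw [hd] at this
        apply tens_irr_mem_tightSpan
        exact t.left_irr.of_infix ⟨[], e, by simpa using this⟩
    · rcases List.eq_nil_or_concat t.left with h | ⟨u, x, h⟩
      · rw [gamma_single_of_left_nil h]; exact zero_mem _
      · rw [List.concat_eq_append] at h
        rw [gamma_single_of_left_eq h]
        apply Submodule.smul_mem
        apply tens_irr_mem_tightSpan
        rw [← h]; exact t.left_irr

end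

/-! ### The maps `∂` and `ρ` -/

section

variable (k : Type*) [Field k] (m : ℕ)

/-- The difference `δ_{n+1} - ∂_{n+1}`. -/
noncomputable def err (n : ℕ) : P k m (n + 1) →ₗ[k] P k m n := delta k m n - diff k m n

/-- An explicit formula for `err` on `u ⊗ w ⊗ v`. -/
noncomputable def errTerm (n : ℕ) (a : ℤ) (u : Word) : Word → Word → P k m n
  | x :: y :: r, v => (-1 : k) ^ (n + 1) •
      if x = s then tens k m n a (u ++ [y]) (s :: r) v + tens k m n a u (y :: r) (s :: v)
      else tens k m n a u (s :: r) v
  | _, _ => 0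

variable {k m}

theorem rhoSummand_diff (n : ℕ) (t : Gen m n) (i : ℕ) :
    rhoSummand k m n (diff k m n) t i =
      gamma k m n (((err k m n ∘ₗ gamma k m n) ^ i) (Finsupp.single t 1)) := by
  rw [rhoSummand, err, LinearMap.sub_comp]

theorem rho_eq_rhoOf (n : ℕ) : rho k m n = rhoOf k m n (diff k m n) := by
  cases n <;> rfl

theorem rho_single (n : ℕ) (t : Gen m n) :
    rho k m n (Finsupp.single t 1) = ∑ᶠ i, rhoSummand k m n (diff k m n) t i := by
  rw [rho_eq_rhoOf, rhoOf, Finsupp.linearCombination_single, one_smul]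

theorem gamma_err_pow_tight {n : ℕ} {f : P k m n} (hf : f ∈ tightSpan k m n) (i : ℕ) :
    gamma k m n (((err k m n ∘ₗ gamma k m n) ^ i) f) = 0 := by
  cases i with
  | zero => exact gamma_apply_tight hf
  | succ i => simp [pow_succ, gamma_apply_tight hf]

theorem rhoSummand_of_tight {n : ℕ} {t : Gen m n} (ht : Tight t) (i : ℕ) :
    rhoSummand k m n (diff k m n) t i = 0 := by
  rw [rhoSummand_diff, gamma_err_pow_tight (single_mem_tightSpan ht)]

/-- Tight errors contribute nothing to later summands, so `err ∘ γ` matters only modulo `tightSpan`.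
This turns the series for `ρ` into a recursion. -/
theorem rhoSummand_succ {n : ℕ} {t : Gen m n} {f : P k m n}
    (h : err k m n (gamma k m n (Finsupp.single t 1)) - f ∈ tightSpan k m n) (i : ℕ) :
    rhoSummand k m n (diff k m n) t (i + 1) =
      gamma k m n (((err k m n ∘ₗ gamma k m n) ^ i) f) := by
  rw [rhoSummand_diff, pow_succ]
  have := gamma_err_pow_tight h i
  rw [map_sub, map_sub, sub_eq_zero] at this
  simpa using this

theorem rho_apply_tight {n : ℕ} {f : P k m n} (hf : f ∈ tightSpan k m n) : rho k m n f = 0 := by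
  refine le_ker_of_tight _ ?_ hf
  intro t ht
  rw [rho_single]
  simp [rhoSummand_of_tight ht]

theorem finsum_nat_eq_add {M : Type*} [AddCommMonoid M] {f : ℕ → M}
    (h : (Function.support f).Finite) : ∑ᶠ i, f i = f 0 + ∑ᶠ i, f (i + 1) := by
  obtain ⟨N, hN⟩ := h.bddAbove
  have h1 : Function.support f ⊆ ↑(Finset.range (N + 2)) := by
    intro i hi
    have := hN hi
    simp; omega
  have h2 : Function.support (fun i => f (i + 1)) ⊆ ↑(Finset.range (N + 1)) := by
    intro i hi
    have := hN (show i + 1 ∈ Function.support f from hi)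
    simp; omega
  rw [finsum_eq_sum_of_support_subset _ h1, finsum_eq_sum_of_support_subset _ h2,
    Finset.sum_range_succ', add_comm]

/-- Every summand of `ρ` ends with an application of `γ`. Together with `rho_apply_tight` this makes
consecutive `ρ`s compose to zero. -/
theorem rho_mem_tightSpan {n : ℕ} (f : P k m n) : rho k m n f ∈ tightSpan k m (n + 1) := by
  induction f using Finsupp.induction_linear with
  | zero => simp
  | add f g hf hg => rw [map_add]; exact add_mem hf hg
  | single t c =>
    rw [← mul_one c, ← smul_eq_mul, ← Finsupp.smul_single, map_smul]
    apply Submodule.smul_mem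
    rw [rho_single]
    refine finsum_induction (· ∈ tightSpan k m (n + 1)) (zero_mem _) (fun _ _ => add_mem) ?_
    intro i
    rw [rhoSummand_diff]
    exact gamma_mem_tightSpan _

theorem isPath_s_cons {a : ℤ} {w : Word} : IsPath m a (s :: w) ↔ IsPath m a w := by
  rw [isPath_cons, shift_cons, shift_s, zero_add]
  exact ⟨fun h => h.1, fun h => ⟨h, h w List.suffix_rfl⟩⟩

/-! ### Evaluation of `ρ` from the error formula -/

/-- The formula `errTerm` for `err` in degree `n + 1`. -/
def ErrFormula (k : Type*) [Field k] (m n : ℕ) : Prop := ∀ t : Gen m (n + 1),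
  err k m n (Finsupp.single t 1) = errTerm k m n t.src t.left t.mid t.right

theorem ErrFormula.err_tens {n : ℕ} (hE : ErrFormula k m n) {a : ℤ} {u w v : Word}
    (hw : Amb (n + 1) w) (hp : IsPath m a (u ++ w ++ v)) :
    err k m n (tens k m (n + 1) a u w v) = errTerm k m n a (nf u) w (nf v) := by
  obtain ⟨t, h1, h2, h3, h4, h5⟩ := exists_tens_eq_single (k := k) hw hp
  rw [h1, hE, h2, h3, h4, h5]

theorem isPath_slide_iff {a : ℤ} {u r v : Word} :
    IsPath m a (u ++ r ++ s :: v) ↔ IsPath m a (u ++ [s] ++ r ++ v) := by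
  simp only [isPath_append, shift_cons s v, isPath_s_cons, shift_s, isPath_nil, zero_add]
  constructor
  · rintro ⟨h1, h2, h3⟩
    exact ⟨h1, h2, by simpa [shift_nil] using h3 [] (List.nil_suffix ..), by simpa [shift_append, shift_nil, add_assoc] using h3⟩
  · rintro ⟨h1, h2, -, h3⟩
    exact ⟨h1, h2, by simpa [shift_append, shift_nil, add_assoc] using h3⟩

theorem nf_append_s (w : Word) : nf (w ++ [s]) = nf w ++ [s] := nf_append_dots w 1

/-- One step of the recursion for `ρ`: a dot is dropped. -/
theorem ErrFormula.err_gamma_dot {n : ℕ} (hE : ErrFormula k m (n + 1)) {t : Gen m (n + 1)}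
    {u r : Word} {c : Arrow} (hc : c ≠ s) (h1 : t.left = u ++ [s]) (h2 : t.mid = c :: r) :
    ∃ t' : Gen m (n + 1), tens k m (n + 1) t.src u t.mid (s :: t.right) = Finsupp.single t' 1 ∧
      t'.left = u ∧
      err k m (n + 1) (gamma k m (n + 1) (Finsupp.single t 1)) - Finsupp.single t' 1 ∈
        tightSpan k m (n + 1) := by
  have hp := t.isPath
  have hu : Irr u := t.left_irr.of_infix ⟨[], [s], by simp [h1]⟩
  have hp' : IsPath m t.src (u ++ t.mid ++ s :: t.right) := by
    rw [isPath_slide_iff, ← h1]; exact hp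
  obtain ⟨t', e1, e2, e3, e4, e5⟩ := exists_tens_eq_single (k := k) t.mid_amb hp'
  refine ⟨t', e1, by rw [e3, irr_iff.1 hu], ?_⟩
  have ha : Amb (n + 2) (s :: t.mid) := by
    rw [h2, amb_cons_cons, ← h2]; exact ⟨inS_s hc, t.mid_amb⟩
  rw [gamma_single_of_left_eq h1, map_smul, hE.err_tens ha (by
    rw [h1] at hp; simpa using hp), irr_iff.1 hu, irr_iff.1 t.right_irr, ← e1, h2, errTerm,
    if_pos rfl, smul_smul, ← mul_pow]
  simp only [neg_mul_neg, mul_one, one_pow, one_smul, add_sub_cancel_right]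
  exact tens_s_mem_tightSpan _ _ _ _

/-- The error now has an ambiguity starting with a loop, which no letter extends; so the series for
`ρ` stops after its first summand. -/
theorem ErrFormula.err_gamma_arrow {n : ℕ} (hE : ErrFormula k m (n + 1)) {t : Gen m (n + 1)}
    {u : Word} {x : Arrow} (hx : x ≠ s) (h1 : t.left = u ++ [x]) :
    err k m (n + 1) (gamma k m (n + 1) (Finsupp.single t 1)) ∈ tightSpan k m (n + 1) := by
  rw [gamma_single_of_left_eq h1, map_smul]
  apply Submodule.smul_mem
  by_cases ha : Amb (n + 2) (x :: t.mid)
  · have hp := t.isPath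
    rw [hE.err_tens ha (by rw [h1] at hp; simpa using hp)]
    rcases hm : t.mid with _ | ⟨y, r⟩
    · exact zero_mem _
    · rw [errTerm, if_neg hx]
      exact Submodule.smul_mem _ _ (tens_s_mem_tightSpan _ _ _ _)
  · rw [tens_of_not_amb ha, map_zero]; exact zero_mem _

theorem Gen.mid_eq_cons {n : ℕ} (t : Gen m (n + 1)) : ∃ c r, t.mid = c :: r := by
  rcases h : t.mid with _ | ⟨c, r⟩
  · have := t.mid_amb.1
    rw [h] at this
    simp at this
  · exact ⟨c, r, rfl⟩

theorem tight_of_mid_s {n : ℕ} {t : Gen m n} {r : Word} (h : t.mid = s :: r) : Tight t := by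
  intro u x _ ha
  rw [h] at ha
  have := ha.2
  simp only [List.isChain_cons_cons] at this
  exact not_inS_s x this.1

theorem tight_of_left_nil {n : ℕ} {t : Gen m n} (h : t.left = []) : Tight t := by
  intro u x h'
  rw [h] at h'
  simp at h'

theorem ErrFormula.finite_support {n : ℕ} (hE : ErrFormula k m (n + 1)) (t : Gen m (n + 1)) :
    (Function.support (rhoSummand k m (n + 1) (diff k m (n + 1)) t)).Finite := by
  -- Each further summand drops one dot and thereby shortens the left factor.
  suffices H : ∀ L, ∀ t : Gen m (n + 1), t.left.length = L →
      ∃ N, ∀ i, N ≤ i → rhoSummand k m (n + 1) (diff k m (n + 1)) t i = 0 by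
    obtain ⟨N, hN⟩ := H _ t rfl
    refine (Set.finite_Iio N).subset fun i hi => ?_
    by_contra h
    exact hi (hN i (by simpa using h))
  intro L
  induction L with
  | zero =>
    intro t ht
    exact ⟨0, fun i _ => rhoSummand_of_tight
      (tight_of_left_nil (List.eq_nil_of_length_eq_zero ht)) i⟩
  | succ L ih =>
    intro t ht
    obtain ⟨c, r, hm⟩ := t.mid_eq_cons
    rcases List.eq_nil_or_concat t.left with h | ⟨u, x, h⟩
    · rw [h] at ht; simp at ht
    rw [List.concat_eq_append] at h
    by_cases hc : c = s
    · subst hc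
      exact ⟨0, fun i _ => rhoSummand_of_tight (tight_of_mid_s hm) i⟩
    by_cases hx : x = s
    · subst hx
      obtain ⟨t', h1, h2, h3⟩ := hE.err_gamma_dot hc h hm
      obtain ⟨N, hN⟩ := ih t' (by rw [h2]; rw [h] at ht; simpa using ht)
      refine ⟨N + 1, fun i hi => ?_⟩
      obtain ⟨i, rfl⟩ := Nat.exists_eq_add_of_le' (show 1 ≤ i by omega)
      rw [rhoSummand_succ h3, ← rhoSummand_diff]
      exact hN i (by omega)
    · refine ⟨1, fun i hi => ?_⟩
      obtain ⟨i, rfl⟩ := Nat.exists_eq_add_of_le' hi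
      rw [rhoSummand_succ (f := 0) (by simpa using hE.err_gamma_arrow hx h)]
      simp

/-- The summand `i = 0` makes the dot the first letter of the ambiguity. The rest of the series is
the series for the basis element with the dot moved to the right factor. -/
theorem ErrFormula.rho_dot {n : ℕ} (hE : ErrFormula k m (n + 1)) {a : ℤ} {u r v : Word}
    {c : Arrow} (hc : c ≠ s) :
    rho k m (n + 1) (tens k m (n + 1) a (u ++ [s]) (c :: r) v) =
      (-1 : k) ^ (n + 2) • tens k m (n + 2) a u (s :: c :: r) v +
        rho k m (n + 1) (tens k m (n + 1) a u (c :: r) (s :: v)) := by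
  by_cases ha : Amb (n + 1) (c :: r)
  swap
  · rw [tens_of_not_amb ha, tens_of_not_amb ha, tens_of_not_amb fun h => ha h.tail]
    simp
  by_cases hp : IsPath m a (u ++ [s] ++ c :: r ++ v)
  swap
  · rw [tens_of_not_isPath hp, tens_of_not_isPath (by simpa using hp),
      tens_of_not_isPath (by rwa [isPath_slide_iff])]
    simp
  obtain ⟨t, h1, h2, h3, h4, h5⟩ := exists_tens_eq_single (k := k) ha hp
  have h3' : t.left = nf u ++ [s] := h3.trans (nf_append_s u)
  obtain ⟨t', e1, e2, e3⟩ := hE.err_gamma_dot hc h3' h4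
  have e4 : tens k m (n + 1) a u (c :: r) (s :: v) = Finsupp.single t' 1 := by
    rw [← e1, h2, h4, h5]
    refine tens_congr ?_ (nf_nf u).symm (nf_append_congr (u := [s]) rfl (nf_nf v).symm)
    rw [isPath_slide_iff, isPath_slide_iff]
    have := (isPath_nf_nf_iff [] hp).symm
    rw [nf_append_s] at this
    simpa using this
  rw [h1, e4, rho_single, finsum_nat_eq_add (hE.finite_support t), rho_single]
  congr 1
  · rw [rhoSummand_diff, pow_zero, Module.End.one_apply, gamma_single_of_left_eq h3', h2, h4, h5]
    congr 1
    refine tens_congr ?_ (nf_nf u) (nf_nf v)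
    have := (isPath_nf_nf_iff [] hp)
    rw [nf_append_s] at this
    simpa using this
  · exact finsum_congr fun i => by rw [rhoSummand_succ e3, ← rhoSummand_diff]

theorem ErrFormula.rho_arrow {n : ℕ} (hE : ErrFormula k m (n + 1)) {a : ℤ} {u r v : Word}
    {x : Arrow} (hx : x ≠ s) (hu : Irr (u ++ [x])) :
    rho k m (n + 1) (tens k m (n + 1) a (u ++ [x]) r v) =
      (-1 : k) ^ (n + 2) • tens k m (n + 2) a u (x :: r) v := by
  by_cases ha : Amb (n + 1) r
  swap
  · rw [tens_of_not_amb ha, tens_of_not_amb fun h => ha h.tail]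
    simp
  by_cases hp : IsPath m a (u ++ [x] ++ r ++ v)
  swap
  · rw [tens_of_not_isPath hp, tens_of_not_isPath (u := u)]
    · simp
    · simpa using hp
  obtain ⟨t, h1, h2, h3, h4, h5⟩ := exists_tens_eq_single (k := k) ha hp
  rw [irr_iff.1 hu] at h3
  rw [h1, rho_single, finsum_nat_eq_add (hE.finite_support t), finsum_eq_zero_of_forall_eq_zero,
    add_zero]
  · rw [rhoSummand_diff, pow_zero, Module.End.one_apply, gamma_single_of_left_eq h3, h2, h4, h5]
    congr 1
    refine tens_congr ?_ rfl (nf_nf v)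
    have := (isPath_nf_nf_iff [] hp)
    rw [irr_iff.1 hu] at this
    simpa using this
  · intro i
    rw [rhoSummand_succ (f := 0) (by simpa using hE.err_gamma_arrow hx h3)]
    simp

/-! ### The formula for the differential -/

theorem delta_single_eq_sandwich {n : ℕ} (t : Gen m (n + 1)) :
    delta k m n (Finsupp.single t 1) = sandwich k m n t (delta k m n (core k m t)) := by
  rw [single_eq_tens, core, delta_tens _ _ _ t.mid_amb, delta_tens _ _ _ t.mid_amb, sandwich_add,
    sandwich_smul, sandwich_tens, sandwich_tens]
  · simp
  · rw [List.nil_append, List.append_nil, List.take_append_drop]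
  · rw [List.nil_append, List.append_nil, List.take_append_drop]

theorem partialZero_tens (a : ℤ) (u v : Word) :
    partialZero k m (tens k m 0 a u [] v) = proj k m a (u ++ v) := by
  by_cases hp : IsPath m a (u ++ [] ++ v)
  · obtain ⟨t, h1, h2, h3, h4, h5⟩ := exists_tens_eq_single (k := k) amb_nil hp
    rw [h1, partialZero, Finsupp.linearCombination_single, one_smul, h2, h3, h5]
    have hp' : IsPath m a (u ++ v) := by simpa using hp
    rw [proj, proj, dif_pos (isPath_nf_append hp'), dif_pos hp']
    congr 1
    exact IrrPath.ext rfl (nf_append_congr (nf_nf u) (nf_nf v))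
  · rw [tens_of_not_isPath hp, map_zero, proj, dif_neg]
    simpa using hp

theorem errTerm_zero (t : Gen m 1) : errTerm k m 0 t.src t.left t.mid t.right = 0 := by
  have := t.mid_amb.1
  rcases hm : t.mid with _ | ⟨x, _ | ⟨y, r⟩⟩
  · rfl
  · rfl
  · rw [hm] at this; simp at this

/-- Both halves of `δ_1(1 ⊗ x ⊗ 1)` multiply to `π(x)`, so `∂_0` kills it and no correction arises.
`errTerm` vanishes here because words in `S_1` have one letter. -/
theorem errFormula_zero : ErrFormula k m 0 := by
  intro t
  rw [errTerm_zero, err, LinearMap.sub_apply, sub_eq_zero, delta_single_eq_sandwich]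
  have : diff k m 0 (Finsupp.single t 1) = sandwich k m 0 t (delta k m 0 (core k m t) -
        rhoNegOne k m (partialZero k m (delta k m 0 (core k m t)))) := by
    simp [diff, resolution, Finsupp.linearCombination_single]
  rw [this]
  congr 1
  rw [eq_comm, sub_eq_self, core, delta_tens _ _ _ t.mid_amb]
  have h1 : t.mid.drop 1 = [] := List.drop_eq_nil_of_le t.mid_amb.1.le
  have h2 : t.mid.take 1 = t.mid := List.take_of_length_le t.mid_amb.1.le
  rw [h1, h2, List.take_zero, map_add, map_smul, partialZero_tens, partialZero_tens]
  simp

theorem err_succ_single {n : ℕ} (t : Gen m (n + 2)) :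
    err k m (n + 1) (Finsupp.single t 1) = sandwich k m (n + 1) t
      (rho k m n (diff k m n (delta k m (n + 1) (core k m t)))) := by
  have : diff k m (n + 1) (Finsupp.single t 1) = sandwich k m (n + 1) t
      (delta k m (n + 1) (core k m t) -
        rho k m n (diff k m n (delta k m (n + 1) (core k m t)))) := by
    rw [diff, resolution, Finsupp.linearCombination_single, one_smul]
    rfl
  rw [err, LinearMap.sub_apply, delta_single_eq_sandwich, this, sandwich_sub]
  abel

theorem ErrFormula.err_nil_mem {n : ℕ} (hE : ErrFormula k m n) (a : ℤ) (w v : Word) :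
    err k m n (tens k m (n + 1) a [] w v) ∈ tightSpan k m n := by
  by_cases ha : Amb (n + 1) w
  swap
  · rw [tens_of_not_amb ha, map_zero]; exact zero_mem _
  by_cases hp : IsPath m a ([] ++ w ++ v)
  swap
  · rw [tens_of_not_isPath hp, map_zero]; exact zero_mem _
  rw [hE.err_tens ha hp, irr_iff.1 irr_nil]
  rcases w with _ | ⟨x, _ | ⟨y, r⟩⟩
  · exact zero_mem _
  · exact zero_mem _
  · rw [errTerm]
    apply Submodule.smul_mem
    split_ifs
    · exact add_mem (tens_s_mem_tightSpan _ _ _ _) (tens_nil_mem_tightSpan _ _ _)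
    · exact tens_s_mem_tightSpan _ _ _ _

theorem ErrFormula.err_ne_s_mem {n : ℕ} (hE : ErrFormula k m n) (a : ℤ) (u w v : Word) {y : Arrow}
    (hy : y ≠ s) : err k m n (tens k m (n + 1) a u (y :: w) v) ∈ tightSpan k m n := by
  by_cases ha : Amb (n + 1) (y :: w)
  swap
  · rw [tens_of_not_amb ha, map_zero]; exact zero_mem _
  by_cases hp : IsPath m a (u ++ (y :: w) ++ v)
  swap
  · rw [tens_of_not_isPath hp, map_zero]; exact zero_mem _
  rw [hE.err_tens ha hp]
  rcases w with _ | ⟨z, r⟩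
  · exact zero_mem _
  · rw [errTerm, if_neg hy]
    exact Submodule.smul_mem _ _ (tens_s_mem_tightSpan _ _ _ _)

/-- With `∂ = δ - err`, both errors are tight and disappear under `ρ`. In `δ δ` the term with left
factor `1` is tight, the two terms with left factor `x` cancel, and the one with left factor `xy` is
left. -/
theorem rho_diff_delta_core {n : ℕ} (hE : ErrFormula k m n) {a : ℤ} {x y : Arrow} {r : Word}
    (ha : Amb (n + 2) (x :: y :: r)) :
    rho k m n (diff k m n (delta k m (n + 1) (tens k m (n + 2) a [] (x :: y :: r) []))) =
      - rho k m n (tens k m n a [x, y] r []) := by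
  have hd : diff k m n = delta k m n - err k m n := by rw [err]; abel
  have hy : y ≠ s := (inS_iff.1 (amb_cons_cons.1 ha).1).1
  have h1 := rho_apply_tight (hE.err_nil_mem a (x :: (y :: r).take n) ((y :: r).drop n ++ []))
  have h2 := rho_apply_tight (hE.err_ne_s_mem a [x] r [] hy)
  have h3 := rho_apply_tight (tens_nil_mem_tightSpan (k := k) (m := m) (n := n) a
    ((x :: (y :: r).take n).take n) ((x :: (y :: r).take n).drop n ++ ((y :: r).drop n ++ [])))
  have ha1 : Amb (n + 1) (x :: (y :: r).take n) := by
    have := ha.take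
    rwa [List.take_succ_cons] at this
  rw [delta_tens _ _ _ ha, List.take_succ_cons, List.drop_succ_cons]
  simp only [List.take_succ_cons, List.drop_succ_cons, List.take_zero, List.drop_zero,
    List.nil_append]
  rw [hd, map_add, map_smul, LinearMap.sub_apply, LinearMap.sub_apply, delta_tens _ _ _ ha1,
    delta_tens _ _ _ ha.tail]
  simp only [List.take_succ_cons, List.drop_succ_cons, List.take_zero, List.drop_zero,
    List.nil_append, map_add, map_sub, map_smul, h1, h2, h3]
  have h4 : ((-1 : k) ^ (n + 1)) * (-1) ^ (n + 1) = 1 := by rw [← mul_pow]; simp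
  rw [pow_succ (-1 : k) (n + 1)]
  simp only [smul_add, smul_smul, mul_neg, neg_mul, mul_one, neg_smul, h4, one_smul,
    sub_zero, zero_add, List.append_nil, List.singleton_append]
  abel

theorem err_zero : err k m 0 = 0 := by
  ext t : 2
  simp [errFormula_zero (k := k) t, errTerm_zero]

theorem rhoSummand_zero_succ (t : Gen m 0) (i : ℕ) :
    rhoSummand k m 0 (diff k m 0) t (i + 1) = 0 := by
  rw [rhoSummand_diff, err_zero]
  simp [pow_succ]

theorem rho_zero_single (t : Gen m 0) :
    rho k m 0 (Finsupp.single t 1) = gamma k m 0 (Finsupp.single t 1) := by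
  rw [rho_single, finsum_eq_single _ 0]
  · rw [rhoSummand_diff, pow_zero, Module.End.one_apply]
  · intro i hi
    obtain ⟨i, rfl⟩ := Nat.exists_eq_succ_of_ne_zero hi
    exact rhoSummand_zero_succ t i

end

section

variable {k : Type*} [Field k] {m : ℕ}

theorem gamma_zero_tens (a : ℤ) {u : Word} (v : Word) (hu : Irr u) :
    gamma k m 0 (tens k m 0 a u [] v) = - ∑ l ∈ Finset.range (u.length + 1),
      tens k m 1 a (u.take l) ((u.drop l).take 1) ((u.drop l).drop 1 ++ v) := by
  have e : ∀ l, u.take l ++ (u.drop l).take 1 ++ ((u.drop l).drop 1 ++ v) = u ++ v := by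
    intro l
    rw [List.append_assoc, ← List.append_assoc ((u.drop l).take 1), List.take_append_drop,
      ← List.append_assoc, List.take_append_drop]
  by_cases hp : IsPath m a (u ++ [] ++ v)
  · obtain ⟨t, h1, h2, h3, h4, h5⟩ := exists_tens_eq_single (k := k) amb_nil hp
    rw [h1, gamma_zero_single, split, map_sum, h3, h5, h2, irr_iff.1 hu]
    congr 1
    refine Finset.sum_congr rfl fun l _ => ?_
    rw [ract_tens, if_pos rfl]
    refine tens_congr ?_ rfl (nf_append_congr rfl (nf_nf v))
    have h6 := isPath_nf_nf_iff [] hp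
    rw [irr_iff.1 hu] at h6
    have e' : u.take l ++ (u.drop l).take 1 ++ ((u.drop l).drop 1 ++ nf v) = u ++ nf v := by
      rw [List.append_assoc, ← List.append_assoc ((u.drop l).take 1), List.take_append_drop,
        ← List.append_assoc, List.take_append_drop]
    rw [e, e']
    simpa using h6
  · rw [tens_of_not_isPath hp, map_zero, Finset.sum_eq_zero, neg_zero]
    intro l _
    apply tens_of_not_isPath
    rw [e]
    simpa using hp

theorem rho_zero_eq_gamma : rho k m 0 = gamma k m 0 := by
  ext t : 2
  simpa using rho_zero_single t

/-- The outer factor `xy` lives in `A`, so it may be replaced by `φ_{xy}`. If this is `s`, dropping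
the dot gives one term; if it is `y s`, the dot gives one term and then the arrow `y` another. -/
theorem neg_rho_tens_pair {n : ℕ} (hE : ErrFormula k m n) {a : ℤ} {x y : Arrow} {r : Word}
    (ha : Amb (n + 2) (x :: y :: r)) (hp : IsPath m a (x :: y :: r)) :
    - rho k m n (tens k m n a [x, y] r []) = errTerm k m (n + 1) a [] (x :: y :: r) [] := by
  obtain ⟨hxy, ha'⟩ := amb_cons_cons.1 ha
  obtain ⟨hy, hx⟩ := inS_iff.1 hxy
  obtain ⟨f, hf⟩ := hxy
  have hred : Reduces (x :: y :: r) (f ++ r) := ReflTransGen.single (by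
    simpa using Step.mk [] _ _ r hf)
  have hpf := reduces_isPath hred hp
  have hnf : nf [x, y] = nf f := by
    have : Step [x, y] f := by simpa using Step.mk [] _ _ [] hf
    exact (step_nf this).symm
  have ht : tens k m n a [x, y] r [] = tens k m n a f r [] :=
    tens_congr (by simpa using ⟨fun _ => hpf, fun _ => hp⟩) hnf rfl
  rw [ht, errTerm]
  rcases n with _ | n
  · obtain rfl : r = [] := List.eq_nil_of_length_eq_zero ha'.tail.1
    have hf' : Irr f := by
      cases hf
      · exact irr_singleton s
      · exact irr_singleton s
      · exact irr_replicate_append (c := p) (by simp) 1 1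
      · exact irr_replicate_append (c := q) (by simp) 1 1
    rw [rho_zero_eq_gamma, gamma_zero_tens _ _ hf', neg_neg]
    have h0 : ∀ u v : Word, tens k m 1 a u [] v = 0 := fun u v =>
      tens_of_not_amb (by simp [Amb])
    cases hf <;> simp [Finset.sum_range_succ, h0, add_comm]
  · obtain ⟨c, r, rfl⟩ : ∃ c r', r = c :: r' := by
      rcases r with _ | ⟨c, r'⟩
      · have := ha'.tail.1; simp at this
      · exact ⟨c, r', rfl⟩
    have hc : c ≠ s := (inS_iff.1 (amb_cons_cons.1 ha').1).1
    have hsign : ((-1 : k)) ^ (n + 1 + 1 + 1) = - (-1) ^ (n + 2) := by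
      rw [pow_succ]; ring
    by_cases hxs : x = s
    · subst hxs
      have hf' : f = [y] ++ [s] := by cases hf <;> rfl
      rw [hf', hE.rho_dot hc, ← List.nil_append [y], hE.rho_arrow hy (irr_singleton y), if_pos rfl,
        hsign]
      simp [add_comm]
    · have hf' : f = [] ++ [s] := by
        obtain rfl := hx.resolve_left hxs
        exact hf.eq_of_opp
      rw [hf', hE.rho_dot hc, rho_apply_tight (tens_nil_mem_tightSpan _ _ _), if_neg hxs, hsign]
      simp

theorem sandwich_errTerm {n : ℕ} (t : Gen m (n + 2)) :
    sandwich k m (n + 1) t (errTerm k m (n + 1) (t.src + shift t.right) [] t.mid []) =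
      errTerm k m (n + 1) t.src t.left t.mid t.right := by
  have ha := t.mid_amb
  rcases hm : t.mid with _ | ⟨x, _ | ⟨y, r⟩⟩
  · simp [errTerm, sandwich]
  · simp [errTerm, sandwich]
  · rw [hm] at ha
    obtain ⟨hy, hx⟩ := inS_iff.1 (amb_cons_cons.1 ha).1
    rw [errTerm, errTerm, sandwich_smul]
    congr 1
    split_ifs with hxs
    · subst hxs
      rw [sandwich_add, sandwich_tens, sandwich_tens]
      · simp
      · rw [hm]
        simp only [shift_append, shift_cons s (_ :: _), shift_s, shift_cons y r, shift_nil]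
        ring
      · rw [hm]
        simp only [shift_append, shift_cons s (_ :: _), shift_cons s r, shift_s, shift_cons y r,
          shift_nil]
        ring
    · obtain rfl := hx.resolve_left hxs
      rw [sandwich_tens]
      · simp
      · rw [hm]
        simp only [shift_append, shift_cons s r, shift_s, shift_cons y r,
          shift_cons (opp y) (_ :: _), shift_opp, shift_nil]
        ring

/-- The error in degree `n + 1` is the correction `ρ_n ∂_{n+1} δ_{n+2}`, and the formula in degree
`n` suffices to evaluate that `ρ_n`. -/
theorem errFormula (n : ℕ) : ErrFormula k m n := by
  induction n with
  | zero => exact errFormula_zero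
  | succ n ih =>
    intro t
    rw [err_succ_single, ← sandwich_errTerm]
    congr 1
    have ha := t.mid_amb
    have hp : IsPath m (t.src + shift t.right) t.mid := by
      have := t.isPath
      rw [List.append_assoc, isPath_append, isPath_append] at this
      exact this.1.2
    rw [core]
    rcases hm : t.mid with _ | ⟨x, _ | ⟨y, r⟩⟩
    · rw [hm] at ha; simp [Amb] at ha
    · rw [hm] at ha; simp [Amb] at ha
    · rw [hm] at ha hp
      rw [rho_diff_delta_core ih ha, neg_rho_tens_pair ih ha hp]

/-- The sum defining `ρ_n` is finite on basis elements. -/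
theorem finite_support_rhoSummand (n : ℕ) (t : Gen m n) :
    (Function.support (rhoSummand k m n (diff k m n) t)).Finite := by
  rcases n with _ | n
  · refine (Set.finite_singleton 0).subset fun i hi => ?_
    by_contra h
    apply hi
    obtain ⟨i, rfl⟩ := Nat.exists_eq_succ_of_ne_zero h
    exact rhoSummand_zero_succ t i
  · exact (errFormula (n + 1)).finite_support t

/-! ### Right linearity -/

theorem rho_dot {n : ℕ} (a : ℤ) (u r v : Word) {c : Arrow} (hc : c ≠ s) :
    rho k m (n + 1) (tens k m (n + 1) a (u ++ [s]) (c :: r) v) =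
      (-1 : k) ^ (n + 2) • tens k m (n + 2) a u (s :: c :: r) v +
        rho k m (n + 1) (tens k m (n + 1) a u (c :: r) (s :: v)) :=
  (errFormula (n + 1)).rho_dot hc

theorem rho_arrow {n : ℕ} (a : ℤ) {u : Word} (r v : Word) {x : Arrow} (hx : x ≠ s)
    (hu : Irr (u ++ [x])) :
    rho k m (n + 1) (tens k m (n + 1) a (u ++ [x]) r v) =
      (-1 : k) ^ (n + 2) • tens k m (n + 2) a u (x :: r) v :=
  (errFormula (n + 1)).rho_arrow hx hu

theorem linearMap_ext_tens {n : ℕ} {M : Type*} [AddCommGroup M] [Module k M]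
    {F F' : P k m n →ₗ[k] M} (h : ∀ t : Gen m n, F (tens k m n t.src t.left t.mid t.right) =
      F' (tens k m n t.src t.left t.mid t.right)) : F = F' := by
  ext t : 2
  have := h t
  rw [← single_eq_tens] at this
  simpa using this

theorem rho_ract (n : ℕ) (b : ℤ) (y : Word) (f : P k m n) :
    rho k m n (ract k m n b y f) = ract k m (n + 1) b y (rho k m n f) := by
  suffices H : rho k m n ∘ₗ ract k m n b y = ract k m (n + 1) b y ∘ₗ rho k m n from
    LinearMap.congr_fun H f
  refine linearMap_ext_tens fun t => ?_
  simp only [LinearMap.comp_apply]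
  rcases n with _ | n
  · have hm : t.mid = [] := List.eq_nil_of_length_eq_zero t.mid_amb.1
    rw [hm, ract_tens, rho_zero_eq_gamma, gamma_zero_tens _ _ t.left_irr, map_neg, map_sum]
    simp only [ract_tens]
    split_ifs
    · rw [gamma_zero_tens _ _ t.left_irr]; simp
    · simp
  · obtain ⟨c, r, hm⟩ := t.mid_eq_cons
    by_cases hc : c = s
    · subst hc
      rw [hm, rho_apply_tight (ract_mem_tightSpan _ _ (tens_s_mem_tightSpan _ _ _ _)),
        rho_apply_tight (tens_s_mem_tightSpan _ _ _ _), map_zero]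
    obtain ⟨x, A, M, hx, hl⟩ := t.left_irr.exists_form
    rw [hm, hl]
    -- Dropping a dot changes the right factor, so it has to vary in the induction on the number `M`
    -- of dots.
    generalize t.right = v
    clear hl
    induction M generalizing v with
    | zero =>
      rw [List.replicate_zero, List.append_nil]
      rcases A with _ | A
      · rw [List.replicate_zero,
          rho_apply_tight (ract_mem_tightSpan _ _ (tens_nil_mem_tightSpan _ _ _)),
          rho_apply_tight (tens_nil_mem_tightSpan _ _ _), map_zero]
      · have hi : Irr (List.replicate A x ++ [x]) := by
          rw [← List.replicate_succ']
          simpa using irr_replicate_append hx (A + 1) 0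
        rw [List.replicate_succ', rho_arrow _ _ _ hx hi, map_smul, ract_tens, ract_tens]
        split_ifs
        · rw [rho_arrow _ _ _ hx hi]
        · simp
    | succ M ih =>
      rw [List.replicate_succ', ← List.append_assoc, rho_dot _ _ _ _ hc, map_add, map_smul, ← ih,
        ract_tens, ract_tens, ract_tens]
      split_ifs
      · rw [rho_dot _ _ _ _ hc]; rfl
      · simp

theorem lact_ract (n : ℕ) (a b : ℤ) (x y : Word) (f : P k m n) :
    lact k m n b x (ract k m n a y f) = ract k m n a y (lact k m n b x f) := by
  suffices H : lact k m n b x ∘ₗ ract k m n a y = ract k m n a y ∘ₗ lact k m n b x from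
    LinearMap.congr_fun H f
  refine linearMap_ext_tens fun t => ?_
  simp only [LinearMap.comp_apply, ract_tens, lact_tens, apply_ite (lact k m n b x),
    apply_ite (ract k m n a y), map_zero]
  by_cases h1 : a + shift y = t.src
  · simp only [if_pos h1]
    have : a + shift (t.left ++ t.mid ++ (t.right ++ y)) =
        t.src + shift (t.left ++ t.mid ++ t.right) := by
      rw [← h1]; simp only [shift_append]; ring
    rw [this]
  · simp [h1]

end

section

variable {k : Type*} [Field k] {m : ℕ}

/-! ### The terms of `ρ` -/

/-- The basis elements which occur in `ρ_n(u ⊗ c r ⊗ v)`, where `c` is not a loop and `n ≥ 1`. -/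
def slideTerms (m n : ℕ) (a : ℤ) (u : Word) (c : Arrow) (r v : Word) : Set (Gen m n) :=
  {t | t.src = a ∧ nf (t.left ++ t.mid ++ t.right) = nf (u ++ c :: r ++ v) ∧
    ((t.mid = s :: c :: r ∧ ∃ d, nf u = t.left ++ List.replicate (d + 1) s) ∨
      (t.mid = opp c :: c :: r ∧ ∃ d, nf u = t.left ++ opp c :: List.replicate d s))}

theorem finite_slideTerms (n : ℕ) (a : ℤ) (u : Word) (c : Arrow) (r v : Word) :
    (slideTerms m n a u c r v).Finite :=
  (finite_setOf_gen n a _).subset fun _ h => ⟨h.1, h.2.1⟩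

theorem slideTerms_congr {n : ℕ} {a : ℤ} {u u' : Word} {c : Arrow} {r v : Word}
    (h : nf u = nf u') : slideTerms m n a u c r v = slideTerms m n a u' c r v := by
  have : nf (u ++ c :: r ++ v) = nf (u' ++ c :: r ++ v) :=
    nf_append_congr (nf_append_congr h rfl) rfl
  simp only [slideTerms, h, this]

theorem eq_zero_of_replicate_eq_append_dots {c : Arrow} {u w : Word} {A : ℕ} {d : ℕ} (hc : c ≠ s)
    (h : List.replicate A c = u ++ w ++ List.replicate d s) : d = 0 := by
  rcases d with _ | d
  · rfl
  · have : s ∈ List.replicate A c := by rw [h]; simp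
    exact absurd (List.eq_of_mem_replicate this).symm hc

theorem neg_one_pow_smul_self {M : Type*} [AddCommGroup M] [Module k M] (n : ℕ) (x : M) :
    (-1 : k) ^ n • (-1 : k) ^ n • x = x := by
  rw [smul_smul, ← mul_pow]; simp

/-- Write `u = x^A s^M`. Each of the `M` dots gives one term when it is dropped; afterwards the last
`x` gives one more term if `x = opp c` and none otherwise. -/
theorem smul_rho_eq_finsum_of_irr {n : ℕ} {a : ℤ} {u : Word} {c : Arrow} {r v : Word} (hc : c ≠ s)
    (ha : Amb (n + 1) (c :: r)) (hu : Irr u) (hp : IsPath m a (u ++ c :: r ++ v)) :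
    (-1 : k) ^ (n + 2) • rho k m (n + 1) (tens k m (n + 1) a u (c :: r) v) =
      ∑ᶠ t ∈ slideTerms m (n + 2) a u c r v, Finsupp.single t 1 := by
  obtain ⟨x, A, M, hx, rfl⟩ := hu.exists_form
  induction M generalizing v with
  | zero =>
    rw [List.replicate_zero, List.append_nil] at hp ⊢
    have hr : ∀ B, nf (List.replicate B x) = List.replicate B x := fun B => by
      simpa using irr_iff.1 (irr_replicate_append hx B 0)
    have hempty : (∀ B, List.replicate A x ≠ B ++ [opp c]) →
        slideTerms m (n + 2) a (List.replicate A x) c r v = ∅ := by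
      intro hB
      ext t
      simp only [slideTerms, Set.mem_ofPred_eq, Set.mem_empty_iff_false, iff_false, hr]
      rintro ⟨-, -, ⟨-, d, h⟩ | ⟨-, d, h⟩⟩
      · have := eq_zero_of_replicate_eq_append_dots (w := []) hx (by simpa using h)
        omega
      · obtain rfl := eq_zero_of_replicate_eq_append_dots (d := d) (u := t.left) (w := [opp c]) hx
          (by simpa using h)
        exact hB _ (by simpa using h)
    rcases A with _ | A
    · rw [hempty (by simp), List.replicate_zero, rho_apply_tight (tens_nil_mem_tightSpan _ _ _)]
      simp
    · have hi : Irr (List.replicate A x ++ [x]) := by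
        rw [← List.replicate_succ']
        simpa using irr_replicate_append hx (A + 1) 0
      by_cases hxc : x = opp c
      · subst hxc
        have hp' : IsPath m a (List.replicate A (opp c) ++ (opp c :: c :: r) ++ v) := by
          simpa [List.replicate_succ'] using hp
        obtain ⟨t, h1, h2, h3, h4, h5⟩ := exists_tens_eq_single (k := k)
          (amb_cons_cons.2 ⟨inS_opp hc, ha⟩) hp'
        rw [hr] at h3
        have hs : slideTerms m (n + 2) a (List.replicate (A + 1) (opp c)) c r v = {t} := by
          ext t'
          simp only [slideTerms, Set.mem_ofPred_eq, Set.mem_singleton_iff, hr]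
          constructor
          · rintro ⟨e1, e2, ⟨-, d, h⟩ | ⟨e3, d, h⟩⟩
            · have := eq_zero_of_replicate_eq_append_dots (w := []) hx (by simpa using h)
              omega
            · obtain rfl := eq_zero_of_replicate_eq_append_dots (d := d) (u := t'.left) (w := [opp c]) hx
                (by simpa using h)
              rw [List.replicate_succ', List.replicate_zero] at h
              have e4 : t'.left = List.replicate A (opp c) := (List.append_cancel_right h).symm
              refine Gen.ext_of_nf (e1.trans h2.symm) (e4.trans h3.symm) (e3.trans h4.symm) ?_
              rw [e2, h3, h4, h5, List.replicate_succ']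
              simpa using nf_append_congr (u := List.replicate A (opp c) ++ opp c :: c :: r) rfl
                (nf_nf v).symm
          · rintro rfl
            refine ⟨h2, ?_, Or.inr ⟨h4, 0, ?_⟩⟩
            · rw [h3, h4, h5, List.replicate_succ']
              simpa using nf_append_congr (u := List.replicate A (opp c) ++ opp c :: c :: r) rfl
                (nf_nf v)
            · rw [h3, List.replicate_succ']; rfl
        rw [hs, finsum_mem_singleton, List.replicate_succ', rho_arrow _ _ _ hx hi,
          neg_one_pow_smul_self, h1]
      · rw [hempty, List.replicate_succ', rho_arrow _ _ _ hx hi, tens_of_not_amb]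
        · simp
        · intro h
          rcases (inS_iff.1 (amb_cons_cons.1 h).1).2 with h | h
          · exact hx h
          · exact hxc h
        · intro B h
          have : opp c ∈ List.replicate (A + 1) x := by rw [h]; simp
          exact hxc (List.eq_of_mem_replicate this).symm
  | succ M ih =>
    have hi := irr_replicate_append hx A M
    have ih' := ih (v := s :: v)
    have e : List.replicate A x ++ List.replicate (M + 1) s =
        List.replicate A x ++ List.replicate M s ++ [s] := by
      rw [List.replicate_succ', List.append_assoc]
    rw [e] at hp hu ⊢
    generalize List.replicate A x ++ List.replicate M s = w at *
    have hp' : IsPath m a (w ++ s :: c :: r ++ v) := by simpa using hp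
    obtain ⟨t, h1, h2, h3, h4, h5⟩ := exists_tens_eq_single (k := k)
      (amb_cons_cons.2 ⟨inS_s hc, ha⟩) hp'
    rw [irr_iff.1 hi] at h3
    have htot : nf (w ++ c :: r ++ s :: v) = nf (w ++ [s] ++ c :: r ++ v) := by
      rw [nf_eq_nf_iff]
      simp only [shift_append, deg_append, shift_cons s v, deg_cons s v]
      constructor
      · ring
      · ring
    -- The new element `t` is the loop term with `d = 0`. For all other terms one dot has already
    -- passed into the right factor, and `d` shifts by one.
    have hs : slideTerms m (n + 2) a (w ++ [s]) c r v =
        insert t (slideTerms m (n + 2) a w c r (s :: v)) := by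
      ext t'
      simp only [slideTerms, Set.mem_ofPred_eq, Set.mem_insert_iff, irr_iff.1 hi, irr_iff.1 hu,
        htot]
      constructor
      · rintro ⟨e1, e2, ⟨e3, d, h⟩ | ⟨e3, d, h⟩⟩
        · rw [List.replicate_succ', ← List.append_assoc] at h
          have h := List.append_cancel_right h
          rcases d with _ | d
          · left
            rw [List.replicate_zero, List.append_nil] at h
            refine Gen.ext_of_nf (e1.trans h2.symm) (h.symm.trans h3.symm) (e3.trans h4.symm) ?_
            rw [e2, h3, h4, h5]
            simpa using nf_append_congr (u := w ++ s :: c :: r) rfl (nf_nf v).symm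
          · exact Or.inr ⟨e1, e2, Or.inl ⟨e3, d, h⟩⟩
        · rcases d with _ | d
          · have := congrArg List.getLast? h
            simp at this
            exact absurd this.symm (opp_ne_s hc)
          · rw [List.replicate_succ', ← List.cons_append, ← List.append_assoc] at h
            exact Or.inr ⟨e1, e2, Or.inr ⟨e3, d, List.append_cancel_right h⟩⟩
      · rintro (rfl | ⟨e1, e2, ⟨e3, d, h⟩ | ⟨e3, d, h⟩⟩)
        · refine ⟨h2, ?_, Or.inl ⟨h4, 0, by rw [h3]; rfl⟩⟩
          rw [h3, h4, h5]
          simpa using nf_append_congr (u := w ++ s :: c :: r) rfl (nf_nf v)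
        · refine ⟨e1, e2, Or.inl ⟨e3, d + 1, ?_⟩⟩
          rw [List.replicate_succ', ← List.append_assoc, ← h]
        · refine ⟨e1, e2, Or.inr ⟨e3, d + 1, ?_⟩⟩
          rw [List.replicate_succ', ← List.cons_append, ← List.append_assoc, ← h]
    have hnot : t ∉ slideTerms m (n + 2) a w c r (s :: v) := by
      rintro ⟨-, -, ⟨-, d, h⟩ | ⟨e3, -⟩⟩
      · rw [irr_iff.1 hi, h3] at h
        have := congrArg List.length h
        simp at this
      · rw [h4] at e3
        simp only [List.cons.injEq] at e3
        exact opp_ne_s hc e3.1.symm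
    rw [hs, finsum_mem_insert _ hnot (finite_slideTerms _ _ _ _ _ _), rho_dot _ _ _ _ hc, smul_add,
      neg_one_pow_smul_self, h1, ih' hi (by rwa [isPath_slide_iff])]

theorem smul_rho_eq_finsum {n : ℕ} {a : ℤ} {u : Word} {c : Arrow} {r v : Word} (hc : c ≠ s)
    (ha : Amb (n + 1) (c :: r)) (hp : IsPath m a (u ++ c :: r ++ v)) :
    (-1 : k) ^ (n + 2) • rho k m (n + 1) (tens k m (n + 1) a u (c :: r) v) =
      ∑ᶠ t ∈ slideTerms m (n + 2) a u c r v, Finsupp.single t 1 := by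
  have hp' : IsPath m a (nf u ++ c :: r ++ v) := by
    have := reduces_isPath (reduces_context [] (c :: r ++ v) (reduces_nf u)) (by simpa using hp)
    simpa using this
  rw [tens_congr (u' := nf u) (v' := v) ⟨fun _ => hp', fun _ => hp⟩ (nf_nf u).symm rfl,
    smul_rho_eq_finsum_of_irr hc ha (irr_nf u) hp', slideTerms_congr (nf_nf u)]

/-! ### The recursion for the terms of the splittings -/

/-- `slideTerms` for the left multiple `y · t` of a basis element. -/
def nextTerms {n : ℕ} (y : Word) (t : Gen m n) : Set (Gen m (n + 1)) :=
  {t' | ∃ c r, t.mid = c :: r ∧ c ≠ s ∧ t' ∈ slideTerms m (n + 1) t.src (y ++ t.left) c r t.right}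

theorem nextTerms_of_mid_s {n : ℕ} {y r : Word} {t : Gen m n} (h : t.mid = s :: r) :
    nextTerms y t = ∅ := by
  ext t'
  simp only [nextTerms, Set.mem_ofPred_eq, Set.mem_empty_iff_false, iff_false]
  rintro ⟨c, r', h1, h2, -⟩
  rw [h] at h1
  simp at h1
  exact h2 h1.1.symm

theorem nextTerms_of_mid_ne_s {n : ℕ} {y r : Word} {c : Arrow} {t : Gen m n} (h : t.mid = c :: r)
    (hc : c ≠ s) : nextTerms y t = slideTerms m (n + 1) t.src (y ++ t.left) c r t.right := by
  ext t'
  simp only [nextTerms, Set.mem_ofPred_eq]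
  constructor
  · rintro ⟨c', r', h1, -, h2⟩
    rw [h] at h1
    simp only [List.cons.injEq] at h1
    obtain ⟨rfl, rfl⟩ := h1
    exact h2
  · exact fun h2 => ⟨c, r, h, hc, h2⟩

theorem finite_nextTerms {n : ℕ} (y : Word) (t : Gen m (n + 1)) : (nextTerms y t).Finite := by
  obtain ⟨c, r, h⟩ := t.mid_eq_cons
  by_cases hc : c = s
  · subst hc
    rw [nextTerms_of_mid_s h]; exact Set.finite_empty
  · rw [nextTerms_of_mid_ne_s h hc]; exact finite_slideTerms _ _ _ _ _ _

theorem smul_rho_tens_eq_finsum_nextTerms {n : ℕ} {y : Word} {t : Gen m (n + 1)}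
    (hp : IsPath m t.src (y ++ t.left ++ t.mid ++ t.right)) :
    (-1 : k) ^ (n + 2) • rho k m (n + 1) (tens k m (n + 1) t.src (y ++ t.left) t.mid t.right) =
      ∑ᶠ t' ∈ nextTerms y t, Finsupp.single t' 1 := by
  obtain ⟨c, r, h⟩ := t.mid_eq_cons
  have ha := t.mid_amb
  by_cases hc : c = s
  · subst hc
    rw [nextTerms_of_mid_s h, h, rho_apply_tight (tens_s_mem_tightSpan _ _ _ _)]
    simp
  · rw [nextTerms_of_mid_ne_s h hc]
    rw [h] at hp ha ⊢
    exact smul_rho_eq_finsum hc ha hp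

theorem Irr.exists_left_form {y z : Word} {c : Arrow} (hc : c ≠ s) (h : Irr (y ++ c :: z)) :
    ∃ l b d, y = List.replicate l c ∧ z = List.replicate b c ++ List.replicate d s := by
  refine ⟨y.length, ?_⟩
  obtain ⟨x, b, d, hx, hz⟩ := (h.of_infix (u := c :: z) ⟨y, [], by simp⟩).exists_form
  rcases b with _ | b
  · have : c ∈ List.replicate d s := by
      have : c ∈ c :: z := by simp
      rw [hz] at this; simpa using this
    exact absurd (List.eq_of_mem_replicate this) hc
  · rw [List.replicate_succ, List.cons_append, List.cons.injEq] at hz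
    obtain ⟨rfl, hz⟩ := hz
    exact ⟨b, d, h.left_eq_replicate hc, hz⟩

/-- A crossing of the strand by `y`, seen in the normal form of `y y'`, where `y'` starts at the
strand. -/
theorem exists_nf_eq_of_crosses {j i : ℤ} {A z y' y'' w : Word} {c : Arrow}
    (hA : Irr (A ++ opp c :: z)) (hy : Irr (y' ++ c :: y''))
    (hc : Crosses j (i + shift (y'' ++ w)) [c])
    (hz : Crosses j (i + shift (z ++ (y' ++ c :: y'' ++ w))) [opp c]) :
    ∃ d, nf (A ++ opp c :: z ++ y') = A ++ opp c :: List.replicate d s := by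
  have hcs := hc.ne_s
  obtain ⟨-, h0⟩ := crosses_opp_of_allCross hy hA hc hz
  obtain ⟨M, hM⟩ := reduces_dots_of_shift_eq_zero h0
  refine ⟨M, ?_⟩
  have h1 : Irr (A ++ opp c :: List.replicate M s) := by
    obtain ⟨l, -, -, rfl, -⟩ := hA.exists_left_form (opp_ne_s hcs)
    have := irr_replicate_append (opp_ne_s hcs) (l + 1) M
    rwa [List.replicate_succ', List.append_assoc] at this
  rw [← irr_iff.1 h1]
  have := nf_append_congr (u := A ++ [opp c]) (u' := A ++ [opp c]) rfl hM.nf_eq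
  simpa using this.symm

theorem exists_crosses_of_nf_eq {j i : ℤ} {y A y' y'' w : Word} {c : Arrow} {d : ℕ}
    (hyi : Irr y) (hy : Irr (y' ++ c :: y''))
    (hc : Crosses j (i + shift (y'' ++ w)) [c])
    (h : nf (y ++ y') = A ++ opp c :: List.replicate d s) :
    ∃ z, y = A ++ opp c :: z ∧ Crosses j (i + shift (z ++ (y' ++ c :: y'' ++ w))) [opp c] := by
  have hcs := hc.ne_s
  have hn : Irr (A ++ opp c :: List.replicate d s) := h ▸ irr_nf _
  obtain ⟨l, -, -, rfl, -⟩ := hn.exists_left_form (opp_ne_s hcs)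
  obtain ⟨l', -, -, rfl, -⟩ := hy.exists_left_form hcs
  obtain ⟨x, b, e, hx, rfl⟩ := hyi.exists_form
  have hsh := shift_nf (List.replicate b x ++ List.replicate e s ++ List.replicate l' c)
  rw [h] at hsh
  simp only [shift_append, shift_cons (opp c) (List.replicate _ _), shift_replicate,
    shift_s, shift_opp, mul_zero, add_zero] at hsh
  -- The displacement of the normal form forces `y` to make `l + 1 + l'` moves in direction `opp c`:
  -- those above the strand, the crossing itself, and `l'` moves undoing `y'`.
  have hxb : List.replicate b x = List.replicate (l + 1 + l') (opp c) := by
    cases c <;> cases x <;> simp [opp] at hsh hcs hx ⊢ <;> omega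
  refine ⟨List.replicate l' (opp c) ++ List.replicate e s, ?_, ?_⟩
  · rw [hxb, ← List.replicate_append_replicate, List.replicate_succ']
    simp
  · rw [crosses_singleton] at hc ⊢
    simp only [shift_append, shift_cons c y'', shift_replicate, shift_s, shift_opp, mul_zero] at hc ⊢
    rcases hc with ⟨rfl, hc⟩ | ⟨rfl, hc⟩ <;> simp [opp] at hc ⊢ <;> omega

/-- Only terms `t` whose ambiguity starts with an arrow can be extended. Such a `t` has the part of
`y_1`-level factor above its crossing as left factor, so `π(y · t.left)` is exactly the straightened
top `π(y_n y')` in `strandTerms`. -/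
theorem splitTerms_cons_eq_biUnion {n : ℕ} {i : ℤ} {y : Word} {ys : List Word}
    (hn : ys.length = n + 1) (hys : ∀ x ∈ y :: ys, Irr x) (hp : IsPath m i (y :: ys).flatten) :
    splitTerms k m (n + 2) i (y :: ys).flatten =
      ⋃ t ∈ splitTerms k m (n + 1) i ys.flatten, nextTerms y t := by
  rcases ys with _ | ⟨y₁, rest⟩
  · simp at hn
  simp only [List.length_cons, Nat.add_right_cancel_iff] at hn
  have hy : Irr y := hys y (by simp)
  have hys' : ∀ x ∈ y₁ :: rest, Irr x := fun x hx => hys x (List.mem_cons_of_mem _ hx)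
  have hp₁ : IsPath m i (y₁ :: rest).flatten :=
    ((isPath_append _ _ _ _).1 (by simpa using hp : IsPath m i (y ++ (y₁ :: rest).flatten))).1
  rw [splitTerms_eq_strandTerms (by simp [hn]) hys hp]
  ext t'
  simp only [Set.mem_iUnion, exists_prop]
  constructor
  · rintro ⟨h1, h2, j, -, -, h3, y', c, y'', rest', he, h4, h5⟩
    simp only [List.cons.injEq] at he
    obtain ⟨rfl, rfl⟩ := he
    have hcs := h4.ne_s
    obtain ⟨v, hv⟩ := (allCross_cons.1 h3).2.reduces
      (fun x hx => hys' x (List.mem_cons_of_mem _ hx)) (hys' _ (List.mem_cons_self ..)) h4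
    rw [hn] at hv
    have hpv := reduces_isPath hv (by simpa using hp₁)
    obtain ⟨t, -, e1, e2, e3, e4⟩ := exists_tens_eq_single (k := k) (amb_zigzag hcs (n + 1)) hpv
    have hy' : Irr y' := (hys' _ (List.mem_cons_self ..)).of_infix ⟨[], c :: y'', by simp⟩
    rw [irr_iff.1 hy'] at e2
    have htot : nf (t.left ++ t.mid ++ t.right) = nf (y' ++ c :: y'' ++ rest.flatten) := by
      rw [e2, e3, e4, ← hv.nf_eq]
      exact nf_append_congr rfl (nf_nf v)
    refine ⟨t, ?_, ?_⟩
    · exact (mem_splitTerms_zigzag hn hys' hp₁ hcs e3).2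
        ⟨e1, by simpa using htot, j, h3, y'', by rw [e2], h4⟩
    · rw [nextTerms_of_mid_ne_s (by rw [e3, zigzag]) hcs]
      refine ⟨h1.trans e1.symm, ?_, ?_⟩
      · have h6 := nf_append_congr (u := y) rfl htot.symm
        rw [h2]
        rw [e3, zigzag] at h6
        simpa using h6
      · rw [e2]
        rcases h5 with ⟨h5, h6⟩ | ⟨h5, z, rfl, h7⟩
        · exact Or.inl ⟨by simpa [zigzag] using h5, h6⟩
        · refine Or.inr ⟨by simpa [zigzag] using h5, ?_⟩
          exact exists_nf_eq_of_crosses hy (hys' _ (List.mem_cons_self ..)) h4 (by simpa using h7)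
  · rintro ⟨t, ht, c, r, hm, hcs, h1, h2, h3⟩
    have hz : c :: r = zigzag c (n + 1) := (amb_cons_iff_zigzag hcs).1 (hm ▸ t.mid_amb)
    obtain ⟨e1, e2, j, hall, y'', rfl, h4⟩ :=
      (mem_splitTerms_zigzag hn hys' hp₁ hcs (hm.trans hz)).1 ht
    have hb := h4.strand_bounds (m := m) (u := t.left) (by simpa using hp₁)
    refine ⟨h1.trans e1, ?_, j, hb.1, hb.2, hall, t.left, c, y'', rest, rfl, h4, ?_⟩
    · rw [h2, ← hm]
      have h6 := nf_append_congr (u := y) rfl e2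
      simpa using h6
    · rcases h3 with ⟨h5, h6⟩ | ⟨h5, d, h6⟩
      · exact Or.inl ⟨by rw [h5, hz]; rfl, h6⟩
      · obtain ⟨z, h7, h8⟩ := exists_crosses_of_nf_eq hy (hys' _ (List.mem_cons_self ..)) h4 h6
        refine Or.inr ⟨?_, z, h7, by simpa using h8⟩
        rw [h5, hz, zigzag, zigzag, zigzag, opp_opp]

/-- A term `t'` remembers its origin: removing the first letter of its ambiguity gives `t.mid`. Its
left factor gives the displacement of `t.left`, which is a power of the crossing arrow and hence
determined by it. -/
theorem pairwiseDisjoint_nextTerms {n : ℕ} {i : ℤ} {y : Word} {ys : List Word}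
    (hn : ys.length = n + 1) (hys : ∀ x ∈ ys, Irr x) (hp : IsPath m i ys.flatten) :
    (splitTerms k m (n + 1) i ys.flatten).PairwiseDisjoint (nextTerms y) := by
  rcases ys with _ | ⟨y₁, rest⟩
  · simp at hn
  simp only [List.length_cons, Nat.add_right_cancel_iff] at hn
  intro t₁ ht₁ t₂ ht₂ hne
  refine Set.disjoint_left.2 ?_
  rintro t' ⟨c₁, r₁, hm₁, hc₁, -, -, h₁⟩ ⟨c₂, r₂, hm₂, hc₂, -, -, h₂⟩
  apply hne
  have hm : t₁.mid = t₂.mid := by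
    rw [hm₁, hm₂]
    rcases h₁ with ⟨h₁, -⟩ | ⟨h₁, -⟩ <;> rcases h₂ with ⟨h₂, -⟩ | ⟨h₂, -⟩ <;>
      · rw [h₁] at h₂; exact (List.cons.inj h₂).2
  have hc : c₁ = c₂ := by
    rw [hm₁, hm₂] at hm; exact (List.cons.inj hm).1
  subst hc
  have hsh : shift (y ++ t₁.left) = shift (y ++ t₂.left) := by
    rw [← shift_nf, ← shift_nf (y ++ t₂.left)]
    rcases h₁ with ⟨h₁, d₁, h₁'⟩ | ⟨h₁, d₁, h₁'⟩ <;>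
      rcases h₂ with ⟨h₂, d₂, h₂'⟩ | ⟨h₂, d₂, h₂'⟩
    · rw [h₁', h₂']
      simp [shift_append, shift_replicate]
    · rw [h₁] at h₂; exact absurd (List.cons.inj h₂).1.symm (opp_ne_s hc₁)
    · rw [h₁] at h₂; exact absurd (List.cons.inj h₂).1 (opp_ne_s hc₁)
    · rw [h₁', h₂']
      simp only [shift_append, shift_cons _ (List.replicate _ _), shift_replicate, shift_s,
        mul_zero]
  rw [shift_append, shift_append, add_right_inj] at hsh
  have hz : c₁ :: r₁ = zigzag c₁ (n + 1) := (amb_cons_iff_zigzag hc₁).1 (hm₁ ▸ t₁.mid_amb)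
  obtain ⟨e₁, n₁, -, -, z₁, f₁, -⟩ :=
    (mem_splitTerms_zigzag hn hys hp hc₁ (hm₁.trans hz)).1 ht₁
  obtain ⟨e₂, n₂, -, -, z₂, f₂, -⟩ :=
    (mem_splitTerms_zigzag hn hys hp hc₁ (hm.symm.trans (hm₁.trans hz))).1 ht₂
  refine Gen.ext_of_nf (e₁.trans e₂.symm) ?_ hm (n₁.trans n₂.symm)
  have hy₁ : Irr y₁ := hys y₁ (by simp)
  obtain ⟨l₁, -, -, g₁, -⟩ := Irr.exists_left_form hc₁ (f₁ ▸ hy₁)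
  obtain ⟨l₂, -, -, g₂, -⟩ := Irr.exists_left_form hc₁ (f₂ ▸ hy₁)
  rw [g₁, g₂, shift_replicate, shift_replicate] at hsh
  rw [g₁, g₂]
  have : (l₁ : ℤ) = l₂ := by
    rcases shift_ne_zero hc₁ with h | h <;> rw [h] at hsh <;> omega
  rw [Nat.cast_injective this]

end

section

variable {k : Type*} [Field k] {m : ℕ}

/-! ### The comparison map -/

variable (k m) in
/-- The sum of the terms of all splittings of paths to which `y_n ⋯ y_1` reduces. -/
noncomputable def splitSum (n : ℕ) (i : ℤ) (ys : List Word) : P k m n :=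
  ∑ᶠ t ∈ splitTerms k m n i ys.flatten, Finsupp.single t (1 : k)

theorem map_splitSum {M : Type*} [AddCommGroup M] [Module k M] {n : ℕ} {i : ℤ} {ys : List Word}
    (F : P k m n →ₗ[k] M) : F (splitSum k m n i ys) =
      ∑ᶠ t ∈ splitTerms k m n i ys.flatten, F (Finsupp.single t 1) := by
  rw [splitSum]
  exact AddMonoidHom.map_finsum_mem _ F.toAddMonoidHom (finite_splitTerms n i _)

theorem tgt_of_mem_splitTerms {n : ℕ} {i : ℤ} {w : Word} {t : Gen m n}
    (h : t ∈ splitTerms k m n i w) : t.src = i ∧ t.src + shift (t.left ++ t.mid ++ t.right) =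
      i + shift w := by
  have h1 := (mem_splitTerms.1 h).1
  have h2 := nf_total_of_mem_splitTerms h
  exact ⟨h1, by rw [h1, (nf_eq_nf_iff.1 h2).1]⟩

theorem ract_lact_splitSum_eq_zero {n : ℕ} {i a b : ℤ} {x z : Word} {ys : List Word}
    (h : ¬ (b = i + shift ys.flatten ∧ a + shift z = i)) :
    ract k m n a z (lact k m n b x (splitSum k m n i ys)) = 0 := by
  rw [← LinearMap.comp_apply, map_splitSum]
  refine finsum_mem_eq_zero_of_forall_eq_zero fun t ht => ?_
  obtain ⟨h1, h2⟩ := tgt_of_mem_splitTerms ht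
  rw [LinearMap.comp_apply, single_eq_tens, lact_tens, h2, h1]
  split_ifs with h3
  · rw [ract_tens, if_neg fun h4 => h ⟨h3, h4⟩]
  · simp

theorem splitSum_eq_split {i : ℤ} {w : Word} (n : ℕ) (hw : Irr w) :
    splitSum k m n i [w] = split k m n i w := by
  classical
  have h1 : splitTerms k m n i [w].flatten = ↑(split k m n i w).support := by
    ext t
    simp only [splitTerms, List.flatten_cons, List.flatten_nil, List.append_nil,
      Set.mem_ofPred_eq, SetLike.mem_coe]
    constructor
    · rintro ⟨w', h, h'⟩
      rwa [h.eq_of_irr hw] at h'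
    · exact fun h => ⟨w, ReflTransGen.refl, h⟩
  rw [splitSum, h1, finsum_mem_coe_finset]
  conv_rhs => rw [← Finsupp.sum_single (split k m n i w)]
  refine Finset.sum_congr rfl fun t ht => ?_
  rw [Finsupp.mem_support_iff, split_apply] at ht
  rw [split_apply]
  split_ifs at ht ⊢
  · rfl
  · exact absurd rfl ht

theorem split_zero_nil {i : ℤ} : split k m 0 i [] = tens k m 0 i [] [] [] := by
  simp [split]

theorem splitSum_nil (i : ℤ) : splitSum k m 0 i [] = tens k m 0 i [] [] [] := by
  rw [← split_zero_nil, ← splitSum_eq_split 0 irr_nil]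
  rfl

/-- This is the recursion that `G` satisfies. In degree `1` it holds because `ρ_0 = γ_0` is minus
the splitting; in higher degrees it combines the disjoint union of terms with the evaluation of `ρ`.
-/
theorem splitSum_cons {n : ℕ} {i : ℤ} {y : Word} {ys : List Word} (hn : ys.length = n)
    (hys : ∀ x ∈ y :: ys, Irr x) (hp : IsPath m i (y :: ys).flatten) :
    splitSum k m (n + 1) i (y :: ys) = (-1 : k) ^ (n + 1) •
      rho k m n (lact k m n (i + shift ys.flatten) y (splitSum k m n i ys)) := by
  rcases n with _ | n
  · obtain rfl := List.eq_nil_of_length_eq_zero hn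
    have hy := hys y (by simp)
    rw [splitSum_eq_split _ hy, splitSum_nil, lact_tens, if_pos (by simp), List.append_nil,
      rho_zero_eq_gamma, gamma_zero_tens _ _ hy]
    simp [split]
  · have hys' : ∀ x ∈ ys, Irr x := fun x hx => hys x (List.mem_cons_of_mem _ hx)
    have hp' := (isPath_append _ _ _ _).1 (by simpa using hp : IsPath m i (y ++ ys.flatten))
    rw [splitSum, splitTerms_cons_eq_biUnion hn hys hp, finsum_mem_biUnion
      (pairwiseDisjoint_nextTerms hn hys' hp'.1) (finite_splitTerms _ _ _)
      (fun t _ => finite_nextTerms y t), ← LinearMap.comp_apply, ← LinearMap.smul_apply,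
      map_splitSum]
    refine finsum_mem_congr rfl fun t ht => ?_
    obtain ⟨h1, h2⟩ := tgt_of_mem_splitTerms ht
    rw [LinearMap.smul_apply, LinearMap.comp_apply, single_eq_tens, lact_tens, if_pos h2.symm,
      smul_rho_tens_eq_finsum_nextTerms]
    have : IsPath m t.src (y ++ (t.left ++ t.mid ++ t.right)) := by
      rw [isPath_append]
      exact ⟨t.isPath, by rw [h2]; exact hp'.2⟩
    simpa using this

theorem barTens_of_not {n : ℕ} {a : ℤ} {x z : Word} {ys : List Word} (h : ¬ (ys.length = n ∧
    (∀ y ∈ ys, nf y ≠ []) ∧ IsPath m a (x ++ ys.flatten ++ z))) :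
    barTens k m n a x ys z = 0 := by
  unfold barTens; rw [dif_neg h]

theorem exists_barTens_eq_single {n : ℕ} {a : ℤ} {x z : Word} {ys : List Word}
    (h1 : ys.length = n) (h2 : ∀ y ∈ ys, nf y ≠ []) (h3 : IsPath m a (x ++ ys.flatten ++ z)) :
    ∃ g : BarGen m n, barTens k m n a x ys z = Finsupp.single g 1 ∧ g.src = a ∧ g.left = nf x ∧
      g.mid = ys.map nf ∧ g.right = nf z := by
  unfold barTens
  rw [dif_pos ⟨h1, h2, h3⟩]
  exact ⟨_, rfl, rfl, rfl, rfl, rfl⟩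

theorem rhoNegOne_mem_tightSpan (f : A k m) : rhoNegOne k m f ∈ tightSpan k m 0 := by
  rw [rhoNegOne, Finsupp.linearCombination_apply]
  refine Submodule.sum_mem _ fun x _ => ?_
  exact Submodule.smul_mem _ _ (tens_nil_mem_tightSpan _ _ _)

theorem G_barTens_nil_mem_tightSpan {n : ℕ} (a : ℤ) (ys : List Word) (z : Word) :
    G k m n (barTens k m n a [] ys z) ∈ tightSpan k m n := by
  by_cases h : ys.length = n ∧ (∀ y ∈ ys, nf y ≠ []) ∧ IsPath m a ([] ++ ys.flatten ++ z)
  · obtain ⟨g, h1, -, h2, -, -⟩ := exists_barTens_eq_single (k := k) h.1 h.2.1 h.2.2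
    rw [irr_iff.1 irr_nil] at h2
    rw [h1]
    rcases n with _ | n
    · rw [G, Finsupp.linearCombination_single, one_smul, h2]
      exact lact_nil_mem_tightSpan _ (rhoNegOne_mem_tightSpan _)
    · rw [G, Finsupp.linearCombination_single, one_smul, h2]
      exact lact_nil_mem_tightSpan _ (rho_mem_tightSpan _)
  · rw [barTens_of_not h, map_zero]; exact zero_mem _

theorem isPath_suffix {a : ℤ} {u v : Word} (h : IsPath m a (u ++ v)) : IsPath m a v :=
  ((isPath_append _ _ _ _).1 h).1

theorem map_nf_of_irr {ys : List Word} (h : ∀ y ∈ ys, Irr y) : ys.map nf = ys := by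
  conv_rhs => rw [← List.map_id ys]
  exact List.map_congr_left fun y hy => irr_iff.1 (h y hy)

theorem barTens_nil_eq_single {n : ℕ} (g : BarGen m n) :
    ∃ g' : BarGen m n, barTens k m n g.src [] g.mid g.right = Finsupp.single g' 1 ∧
      g'.src = g.src ∧ g'.left = [] ∧ g'.mid = g.mid ∧ g'.right = g.right := by
  have hp := g.isPath
  rw [List.append_assoc] at hp
  obtain ⟨g', h1, h2, h3, h4, h5⟩ := exists_barTens_eq_single (k := k) (x := []) g.mid_length
    (fun y hy => by rw [irr_iff.1 (g.mid_irr y hy).1]; exact (g.mid_irr y hy).2)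
    (by simpa using isPath_suffix hp)
  exact ⟨g', h1, h2, h3.trans (irr_iff.1 irr_nil),
    h4.trans (map_nf_of_irr fun y hy => (g.mid_irr y hy).1), h5.trans (irr_iff.1 g.right_irr)⟩

theorem G_single (n : ℕ) (g : BarGen m n) : G k m n (Finsupp.single g 1) =
    lact k m n (g.src + shift (g.mid.flatten ++ g.right)) g.left
      (ract k m n g.src g.right (splitSum k m n (g.src + shift g.right) g.mid)) := by
  induction n with
  | zero =>
    have hm : g.mid = [] := List.eq_nil_of_length_eq_zero g.mid_length
    obtain ⟨g', h1, h2, h3, h4, h5⟩ := barTens_nil_eq_single (k := k) g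
    have hp : IsPath m g.src g.right := isPath_suffix g.isPath
    rw [G, Finsupp.linearCombination_single, one_smul, h1, barDiffZero,
      Finsupp.linearCombination_single, one_smul, h2, h3, h5, List.nil_append, proj, dif_pos hp,
      rhoNegOne, Finsupp.linearCombination_single, one_smul, hm, splitSum_nil, ract_tens,
      if_pos rfl]
    simp only [irr_iff.1 g.right_irr, List.nil_append]
  | succ n ih =>
    obtain ⟨y, ys, hm⟩ : ∃ y ys, g.mid = y :: ys := by
      rcases h : g.mid with _ | ⟨y, ys⟩
      · have := g.mid_length
        rw [h] at this
        simp at this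
      · exact ⟨y, ys, rfl⟩
    obtain ⟨g', h1, h2, h3, h4, h5⟩ := barTens_nil_eq_single (k := k) g
    have hlen : ys.length = n := by
      have := g.mid_length
      rw [hm] at this
      simpa using this
    have hirr : ∀ x ∈ y :: ys, Irr x := fun x hx => (g.mid_irr x (hm ▸ hx)).1
    have hp := g.isPath
    rw [List.append_assoc] at hp
    have hp1 := isPath_suffix hp
    have hp2 : IsPath m (g.src + shift g.right) (y :: ys).flatten := by
      rw [← hm]; exact ((isPath_append _ _ _ _).1 hp1).2
    rw [hm, List.flatten_cons] at hp1
    obtain ⟨g₂, e1, e2, e3, e4, e5⟩ := exists_barTens_eq_single (k := k) (a := g.src) (x := y)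
      (z := g.right) hlen (fun x hx => by
        have := g.mid_irr x (by rw [hm]; exact List.mem_cons_of_mem _ hx)
        rw [irr_iff.1 this.1]; exact this.2) hp1
    rw [irr_iff.1 (hirr y (by simp))] at e3
    rw [map_nf_of_irr fun x hx => hirr x (List.mem_cons_of_mem _ hx)] at e4
    rw [irr_iff.1 g.right_irr] at e5
    rw [G, Finsupp.linearCombination_single, one_smul]
    congr 1
    rw [h1, barDiff, Finsupp.linearCombination_single, one_smul, h2, h3, h4, h5, hm]
    simp only [map_add, map_sum, map_smul, List.nil_append, List.headD_cons, List.tail_cons]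
    -- The first summand and the inner summands of the bar differential have left factor `1`, so `ρ`
    -- kills their images under `G`; only the summand with left factor `y` remains.
    rw [rho_apply_tight (G_barTens_nil_mem_tightSpan _ _ _), Finset.sum_eq_zero, zero_add,
      zero_add, e1, ih, e2, e3, e4, e5, splitSum_cons hlen hirr hp2, map_smul, ← rho_ract,
      lact_ract]
    · rw [show g.src + shift (ys.flatten ++ g.right) = g.src + shift g.right + shift ys.flatten by
        rw [shift_append]; ring]
    · intro j _
      rw [rho_apply_tight (G_barTens_nil_mem_tightSpan _ _ _), smul_zero]

theorem G_barTens {n : ℕ} {i : ℤ} {ys : List Word} (hn : ys.length = n)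
    (hys : ∀ y ∈ ys, Irr y ∧ y ≠ []) (hp : IsPath m i ys.flatten) (x z : IrrPath m) :
    G k m n (if x.src = i + shift ys.flatten ∧ z.src + shift z.word = i then
      barTens k m n z.src x.word ys z.word else 0) =
    ract k m n z.src z.word (lact k m n x.src x.word (splitSum k m n i ys)) := by
  split_ifs with h
  · obtain ⟨h1, rfl⟩ := h
    obtain ⟨g, e1, e2, e3, e4, e5⟩ := exists_barTens_eq_single (k := k) (a := z.src) (x := x.word)
      (z := z.word) hn (fun y hy => by rw [irr_iff.1 (hys y hy).1]; exact (hys y hy).2) (by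
        rw [isPath_append, isPath_append, ← h1]
        exact ⟨z.isPath, hp, x.isPath⟩)
    rw [irr_iff.1 x.irr] at e3
    rw [map_nf_of_irr fun y hy => (hys y hy).1] at e4
    rw [irr_iff.1 z.irr] at e5
    have e : z.src + shift (ys.flatten ++ z.word) = x.src := by
      rw [h1, shift_append]; ring
    rw [e1, G_single, e2, e3, e4, e5, lact_ract, e]
  · rw [map_zero, ract_lact_splitSum_eq_zero h]

theorem G_bar {n : ℕ} {i : ℤ} {ys : List Word} (hn : ys.length = n)
    (hys : ∀ y ∈ ys, Irr y ∧ y ≠ []) (hp : IsPath m i ys.flatten) (a b : A k m) :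
    G k m n (bar n a i ys b) = rmul (lmul a (splitSum k m n i ys)) b := by
  simp only [bar, rmul, lmul, Finsupp.sum, map_sum, map_smul, G_barTens hn hys hp,
    Finset.smul_sum, smul_smul]
  rw [Finset.sum_comm]
  refine Finset.sum_congr rfl fun z _ => Finset.sum_congr rfl fun x _ => ?_
  rw [mul_comm]

end
end KLRW

/-! ### Assembly of the theorem -/

theorem mainTheorem10 {k : Type*} [Field k] (m : ℕ) :
    (∀ (n : ℕ) (t : KLRW.Gen m n),
      (Function.support (KLRW.rhoSummand k m n (KLRW.diff k m n) t)).Finite) ∧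
    ∀ (n : ℕ) (i : ℤ) (ys : List KLRW.Word), ys.length = n →
      (∀ y ∈ ys, KLRW.Irr y ∧ y ≠ []) → KLRW.IsPath m i ys.flatten →
      (KLRW.splitTerms k m n i ys.flatten).Finite ∧
      (∀ a b : KLRW.A k m,
        KLRW.G k m n (KLRW.bar n a i ys b) =
          KLRW.rmul (KLRW.lmul a
            (∑ᶠ t ∈ KLRW.splitTerms k m n i ys.flatten, Finsupp.single t (1 : k))) b) ∧
      (∀ (yn : KLRW.Word) (ys' : List KLRW.Word), ys = yn :: ys' → ys' ≠ [] →
        KLRW.splitTerms k m n i ys.flatten = KLRW.strandTerms m n i yn ys') := by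
  refine ⟨fun n t => KLRW.finite_support_rhoSummand n t, fun n i ys hn hys hp =>
    ⟨KLRW.finite_splitTerms n i _, fun a b => KLRW.G_bar hn hys hp a b, ?_⟩⟩
  rintro yn ys' rfl hne
  rcases ys' with _ | ⟨y, ys⟩
  · exact absurd rfl hne
  · subst hn
    exact KLRW.splitTerms_eq_strandTerms rfl (fun x hx => (hys x hx).1) hp
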